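/- Let $G$ be an abelian group with neutral element $e$ (written additively below), $\mathbb K$ a field of characteristic $0$, and $\varepsilon:G\times G\to\mathbb K^\times$ an antisymmetric bicharacter. Let $\mathfrak g=\bigoplus_{g\in G}\mathfrak g_g$ be a finite-dimensional color Lie algebra, i.e. a $G$-graded vector space with a bilinear bracket such that $[\mathfrak g_a,\mathfrak g_b]\subseteq\mathfrak g_{a+b}$, $[x,y]=-\varepsilon(|x|,|y|)[y,x]$ and $\varepsilon(|z|,|x|)[x,[y,z]]+\varepsilon(|x|,|y|)[y,[z,x]]+\varepsilon(|y|,|z|)[z,[x,y]]=0$ for homogeneous $x,y,z$. Let $U(\mathfrak g)$ be its universal enveloping algebra, the quotient of the tensor algebra by the two-sided ideal generated by the elements $x\otimes y-\varepsilon(|x|,|y|)\,y\otimes x-[x,y]$ ($x,y$ homogeneous), with its $G$-grading and the canonical map $i:\mathfrak g\to U(\mathfrak g)$. A graded deformation of $\mathfrak g$ is a series $\mu_t=\sum_{n\ge0}\mu_nt^n$ of $\varepsilon$-skew-symmetric bilinear maps of degree $e$ on $\mathfrak g$, with $\mu_0=[\cdot,\cdot]$, which is a color Lie bracket on the $\mathbb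 K[[t]]$-module $\mathfrak g[[t]]$. A graded associative deformation of $U(\mathfrak g)$ is a series $\pi_t=\sum_{n\ge0}\pi_nt^n$ of bilinear maps of degree $e$ on $U(\mathfrak g)$, with $\pi_0$ the product of $U(\mathfrak g)$, which is associative on $U(\mathfrak g)[[t]]$. An equivalence from $\pi_t$ to $\pi'_t$ is a series $\varphi_t=\mathrm{id}+\sum_{n\ge1}\varphi_nt^n$ of linear maps of degree $e$ with $\varphi_t(\pi_t(u,v))=\pi'_t(\varphi_t(u),\varphi_t(v))$; $\pi_t$ is trivial if it is equivalent to the undeformed product. We say that $\pi_t$ extends $\mu_t$ if $$\pi_n(i(x),i(y))-\varepsilon(|x|,|y|)\,\pi_n(i(y),i(x))=i(\mu_n(x,y))\qquad\text{for all }n\ge0\text{ and homogeneous }x,y\in\mathfrak g.$$ **Theorem.** Let $\mu_t$ be a graded deformation of $\mathfrak g$. 1. There is a graded associative deformation $\pi_t$ of $U(\mathfrak g)$ that extends $\mu_t$ and has $1\in U(\mathfrak g)$ as its unit element. 2. It is unique: for any two graded associative deformations $\pi_t,\pi'_t$ of $U(\mathfrak g)$ that extend $\mu_t$, there is exactly one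 equivalence $\varphi_t$ from $\pi_t$ to $\pi'_t$ that is the identity on $i(\mathfrak g)$. 3. Let $e_1,\dots,e_m$ be a homogeneous basis of $\mathfrak g$, $e_i\in\mathfrak g_{d_i}$, and let $I=(i_1,\dots,i_k)$ run through the finite nondecreasing sequences of indices in which an index $i$ may be repeated only if $\varepsilon(d_i,d_i)=1$. Let $U(\mathfrak g[[t]])$ be the universal enveloping algebra over $\mathbb K[[t]]$ of the color Lie algebra $(\mathfrak g[[t]],\mu_t)$. The ordered monomials $y_I=y_{i_1}\cdots y_{i_k}$ in the images $y_i$ of the $e_i$ form a basis of $U(\mathfrak g)$ over $\mathbb K$, and the corresponding ordered monomials $y'_I$ in $U(\mathfrak g[[t]])$ form a basis of it over $\mathbb K[[t]]$. Let $\Phi:\mathbb K[[t]]\otimes_{\mathbb K}U(\mathfrak g)\to U(\mathfrak g[[t]])$ be the $\mathbb K[[t]]$-linear isomorphism with $\Phi(1\otimes y_I)=y'_I$. Then $\pi_t(u,v)=\Phi^{-1}(\Phi(u)\Phi(v))$, $u,v\in U(\mathfrak g)$, defines a graded associative deformation of $U(\mathfrak g)$ that extends $\mu_t$, and it is the only one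 that extends $\mu_t$, has unit element $1$, and in which, for every $I$, the $\pi_t$-product of $y_{i_1},\dots,y_{i_k}$ equals $y_I$. 4. For every graded associative deformation $\pi_t$ of $U(\mathfrak g)$ that extends $\mu_t$, the map $\pi_1$ is a Hochschild $2$-cocycle of degree $e$, and $i(\mu_1(x,y))=\pi_1(i(x),i(y))-\varepsilon(|x|,|y|)\,\pi_1(i(y),i(x))$ for homogeneous $x,y\in\mathfrak g$. For every linear map $f:U(\mathfrak g)\to U(\mathfrak g)$ of degree $e$, with Hochschild coboundary $(\delta_Hf)(u,v)=u f(v)-f(uv)+f(u)v$, and for homogeneous $x,y\in\mathfrak g$, $$(\delta_Hf)(i(x),i(y))-\varepsilon(|x|,|y|)\,(\delta_Hf)(i(y),i(x))=x\cdot f(i(y))-\varepsilon(|x|,|y|)\,y\cdot f(i(x))-f(i([x,y])),$$ where $\mathfrak g$ acts on homogeneous $u\in U(\mathfrak g)$ by $x\cdot u=i(x)u-\varepsilon(|x|,|u|)\,u\,i(x)$, and where $f(i(x))$, $f(i(y))$ are given the degrees $|x|$, $|y|$; the right-hand side is the Chevalley–Eilenberg coboundary of $f\circ i$. 5. If the class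 $[\mu_1]\in H^2(\mathfrak g,\mathfrak g)_e$ in the degree $e$ Chevalley–Eilenberg cohomology is nonzero, then every graded associative deformation $\pi_t$ of $U(\mathfrak g)$ that extends $\mu_t$ is nontrivial, and $\pi_1$ is not the Hochschild coboundary of a linear map of degree $e$. -/

import Mathlib

open scoped TensorProduct PowerSeries

set_option maxSynthPendingDepth 3

noncomputable section

namespace ColorLie

/-! ### Color Lie algebras -/

/-- An antisymmetric bicharacter of the abelian group `G` (written additively) with values
in the units of `R`. -/
structure Bicharacter (G : Type*) [AddCommGroup G] (R : Type*) [CommRing R] where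
  toFun : G → G → Rˣ
  mul_swap : ∀ g h, toFun g h * toFun h g = 1
  add_right : ∀ g h k, toFun g (h + k) = toFun g h * toFun g k
  add_left : ∀ g h k, toFun (g + h) k = toFun g k * toFun h k

/-- The value of a bicharacter, as an element of the ring of scalars. -/
def Bicharacter.val {G : Type*} [AddCommGroup G] {R : Type*} [CommRing R]
    (ε : Bicharacter G R) (g h : G) : R :=
  (ε.toFun g h : R)

theorem Bicharacter.val_mul_swap {G : Type*} [AddCommGroup G] {R : Type*} [CommRing R]
    (ε : Bicharacter G R) (g h : G) : ε.val g h * ε.val h g = 1 := by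
  rw [val, val, ← Units.val_mul, ε.mul_swap, Units.val_one]

theorem Bicharacter.val_add_right {G : Type*} [AddCommGroup G] {R : Type*} [CommRing R]
    (ε : Bicharacter G R) (g h k : G) : ε.val g (h + k) = ε.val g h * ε.val g k := by
  rw [val, val, val, ε.add_right, Units.val_mul]

/-- Extension of scalars of a bicharacter. -/
def Bicharacter.map {G : Type*} [AddCommGroup G] {R S : Type*} [CommRing R] [CommRing S]
    (ε : Bicharacter G R) (f : R →+* S) : Bicharacter G S where
  toFun g h := Units.map (f : R →* S) (ε.toFun g h)
  mul_swap g h := by rw [← map_mul, ε.mul_swap, map_one]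
  add_right g h k := by rw [ε.add_right, map_mul]
  add_left g h k := by rw [ε.add_left, map_mul]

/-- `br` is a color Lie bracket (an `ε`-Lie bracket) on the module `L`, with respect to the
submodules `𝓛 g` of homogeneous elements of degree `g`. -/
structure IsColorLieBracket {G : Type*} [AddCommGroup G] {R : Type*} [CommRing R]
    (ε : Bicharacter G R) {L : Type*} [AddCommGroup L] [Module R L]
    (𝓛 : G → Submodule R L) (br : L →ₗ[R] L →ₗ[R] L) : Prop where
  degree : ∀ {a b : G} {x y : L}, x ∈ 𝓛 a → y ∈ 𝓛 b → br x y ∈ 𝓛 (a + b)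
  skew : ∀ {a b : G} {x y : L}, x ∈ 𝓛 a → y ∈ 𝓛 b → br x y = -(ε.val a b • br y x)
  jacobi : ∀ {a b c : G} {x y z : L}, x ∈ 𝓛 a → y ∈ 𝓛 b → z ∈ 𝓛 c →
    ε.val c a • br x (br y z) + ε.val a b • br y (br z x) + ε.val b c • br z (br x y) = 0

/-- A color Lie algebra: a graded module `L = ⨁ g, 𝓛 g` with a color Lie bracket. -/
structure IsColorLieAlgebra {G : Type*} [AddCommGroup G] [DecidableEq G]
    {R : Type*} [CommRing R] (ε : Bicharacter G R) {L : Type*} [AddCommGroup L] [Module R L]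
    (𝓛 : G → Submodule R L) (br : L →ₗ[R] L →ₗ[R] L) : Prop where
  isInternal : DirectSum.IsInternal 𝓛
  isBracket : IsColorLieBracket ε 𝓛 br

/-! ### The universal enveloping algebra -/

/-- The relations `x ⊗ y = ε(|x|,|y|) y ⊗ x + [x, y]`, for homogeneous `x`, `y`, in the tensor
algebra of `L`. -/
inductive EnvelopingRel {G : Type*} [AddCommGroup G] {R : Type*} [CommRing R]
    (ε : Bicharacter G R) {L : Type*} [AddCommGroup L] [Module R L]
    (𝓛 : G → Submodule R L) (br : L →ₗ[R] L →ₗ[R] L) :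
    TensorAlgebra R L → TensorAlgebra R L → Prop
  | bracket {a b : G} {x y : L} (hx : x ∈ 𝓛 a) (hy : y ∈ 𝓛 b) :
      EnvelopingRel ε 𝓛 br (TensorAlgebra.ι R x * TensorAlgebra.ι R y)
        (ε.val a b • (TensorAlgebra.ι R y * TensorAlgebra.ι R x) + TensorAlgebra.ι R (br x y))

/-- The universal enveloping algebra `U(L)`: the quotient of the tensor algebra by the two-sided
ideal generated by `x ⊗ y - ε(|x|,|y|) y ⊗ x - [x, y]`, `x` and `y` homogeneous. -/
def Enveloping {G : Type*} [AddCommGroup G] {R : Type*} [CommRing R]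
    (ε : Bicharacter G R) {L : Type*} [AddCommGroup L] [Module R L]
    (𝓛 : G → Submodule R L) (br : L →ₗ[R] L →ₗ[R] L) : Type _ :=
  RingQuot (EnvelopingRel ε 𝓛 br)

namespace Enveloping

section

variable {G : Type*} [AddCommGroup G] {R : Type*} [CommRing R]
    (ε : Bicharacter G R) {L : Type*} [AddCommGroup L] [Module R L]
    (𝓛 : G → Submodule R L) (br : L →ₗ[R] L →ₗ[R] L)

instance : Ring (Enveloping ε 𝓛 br) :=
  inferInstanceAs (Ring (RingQuot (EnvelopingRel ε 𝓛 br)))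

instance : Algebra R (Enveloping ε 𝓛 br) :=
  inferInstanceAs (Algebra R (RingQuot (EnvelopingRel ε 𝓛 br)))

/-- The canonical map `L → U(L)`. -/
def incl : L →ₗ[R] Enveloping ε 𝓛 br :=
  (RingQuot.mkAlgHom R (EnvelopingRel ε 𝓛 br)).toLinearMap ∘ₗ TensorAlgebra.ι R

/-- The homogeneous elements of degree `g` of `U(L)`: the span of the products `x₁ ⋯ xₙ` of
homogeneous elements of `L` whose degrees add up to `g`. -/
def grading (g : G) : Submodule R (Enveloping ε 𝓛 br) :=
  Submodule.span R {u | ∃ l : List (G × L), (∀ p ∈ l, p.2 ∈ 𝓛 p.1) ∧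
    (l.map Prod.fst).sum = g ∧ u = (l.map fun p => incl ε 𝓛 br p.2).prod}

end

end Enveloping

/-! ### Formal power series with coefficients in a module -/

/-- The convolution of two sequences along a biadditive map. -/
def conv {A B C : Type*} [AddCommMonoid C] (f : A → B → C) (x : ℕ → A) (y : ℕ → B) (n : ℕ) : C :=
  ∑ p ∈ Finset.HasAntidiagonal.antidiagonal n, f (x p.1) (y p.2)

theorem conv_assoc {A B C D E F : Type*} [AddCommGroup A] [AddCommGroup B] [AddCommGroup C]
    [AddCommGroup D] [AddCommGroup E] [AddCommGroup F]
    (f : A → B → D) (g : D →+ C →+ F) (f' : B → C → E) (g' : A →+ E →+ F)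
    (h : ∀ a b c, g (f a b) c = g' a (f' b c)) (x : ℕ → A) (y : ℕ → B) (z : ℕ → C) :
    conv (fun d c => g d c) (conv f x y) z = conv (fun a e => g' a e) x (conv f' y z) := by
  funext n
  simp only [conv, map_sum, AddMonoidHom.finsetSum_apply, h, Finset.sum_sigma']
  apply Finset.sum_nbij' (fun ⟨⟨_, k⟩, ⟨i, j⟩⟩ => ⟨(i, j + k), (j, k)⟩)
    (fun ⟨⟨i, _⟩, ⟨j, k⟩⟩ => ⟨(i + j, k), (i, j)⟩) <;>
  grind [Finset.HasAntidiagonal.mem_antidiagonal]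

theorem conv_left_comm {A B C D E F : Type*} [AddCommGroup A] [AddCommGroup B] [AddCommGroup C]
    [AddCommGroup D] [AddCommGroup E] [AddCommGroup F]
    (g : B → C → D) (f : A →+ D →+ F) (f' : A → C → E) (g' : B →+ E →+ F)
    (h : ∀ a b c, f a (g b c) = g' b (f' a c)) (x : ℕ → A) (y : ℕ → B) (z : ℕ → C) :
    conv (fun a d => f a d) x (conv g y z) = conv (fun b e => g' b e) y (conv f' x z) := by
  funext n
  simp only [conv, map_sum, h, Finset.sum_sigma']
  apply Finset.sum_nbij' (fun ⟨⟨i, _⟩, ⟨j, k⟩⟩ => ⟨(j, i + k), (i, k)⟩)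
    (fun ⟨⟨j, _⟩, ⟨i, k⟩⟩ => ⟨(i, j + k), (j, k)⟩) <;>
  grind [Finset.HasAntidiagonal.mem_antidiagonal]

/-- `E[[t]]`: the power series `∑ xₙ tⁿ` with coefficients `xₙ` in `E`. -/
@[ext]
structure Series (E : Type*) where
  coeff : ℕ → E

namespace Series

section

variable {K : Type*} [CommRing K] {E : Type*} [AddCommGroup E] [Module K E]
    {F : Type*} [AddCommGroup F] [Module K F] {H : Type*} [AddCommGroup H] [Module K H]

/-- Power series and their sequences of coefficients. -/
def coeffEquiv (E : Type*) : Series E ≃ (ℕ → E) where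
  toFun := coeff
  invFun := mk
  left_inv _ := rfl
  right_inv _ := rfl

instance : AddCommGroup (Series E) := (coeffEquiv E).addCommGroup

instance : Module K (Series E) := (coeffEquiv E).module K

@[simp] theorem coeff_add (x y : Series E) : (x + y).coeff = x.coeff + y.coeff := rfl

@[simp] theorem coeff_zero : (0 : Series E).coeff = 0 := rfl

/-- The action of `K[[t]]` on `E[[t]]`: `(∑ aᵢ tⁱ) (∑ xⱼ tʲ) = ∑ₙ (∑_{i + j = n} aᵢ xⱼ) tⁿ`. -/
instance : SMul K⟦X⟧ (Series E) where
  smul a x := ⟨conv (fun (r : K) (e : E) => r • e) (fun n => PowerSeries.coeff n a) x.coeff⟩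

theorem coeff_smul (a : K⟦X⟧) (x : Series E) : (a • x).coeff =
    conv (fun (r : K) (e : E) => r • e) (fun n => PowerSeries.coeff n a) x.coeff := rfl

theorem coeff_smul_apply (a : K⟦X⟧) (x : Series E) (n : ℕ) : (a • x).coeff n =
    ∑ p ∈ Finset.HasAntidiagonal.antidiagonal n, PowerSeries.coeff p.1 a • x.coeff p.2 := rfl

theorem coeff_C_smul (r : K) (x : Series E) (n : ℕ) :
    ((PowerSeries.C r : K⟦X⟧) • x).coeff n = r • x.coeff n := by
  rw [coeff_smul_apply, Finset.sum_eq_single (0, n)]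
  · simp
  · rintro ⟨i, j⟩ h hne
    have : i ≠ 0 := by
      rintro rfl
      apply hne
      simpa using h
    simp [PowerSeries.coeff_C, this]
  · simp

/-- Scalar multiplication as a biadditive map. -/
def smulHom (K : Type*) [CommRing K] (E : Type*) [AddCommGroup E] [Module K E] : K →+ E →+ E :=
  AddMonoidHom.mk' (fun r => DistribSMul.toAddMonoidHom E r) fun r s => by
    ext e; exact add_smul r s e

/-- Evaluation of linear maps as a biadditive map. -/
def evalHom (K : Type*) [CommRing K] (E : Type*) [AddCommGroup E] [Module K E]
    (F : Type*) [AddCommGroup F] [Module K F] : (E →ₗ[K] F) →+ E →+ F :=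
  AddMonoidHom.mk' (fun f => f.toAddMonoidHom) fun f g => by
    ext e; rfl

instance : Module K⟦X⟧ (Series E) where
  one_smul x := by
    ext n
    have := coeff_C_smul (1 : K) x n
    rwa [map_one, one_smul] at this
  mul_smul a b x := by
    have h := conv_assoc (fun r s : K => r * s) (smulHom K E) (fun (r : K) (e : E) => r • e)
      (smulHom K E) (fun r s e => mul_smul r s e) (fun n => PowerSeries.coeff n a)
      (fun n => PowerSeries.coeff n b) x.coeff
    have hab : (fun n => PowerSeries.coeff n (a * b)) = conv (fun r s : K => r * s)
        (fun n => PowerSeries.coeff n a) (fun n => PowerSeries.coeff n b) := by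
      funext n
      exact PowerSeries.coeff_mul n a b
    apply Series.ext
    rw [coeff_smul (a * b), hab]
    exact h
  smul_zero a := by
    ext n
    simp [coeff_smul_apply]
  smul_add a x y := by
    ext n
    simp [coeff_smul_apply, Finset.sum_add_distrib]
  add_smul a b x := by
    ext n
    simp [coeff_smul_apply, add_smul, Finset.sum_add_distrib]
  zero_smul x := by
    ext n
    simp [coeff_smul_apply]

/-- The constant power series `e + 0 t + 0 t² + ⋯`. -/
def const (e : E) : Series E := ⟨fun n => if n = 0 then e else 0⟩

/-- The canonical map `K[[t]] ⊗ E → E[[t]]`, which sends `a ⊗ e` to `∑ aₙ e tⁿ`. -/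
def ofTensor (K : Type*) [CommRing K] (E : Type*) [AddCommGroup E] [Module K E] :
    K⟦X⟧ ⊗[K] E →ₗ[K] Series E :=
  TensorProduct.lift (LinearMap.mk₂ K
    (fun (a : K⟦X⟧) (e : E) => (⟨fun n => PowerSeries.coeff n a • e⟩ : Series E))
    (fun a b e => by
      ext n
      simp [add_smul])
    (fun r a e => by
      ext n
      exact (by simp [mul_smul] : PowerSeries.coeff n (r • a) • e = r • PowerSeries.coeff n a • e))
    (fun a e f => by
      ext n
      exact smul_add (PowerSeries.coeff n a) e f)
    (fun r a e => by
      ext n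
      exact smul_comm (PowerSeries.coeff n a) r e))

/-- The submodule `E'[[t]]` of `E[[t]]`. -/
def submodule (E' : Submodule K E) : Submodule K⟦X⟧ (Series E) where
  carrier := {x | ∀ n, x.coeff n ∈ E'}
  add_mem' hx hy n := E'.add_mem (hx n) (hy n)
  zero_mem' _ := E'.zero_mem
  smul_mem' a x hx n := by
    rw [coeff_smul_apply]
    exact E'.sum_mem fun p _ => E'.smul_mem _ (hx p.2)

/-- The extension of a sequence `(fₙ)` of linear maps to the `K[[t]]`-linear map
`f_t = ∑ fₙ tⁿ` on power series: `f_t (∑ xⱼ tʲ) = ∑ₙ (∑_{i + j = n} fᵢ(xⱼ)) tⁿ`. -/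
def map (f : ℕ → E →ₗ[K] F) : Series E →ₗ[K⟦X⟧] Series F where
  toFun x := ⟨conv (fun (g : E →ₗ[K] F) (e : E) => g e) f x.coeff⟩
  map_add' x y := by
    ext n
    simp [conv, Finset.sum_add_distrib]
  map_smul' a x := Series.ext <|
    conv_left_comm (fun (r : K) (e : E) => r • e) (evalHom K E F)
      (fun (g : E →ₗ[K] F) (e : E) => g e) (smulHom K F) (fun g r e => map_smul g r e) f
      (fun n => PowerSeries.coeff n a) x.coeff

theorem coeff_map (f : ℕ → E →ₗ[K] F) (x : Series E) (n : ℕ) : (map f x).coeff n =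
    ∑ p ∈ Finset.HasAntidiagonal.antidiagonal n, f p.1 (x.coeff p.2) := rfl

/-- The extension of a sequence `(mₙ)` of bilinear maps to the `K[[t]]`-bilinear map
`m_t = ∑ mₙ tⁿ` on power series:
`m_t (∑ xᵢ tⁱ) (∑ yⱼ tʲ) = ∑ᵣ (∑_{n + i + j = r} mₙ(xᵢ, yⱼ)) tʳ`. -/
def map₂ (m : ℕ → E →ₗ[K] F →ₗ[K] H) : Series E →ₗ[K⟦X⟧] Series F →ₗ[K⟦X⟧] Series H where
  toFun x := map (map m x).coeff
  map_add' x y := by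
    refine LinearMap.ext fun z => ?_
    rw [map_add]
    ext n
    simp [coeff_map, Finset.sum_add_distrib]
  map_smul' a x := by
    refine LinearMap.ext fun z => ?_
    rw [map_smul]
    exact Series.ext <| conv_assoc (fun (r : K) (g : F →ₗ[K] H) => r • g) (evalHom K F H)
      (fun (g : F →ₗ[K] H) (e : F) => g e) (smulHom K H) (fun r g e => rfl)
      (fun n => PowerSeries.coeff n a) (map m x).coeff z.coeff

theorem coeff_map₂ (m : ℕ → E →ₗ[K] F →ₗ[K] H) (x : Series E) (y : Series F) (r : ℕ) :
    (map₂ m x y).coeff r = ∑ p ∈ Finset.HasAntidiagonal.antidiagonal r,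
      ∑ q ∈ Finset.HasAntidiagonal.antidiagonal p.1, m q.1 (x.coeff q.2) (y.coeff p.2) := by
  change (map (map m x).coeff y).coeff r = _
  simp [coeff_map]

end

end Series

/-! ### Degree zero Chevalley-Eilenberg cohomology, in degree two -/

section ChevalleyEilenberg

variable {G : Type*} [AddCommGroup G] {K : Type*} [CommRing K] (ε : Bicharacter G K)
    {L : Type*} [AddCommGroup L] [Module K L] (𝓛 : G → Submodule K L) (br : L →ₗ[K] L →ₗ[K] L)
    {N : Type*} [AddCommGroup N] [Module K N]

/-- A linear map of degree zero (the neutral element of `G`) between graded modules. -/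
def IsDegreeZero (𝓛 : G → Submodule K L) (𝓝 : G → Submodule K N) (f : L →ₗ[K] N) : Prop :=
  ∀ ⦃a : G⦄ ⦃x : L⦄, x ∈ 𝓛 a → f x ∈ 𝓝 a

/-- The Chevalley-Eilenberg coboundary of a degree zero `1`-cochain `f : L → N`, evaluated at
elements `x`, `y` of degrees `a`, `b`. Here `act c d z u` is the action of the element `z` of `L`,
of degree `c`, on the element `u` of `N`, of degree `d`. -/
def ceDelta₁ (act : G → G → L → N → N) (f : L →ₗ[K] N) (a b : G) (x y : L) : N :=
  act a b x (f y) - ε.val a b • act b a y (f x) - f (br x y)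

/-- The Chevalley-Eilenberg coboundary of a degree zero `2`-cochain `f` with values in the adjoint
module, evaluated at elements `x`, `y`, `z` of degrees `a`, `b`, `c`. -/
def ceDelta₂ (f : L →ₗ[K] L →ₗ[K] L) (a b c : G) (x y z : L) : L :=
  br x (f y z) - ε.val a b • br y (f x z) + (ε.val a c * ε.val b c) • br z (f x y)
    - f (br x y) z + ε.val b c • f (br x z) y - (ε.val a b * ε.val a c) • f (br y z) x

/-- `C²(L, L)_e`: the `ε`-skew-symmetric bilinear maps of degree zero. -/
def cochains₂ : Submodule K (L →ₗ[K] L →ₗ[K] L) where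
  carrier := {f | ∀ ⦃a b : G⦄ ⦃x y : L⦄, x ∈ 𝓛 a → y ∈ 𝓛 b →
    f x y ∈ 𝓛 (a + b) ∧ f x y = -(ε.val a b • f y x)}
  add_mem' hf hg a b x y hx hy := by
    obtain ⟨h1, h2⟩ := hf hx hy
    obtain ⟨h3, h4⟩ := hg hx hy
    refine ⟨(𝓛 (a + b)).add_mem h1 h3, ?_⟩
    simp only [LinearMap.add_apply]
    rw [h2, h4]
    module
  zero_mem' a b x y hx hy := by simp
  smul_mem' r f hf a b x y hx hy := by
    obtain ⟨h1, h2⟩ := hf hx hy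
    refine ⟨(𝓛 (a + b)).smul_mem r h1, ?_⟩
    simp only [LinearMap.smul_apply]
    rw [h2]
    module

/-- `Z²(L, L)_e`: the degree zero `2`-cocycles. -/
def cocycles₂ : Submodule K (L →ₗ[K] L →ₗ[K] L) where
  carrier := {f | f ∈ cochains₂ ε 𝓛 ∧ ∀ ⦃a b c : G⦄ ⦃x y z : L⦄, x ∈ 𝓛 a → y ∈ 𝓛 b → z ∈ 𝓛 c →
    ceDelta₂ ε br f a b c x y z = 0}
  add_mem' := by
    rintro f g ⟨hf, hf'⟩ ⟨hg, hg'⟩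
    refine ⟨Submodule.add_mem _ hf hg, fun a b c x y z hx hy hz => ?_⟩
    have h := congrArg₂ (· + ·) (hf' hx hy hz) (hg' hx hy hz)
    simp only [ceDelta₂, add_zero] at h ⊢
    rw [← h]
    simp only [LinearMap.add_apply, map_add]
    module
  zero_mem' := ⟨Submodule.zero_mem _, fun a b c x y z _ _ _ => by simp [ceDelta₂]⟩
  smul_mem' := by
    rintro r f ⟨hf, hf'⟩
    refine ⟨Submodule.smul_mem _ r hf, fun a b c x y z hx hy hz => ?_⟩
    have h := congrArg (r • ·) (hf' hx hy hz)
    simp only [ceDelta₂, smul_zero] at h ⊢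
    rw [← h]
    simp only [LinearMap.smul_apply, map_smul]
    module

/-- `B²(L, L)_e`: the coboundaries of the degree zero linear maps `L → L`. -/
def coboundaries₂ : Submodule K (L →ₗ[K] L →ₗ[K] L) where
  carrier := {f | f ∈ cochains₂ ε 𝓛 ∧ ∃ φ : L →ₗ[K] L, IsDegreeZero 𝓛 𝓛 φ ∧
    ∀ ⦃a b : G⦄ ⦃x y : L⦄, x ∈ 𝓛 a → y ∈ 𝓛 b →
      f x y = ceDelta₁ ε br (fun _ _ z => br z) φ a b x y}
  add_mem' := by
    rintro f g ⟨hf, φ, hφ, hf'⟩ ⟨hg, ψ, hψ, hg'⟩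
    refine ⟨Submodule.add_mem _ hf hg, φ + ψ, fun a x hx => (𝓛 a).add_mem (hφ hx) (hψ hx),
      fun a b x y hx hy => ?_⟩
    rw [LinearMap.add_apply, LinearMap.add_apply, hf' hx hy, hg' hx hy]
    simp only [ceDelta₁, LinearMap.add_apply, map_add]
    module
  zero_mem' := ⟨Submodule.zero_mem _, 0, fun a x _ => (𝓛 a).zero_mem,
    fun a b x y _ _ => by simp [ceDelta₁]⟩
  smul_mem' := by
    rintro r f ⟨hf, φ, hφ, hf'⟩
    refine ⟨Submodule.smul_mem _ r hf, r • φ, fun a x hx => (𝓛 a).smul_mem r (hφ hx),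
      fun a b x y hx hy => ?_⟩
    rw [LinearMap.smul_apply, LinearMap.smul_apply, hf' hx hy]
    simp only [ceDelta₁, LinearMap.smul_apply, map_smul]
    module

/-- `H²(L, L)_e = Z²(L, L)_e / B²(L, L)_e`. -/
abbrev H₂ : Type _ :=
  cocycles₂ ε 𝓛 br ⧸ (coboundaries₂ ε 𝓛 br).submoduleOf (cocycles₂ ε 𝓛 br)

end ChevalleyEilenberg

/-! ### Graded deformations of a color Lie algebra -/

section LieDeformation

variable {G : Type*} [AddCommGroup G] {K : Type*} [CommRing K] (ε : Bicharacter G K)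
    {L : Type*} [AddCommGroup L] [Module K L] (𝓛 : G → Submodule K L) (br : L →ₗ[K] L →ₗ[K] L)

/-- `μ_t = ∑ μₙ tⁿ` is a graded deformation (of degree zero) of the color Lie algebra `(L, br)`:
`μ₀ = br`, each `μₙ` lies in `C²(L, L)_e`, and `μ_t` is a color Lie bracket on `L[[t]]`. -/
structure IsLieDeformation (μ : ℕ → L →ₗ[K] L →ₗ[K] L) : Prop where
  zero : μ 0 = br
  mem_cochains : ∀ n, μ n ∈ cochains₂ ε 𝓛
  isBracket : IsColorLieBracket (ε.map PowerSeries.C) (fun g => Series.submodule (𝓛 g))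
    (Series.map₂ μ)

/-- The infinitesimal `μ₁` of a graded deformation is a cocycle. -/
theorem IsLieDeformation.mem_cocycles {μ : ℕ → L →ₗ[K] L →ₗ[K] L}
    (hμ : IsLieDeformation ε 𝓛 br μ) : μ 1 ∈ cocycles₂ ε 𝓛 br := by
  refine ⟨hμ.mem_cochains 1, fun a b c x y z hx hy hz => ?_⟩
  have hc : ∀ {g : G} {w : L}, w ∈ 𝓛 g → Series.const w ∈ Series.submodule (𝓛 g) := by
    intro g w hw n
    by_cases hn : n = 0
    · simpa [Series.const, hn] using hw
    · simp [Series.const, hn]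
  have hj := congrArg (fun s : Series L => s.coeff 1)
    (hμ.isBracket.jacobi (hc hx) (hc hy) (hc hz))
  have h1 : Finset.HasAntidiagonal.antidiagonal 1 = {((0 : ℕ), (1 : ℕ)), (1, 0)} := rfl
  have hval : ∀ g h, (ε.map (PowerSeries.C (R := K))).val g h = PowerSeries.C (ε.val g h) :=
    fun _ _ => rfl
  simp [hval, Series.coeff_C_smul, Series.coeff_map₂, h1, Series.const, hμ.zero] at hj
  have hab : ε.val a b * ε.val b a = 1 := ε.val_mul_swap a b
  have hac : ε.val a c * ε.val c a = 1 := ε.val_mul_swap a c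
  have hbc : ε.val b c * ε.val c b = 1 := ε.val_mul_swap b c
  have hbr : ∀ {a b : G} {x y : L}, x ∈ 𝓛 a → y ∈ 𝓛 b →
      br x y ∈ 𝓛 (a + b) ∧ br x y = -(ε.val a b • br y x) := by
    intro a b x y hx hy
    rw [← hμ.zero]
    exact hμ.mem_cochains 0 hx hy
  have hf := @(hμ.mem_cochains 1)
  have e1 := (hf hz hx).2
  have e2 := (hf hy (hbr hx hz).1).2
  have e3 := (hf hx (hbr hy hz).1).2
  have e4 := (hf hz (hbr hx hy).1).2
  have e5 := (hbr hz hx).2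
  rw [ε.val_add_right] at e2 e3 e4
  simp only [e5, e1, e2, e3, e4, map_neg, map_smul] at hj
  have h := congrArg (ε.val a c • ·) hj
  simp only [smul_zero] at h
  rw [← h, ceDelta₂]
  match_scalars
  · linear_combination (-1 : K) * hac
  · linear_combination (ε.val a b) * hac
  · ring
  · linear_combination (ε.val a c * ε.val c a) * hbc + hac
  · linear_combination (-ε.val b c) * hab - (ε.val a b * ε.val b a * ε.val b c) * hac
  · linear_combination (ε.val a b * ε.val a c) * hac

/-- The class of `μ₁` in `H²(L, L)_e`. -/
def IsLieDeformation.infinitesimalClass {μ : ℕ → L →ₗ[K] L →ₗ[K] L}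
    (hμ : IsLieDeformation ε 𝓛 br μ) : H₂ ε 𝓛 br :=
  Submodule.Quotient.mk ⟨μ 1, hμ.mem_cocycles⟩

end LieDeformation

/-! ### Graded deformations of a graded associative algebra -/

section AssocDeformation

variable {G : Type*} [AddCommGroup G] {K : Type*} [CommRing K]
    {A : Type*} [Ring A] [Algebra K A] (𝓐 : G → Submodule K A)

/-- A bilinear map `A × A → A` of degree zero. -/
def IsBilinearDegreeZero (f : A →ₗ[K] A →ₗ[K] A) : Prop :=
  ∀ ⦃a b : G⦄ ⦃u v : A⦄, u ∈ 𝓐 a → v ∈ 𝓐 b → f u v ∈ 𝓐 (a + b)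

/-- `π_t = ∑ πₙ tⁿ` is a graded associative deformation of `A`: `π₀` is the product of `A`, each
`πₙ` has degree zero, and `π_t` is associative on `A[[t]]`. -/
structure IsAssocDeformation (π : ℕ → A →ₗ[K] A →ₗ[K] A) : Prop where
  zero : ∀ u v, π 0 u v = u * v
  degree : ∀ n, IsBilinearDegreeZero 𝓐 (π n)
  assoc : ∀ u v w : Series A,
    Series.map₂ π (Series.map₂ π u v) w = Series.map₂ π u (Series.map₂ π v w)

/-- The formal automorphism `φ_t = id + φ₁ t + φ₂ t² + ⋯` of degree zero is an equivalence from
`(A[[t]], π_t)` to `(A[[t]], π'_t)`. -/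
structure IsEquivalence (π π' : ℕ → A →ₗ[K] A →ₗ[K] A) (φ : ℕ → A →ₗ[K] A) : Prop where
  zero : φ 0 = LinearMap.id
  degree : ∀ n, IsDegreeZero 𝓐 𝓐 (φ n)
  map_mul : ∀ u v : Series A,
    Series.map φ (Series.map₂ π u v) = Series.map₂ π' (Series.map φ u) (Series.map φ v)

/-- A graded deformation is trivial if it is equivalent to the undeformed product on `A[[t]]`. -/
def IsTrivialDeformation (π : ℕ → A →ₗ[K] A →ₗ[K] A) : Prop :=
  ∃ φ, IsEquivalence 𝓐 π (fun n => if n = 0 then LinearMap.mul K A else 0) φ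

/-- The Hochschild coboundary of a `1`-cochain. -/
def hochschildDelta₁ (f : A →ₗ[K] A) (u v : A) : A :=
  u * f v - f (u * v) + f u * v

/-- The Hochschild coboundary of a `2`-cochain. -/
def hochschildDelta₂ (f : A →ₗ[K] A →ₗ[K] A) (u v w : A) : A :=
  u * f v w - f (u * v) w + f u (v * w) - f u v * w

/-- Hochschild `2`-cocycles of degree zero. -/
def IsHochschildCocycle₂ (f : A →ₗ[K] A →ₗ[K] A) : Prop :=
  IsBilinearDegreeZero 𝓐 f ∧ ∀ u v w, hochschildDelta₂ f u v w = 0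

/-- Hochschild `2`-coboundaries of degree zero. -/
def IsHochschildCoboundary₂ (f : A →ₗ[K] A →ₗ[K] A) : Prop :=
  ∃ φ : A →ₗ[K] A, IsDegreeZero 𝓐 𝓐 φ ∧ ∀ u v, f u v = hochschildDelta₁ φ u v

end AssocDeformation

/-! ### Extending a deformation from `L` to `U(L)` -/

section Extension

variable {G : Type*} [AddCommGroup G] {K : Type*} [CommRing K] (ε : Bicharacter G K)
    {L : Type*} [AddCommGroup L] [Module K L] (𝓛 : G → Submodule K L) (br : L →ₗ[K] L →ₗ[K] L)

/-- The color commutator `u v - ε(a, b) v u` of elements `u`, `v` of degrees `a`, `b`, in which the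
product is replaced by an arbitrary bilinear map `m`. -/
def colorCommutator {A : Type*} [AddCommGroup A] [Module K A] (m : A →ₗ[K] A →ₗ[K] A)
    (a b : G) (u v : A) : A :=
  m u v - ε.val a b • m v u

/-- The adjoint action of `L` on `U(L)`: an element `x` of degree `a` of `L` acts on an element
`u` of degree `b` of `U(L)` as `x u - ε(a, b) u x`. -/
def adjointAction (a b : G) (x : L) (u : Enveloping ε 𝓛 br) : Enveloping ε 𝓛 br :=
  colorCommutator ε (LinearMap.mul K _) a b (Enveloping.incl ε 𝓛 br x) u

/-- `π_t` is a graded associative deformation of `U(L)` that extends `μ_t`: the color commutator of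
`π_t` restricts to `μ_t` on `L`, in every degree in `t`. -/
structure IsExtension (μ : ℕ → L →ₗ[K] L →ₗ[K] L)
    (π : ℕ → Enveloping ε 𝓛 br →ₗ[K] Enveloping ε 𝓛 br →ₗ[K] Enveloping ε 𝓛 br) : Prop where
  isDeformation : IsAssocDeformation (Enveloping.grading ε 𝓛 br) π
  commutator : ∀ (n : ℕ) ⦃a b : G⦄ ⦃x y : L⦄, x ∈ 𝓛 a → y ∈ 𝓛 b →
    colorCommutator ε (π n) a b (Enveloping.incl ε 𝓛 br x) (Enveloping.incl ε 𝓛 br y)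
      = Enveloping.incl ε 𝓛 br (μ n x y)

/-- `1 ∈ U(L)` is a unit element for `π_t`. -/
def IsUnital (π : ℕ → Enveloping ε 𝓛 br →ₗ[K] Enveloping ε 𝓛 br →ₗ[K] Enveloping ε 𝓛 br) :
    Prop :=
  ∀ u : Series (Enveloping ε 𝓛 br), Series.map₂ π (Series.const 1) u = u ∧
    Series.map₂ π u (Series.const 1) = u

/-- The universal enveloping algebra, over `K[[t]]`, of the color Lie algebra `(L[[t]], μ_t)`. -/
abbrev DeformedEnveloping (μ : ℕ → L →ₗ[K] L →ₗ[K] L) : Type _ :=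
  Enveloping (ε.map PowerSeries.C) (fun g => Series.submodule (𝓛 g)) (Series.map₂ μ)

/-- The index set of the Poincaré-Birkhoff-Witt basis attached to a homogeneous basis with `m`
elements, of degrees `d 0, …, d (m - 1)`: finite nondecreasing sequences of indices, in which an
index `i` may be repeated only if `ε (d i) (d i) = 1`. -/
def PBWIndex {m : ℕ} (d : Fin m → G) : Type :=
  {I : List (Fin m) // I.IsChain fun i j => i < j ∨ (i = j ∧ ε.val (d i) (d i) = 1)}

/-- The ordered monomials `y_I = y_{i₁} ⋯ y_{iₖ}` in `U(L)`. -/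
def monomial {m : ℕ} (b : Fin m → L) (d : Fin m → G) (I : PBWIndex ε d) : Enveloping ε 𝓛 br :=
  (I.1.map fun i => Enveloping.incl ε 𝓛 br (b i)).prod

/-- The ordered monomials `y'_I = y'_{i₁} ⋯ y'_{iₖ}` in `U(L[[t]], μ_t)`. -/
def deformedMonomial (μ : ℕ → L →ₗ[K] L →ₗ[K] L) {m : ℕ} (b : Fin m → L) (d : Fin m → G)
    (I : PBWIndex ε d) : DeformedEnveloping ε 𝓛 μ :=
  (I.1.map fun i => Enveloping.incl (ε.map PowerSeries.C) (fun g => Series.submodule (𝓛 g))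
    (Series.map₂ μ) (Series.const (b i))).prod

/-- The products `y_{i₁} ⋯ y_{iₖ}` computed with `π_t` in `U(L)[[t]]`. -/
def starMonomial (π : ℕ → Enveloping ε 𝓛 br →ₗ[K] Enveloping ε 𝓛 br →ₗ[K] Enveloping ε 𝓛 br)
    {m : ℕ} (b : Fin m → L) (I : List (Fin m)) : Series (Enveloping ε 𝓛 br) :=
  I.foldr (fun i w => Series.map₂ π (Series.const (Enveloping.incl ε 𝓛 br (b i))) w)
    (Series.const 1)

/-- The family `v` is a basis of the module `M`. -/
def IsBasis (R : Type*) [CommRing R] {M : Type*} [AddCommGroup M] [Module R M] {ι : Type*}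
    (v : ι → M) : Prop :=
  LinearIndependent R v ∧ Submodule.span R (Set.range v) = ⊤

/-- `π_t` is the transport to `U(L)[[t]]` of the product of `U(L[[t]], μ_t)`: there is a
`K[[t]]`-linear isomorphism `Φ : K[[t]] ⊗ U(L) → U(L[[t]], μ_t)` with `Φ(y_I) = y'_I` for all
ordered monomials, and `π_t(u, v) = Φ⁻¹(Φ(u) Φ(v))` for all `u`, `v` in `U(L)`. -/
def IsTransport (μ : ℕ → L →ₗ[K] L →ₗ[K] L)
    (π : ℕ → Enveloping ε 𝓛 br →ₗ[K] Enveloping ε 𝓛 br →ₗ[K] Enveloping ε 𝓛 br)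
    {m : ℕ} (b : Fin m → L) (d : Fin m → G) : Prop :=
  ∃ Φ : (K⟦X⟧ ⊗[K] Enveloping ε 𝓛 br) ≃ₗ[K⟦X⟧] DeformedEnveloping ε 𝓛 μ,
    (∀ I : PBWIndex ε d,
      Φ (1 ⊗ₜ[K] monomial ε 𝓛 br b d I) = deformedMonomial ε 𝓛 μ b d I) ∧
    ∀ u v : Enveloping ε 𝓛 br, Series.map₂ π (Series.const u) (Series.const v)
      = Series.ofTensor K _ (Φ.symm (Φ (1 ⊗ₜ[K] u) * Φ (1 ⊗ₜ[K] v)))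

end Extension

end ColorLie

end

/-!
The theorem rests on the Poincaré-Birkhoff-Witt theorem for color Lie algebras, over `K` and over
`K[[t]]`, and on the fact that the adjoint module `L` is a direct summand of `U(L)`.

*Poincaré-Birkhoff-Witt.* Let `L` have a finite basis of homogeneous elements over a commutative
ring in which `2` and `3` are invertible. Straightening defines an action of `L` on the free module
on the set of ordered monomials, and the point is that it is compatible with the bracket. The
failure of this compatibility is the `defect`. By induction on the length of the monomial, the
defect vanishes on the triples for which straightening prescribes the action, and `defect_hexagon`,
the comparison of the two ways to reverse a product of three elements, reduces the remaining triples
to these by means of the Jacobi identity. The invertibility of `2` and `3` serves for equal indices: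
skew-symmetry only gives `2 [x, x] = 0` if `ε(|x|,|x|) = 1`, while for odd `x`, where
`ε(|x|,|x|) = -1`, one has `x² = [x, x] / 2` and the Jacobi identity only gives `3 [x, [x, x]] = 0`.
The action factors through the enveloping algebra, where the product `y_I` maps the empty monomial
to the basis vector `z_I`; hence the ordered monomials are linearly independent
(`PBW.isBasis_monomial`).

*Existence.* By this theorem over `K[[t]]`, the isomorphism `Φ` of the two modules spanned by the
ordered monomials exists. The map `K[[t]] ⊗ U(L) → U(L)[[t]]` need not be onto, but a product of
two constants has coefficients of every order in `U(L)`, and this defines `π_t`. The bracket of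
constants being that of `μ_t`, the result extends `μ_t` (`exists_transport`).

*Uniqueness.* For every extension `π_t` the inclusion of `L[[t]]` in `U(L)[[t]]` induces a
homomorphism from the enveloping algebra of `(L[[t]], μ_t)` to `(U(L)[[t]], π_t)`
(`IsExtension.exists_isComparison`). Its values on the ordered monomials determine a power series of
linear maps with constant term the identity, and this is an equivalence from the transported product
to `π_t`. Two equivalences that agree on `L` agree on products of elements of `L`, which gives
uniqueness (`existsUnique_isEquivalence`, `eq_of_starMonomial_eq`).

*Nontriviality.* If `π_1` is a Hochschild coboundary `δ f`, then antisymmetrization shows that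
`μ_1`, as a map to `U(L)`, is the Chevalley-Eilenberg coboundary of the restriction of `f` to `L`.
To obtain a coboundary with values in `L`, one needs a projection of `U(L)` onto `L`, of degree
zero, that commutes with the adjoint action. Instead of the symmetrization map, the Adams operation
`ψ` is used: the coproduct, for the braided tensor product, followed by multiplication. It commutes
with the adjoint action and acts as `2ⁿ` on the quotient of degree `n` of the standard filtration.
Hence a product of factors `(ψ - 2ᵏ) / (2 - 2ᵏ)` projects any given step of the filtration onto `L`,
and as `L` is finite-dimensional, one step suffices (`Adams.exists_ceDelta₁_eq`).
-/

noncomputable section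

namespace ColorLie

/-! ### Straightening of words -/

namespace PBW

section Straightening

variable {G : Type*} [AddCommGroup G] {R : Type*} [CommRing R] (ε : Bicharacter G R)
  {L : Type*} [AddCommGroup L] [Module R L] (𝓛 : G → Submodule R L) (br : L →ₗ[R] L →ₗ[R] L)
  {m : ℕ} (b : Module.Basis (Fin m) R L) (d : Fin m → G)

/-- The index `i` may stand before the index `j` in an ordered monomial. -/
def Precedes (i j : Fin m) : Prop := i < j ∨ (i = j ∧ ε.val (d i) (d i) = 1)

/-- The sequence of indices of an ordered monomial. -/
def word (M : PBWIndex ε d) : List (Fin m) := M.1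

/-- `iM` is again ordered. -/
def CanCons (i : Fin m) (M : PBWIndex ε d) : Prop :=
  (i :: word ε d M).IsChain (Precedes ε d)

/-- The empty monomial. -/
def nil : PBWIndex ε d := ⟨[], List.IsChain.nil⟩

variable {ε d} in
/-- The monomial `iM`. -/
def cons (i : Fin m) (M : PBWIndex ε d) (h : CanCons ε d i M) : PBWIndex ε d :=
  ⟨i :: word ε d M, h⟩

@[simp] theorem word_cons (i : Fin m) (M : PBWIndex ε d) (h : CanCons ε d i M) :
    word ε d (cons i M h) = i :: word ε d M := rfl

theorem eq_nil_or_cons (M : PBWIndex ε d) : M = nil ε d ∨ ∃ i N h, M = cons i N h := by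
  obtain ⟨_ | ⟨i, N⟩, hM⟩ := M
  · exact Or.inl rfl
  · exact Or.inr ⟨i, ⟨N, hM.tail⟩, hM, rfl⟩

theorem canCons_nil (i : Fin m) : CanCons ε d i (nil ε d) := List.IsChain.singleton i

theorem canCons_cons {i j : Fin m} {N : PBWIndex ε d} {h : CanCons ε d j N} :
    CanCons ε d i (cons j N h) ↔ Precedes ε d i j := by
  rw [CanCons, word_cons, List.isChain_cons_cons]
  exact and_iff_left h

/-- The degree of the ordered monomial with index `M`. -/
def degree (M : PBWIndex ε d) : G := ((word ε d M).map d).sum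

@[simp] theorem degree_cons (i : Fin m) (M : PBWIndex ε d) (h : CanCons ε d i M) :
    degree ε d (cons i M h) = d i + degree ε d M := by
  simp [degree]

/-- The ordered monomial `z_I` in the free module on the ordered monomials. -/
abbrev z (I : PBWIndex ε d) : PBWIndex ε d →₀ R := Finsupp.single I 1

/-- The rule for the action of the `i`-th basis element on the ordered monomial `z_M`, in which the
actions on the right-hand side are computed with `X`: it is `z_{iM}` if `iM` is ordered. If
`M = jN` with `j < i`, then it is `ε(i,j) x_j x_i z_N + [x_i, x_j] z_N`, and if `M = iN` with `i`
odd, then it is `½ [x_i, x_i] z_N`. -/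
def step (X : L →ₗ[R] (PBWIndex ε d →₀ R) →ₗ[R] (PBWIndex ε d →₀ R)) (i : Fin m)
    (M : PBWIndex ε d) : PBWIndex ε d →₀ R :=
  open Classical in
  if h : CanCons ε d i M then z ε d (cons i M h) else
    match M with
    | ⟨[], _⟩ => 0
    | ⟨j :: N, hN⟩ =>
      if i = j then Ring.inverse (2 : R) • X (br (b i) (b i)) (z ε d ⟨N, hN.tail⟩)
      else ε.val (d i) (d j) • X (b j) (X (b i) (z ε d ⟨N, hN.tail⟩))
        + X (br (b i) (b j)) (z ε d ⟨N, hN.tail⟩)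

theorem step_of_canCons (X : L →ₗ[R] (PBWIndex ε d →₀ R) →ₗ[R] (PBWIndex ε d →₀ R)) {i : Fin m}
    {M : PBWIndex ε d} (h : CanCons ε d i M) : step ε br b d X i M = z ε d (cons i M h) :=
  dif_pos h

theorem step_cons (X : L →ₗ[R] (PBWIndex ε d →₀ R) →ₗ[R] (PBWIndex ε d →₀ R)) {i j : Fin m}
    {N : PBWIndex ε d} (hj : CanCons ε d j N) (h : ¬ Precedes ε d i j) :
    step ε br b d X i (cons j N hj) =
      if i = j then Ring.inverse (2 : R) • X (br (b i) (b i)) (z ε d N)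
      else ε.val (d i) (d j) • X (b j) (X (b i) (z ε d N)) + X (br (b i) (b j)) (z ε d N) :=
  dif_neg (mt (canCons_cons ε d).1 h)

/-- The bilinear map with prescribed values on basis elements and ordered monomials. -/
def ofBasis (F : Fin m → PBWIndex ε d → (PBWIndex ε d →₀ R)) :
    L →ₗ[R] (PBWIndex ε d →₀ R) →ₗ[R] (PBWIndex ε d →₀ R) :=
  b.constr R fun i => Finsupp.linearCombination R (F i)

@[simp] theorem ofBasis_apply (F : Fin m → PBWIndex ε d → (PBWIndex ε d →₀ R)) (i : Fin m)
    (M : PBWIndex ε d) : ofBasis ε b d F (b i) (z ε d M) = F i M := by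
  simp [ofBasis, z]

/-- The `n`-th approximation of the action of `L` on the ordered monomials. -/
def approx : ℕ → L →ₗ[R] (PBWIndex ε d →₀ R) →ₗ[R] (PBWIndex ε d →₀ R)
  | 0 => 0
  | n + 1 => ofBasis ε b d (step ε br b d (approx n))

/-- The action of `L` on the ordered monomials. The value on `x_i z_M` is taken from an
approximation that is exact there, since the recursion decreases `m |M| + i`. -/
def act : L →ₗ[R] (PBWIndex ε d →₀ R) →ₗ[R] (PBWIndex ε d →₀ R) :=
  ofBasis ε b d fun i M => approx ε br b d (m * (word ε d M).length + i + 1) (b i) (z ε d M)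

/-- The span of the ordered monomials of degree `g` and of length at most `n`, in which those of
length `n` have all their indices in `p`. -/
def piece (p : Fin m → Prop) (n : ℕ) (g : G) : Submodule R (PBWIndex ε d →₀ R) :=
  Submodule.span R (z ε d '' {M | (word ε d M).length ≤ n ∧
    ((word ε d M).length = n → ∀ l ∈ word ε d M, p l) ∧ degree ε d M = g})

theorem z_mem_piece {p : Fin m → Prop} {n : ℕ} {g : G} {M : PBWIndex ε d}
    (h : (word ε d M).length ≤ n) (h' : (word ε d M).length = n → ∀ l ∈ word ε d M, p l)
    (h'' : degree ε d M = g) : z ε d M ∈ piece ε d p n g :=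
  Submodule.subset_span ⟨M, ⟨h, h', h''⟩, rfl⟩

theorem piece_mono {p q : Fin m → Prop} {k n : ℕ} (h : k < n) (g : G) :
    piece ε d q k g ≤ piece ε d p n g := by
  refine Submodule.span_mono (Set.image_mono ?_)
  rintro M ⟨h1, h2, h3⟩
  exact ⟨h1.trans h.le, fun h4 => by omega, h3⟩

/-- `X` maps `x_i z_M` to a combination of monomials of the same degree, of length at most
`|M| + 1`, and those of length `|M| + 1` only have indices occurring in `i` and `M`. -/
def Bounded (X : L →ₗ[R] (PBWIndex ε d →₀ R) →ₗ[R] (PBWIndex ε d →₀ R)) : Prop :=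
  ∀ (p : Fin m → Prop) (i : Fin m) (M : PBWIndex ε d), p i → (∀ l ∈ word ε d M, p l) →
    X (b i) (z ε d M) ∈ piece ε d p ((word ε d M).length + 1) (d i + degree ε d M)

variable {ε d b} in
theorem Bounded.mem {X : L →ₗ[R] (PBWIndex ε d →₀ R) →ₗ[R] (PBWIndex ε d →₀ R)}
    (hX : Bounded ε b d X) {p : Fin m → Prop} {n : ℕ} {g : G} {i : Fin m} (hi : p i)
    {v : PBWIndex ε d →₀ R} (hv : v ∈ piece ε d p n g) :
    X (b i) v ∈ piece ε d p (n + 1) (d i + g) := by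
  induction hv using Submodule.span_induction with
  | mem v hv =>
    obtain ⟨M, ⟨h1, h2, rfl⟩, rfl⟩ := hv
    rcases h1.eq_or_lt with h | h
    · rw [← h]
      exact hX p i M hi (h2 h)
    · exact piece_mono ε d (by omega) _
        (hX (fun _ => True) i M trivial fun _ _ => trivial)
  | zero => simp
  | add v w _ _ hv hw => rw [map_add]; exact add_mem hv hw
  | smul r v _ hv => rw [map_smul]; exact Submodule.smul_mem _ r hv

variable (hspan : ∀ g, 𝓛 g = Submodule.span R (b '' {i | d i = g}))
  (hbr : IsColorLieBracket ε 𝓛 br)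

omit [AddCommGroup G] in
include hspan in
theorem basis_mem (i : Fin m) : b i ∈ 𝓛 (d i) := by
  rw [hspan]
  exact Submodule.subset_span ⟨i, rfl, rfl⟩

variable {ε d b 𝓛} in
include hspan in
theorem Bounded.mem_homogeneous {X : L →ₗ[R] (PBWIndex ε d →₀ R) →ₗ[R] (PBWIndex ε d →₀ R)}
    (hX : Bounded ε b d X) {n : ℕ} {g h : G} {x : L} (hx : x ∈ 𝓛 h)
    {v : PBWIndex ε d →₀ R} (hv : v ∈ piece ε d (fun _ => True) n g) :
    X x v ∈ piece ε d (fun _ => True) (n + 1) (h + g) := by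
  rw [hspan] at hx
  induction hx using Submodule.span_induction with
  | mem x hx =>
    obtain ⟨i, rfl, rfl⟩ := hx
    exact hX.mem trivial hv
  | zero => simp
  | add x y _ _ hx hy => rw [map_add]; exact add_mem hx hy
  | smul r x _ hx => rw [map_smul]; exact Submodule.smul_mem _ r hx

include hspan hbr in
theorem bounded_approx (n : ℕ) : Bounded ε b d (approx ε br b d n) := by
  induction n with
  | zero => intro p i M _ _; simp [approx]
  | succ n ih =>
    intro p i M hi hM
    rw [approx, ofBasis_apply]
    by_cases h : CanCons ε d i M
    · rw [step_of_canCons ε br b d _ h]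
      exact z_mem_piece ε d le_rfl (fun _ l hl => by
        rcases List.mem_cons.1 hl with rfl | hl
        exacts [hi, hM _ hl]) (by simp)
    · obtain rfl | ⟨j, N, hj, rfl⟩ := eq_nil_or_cons ε d M
      · exact absurd (canCons_nil ε d i) h
      · rw [canCons_cons] at h
        have hN : z ε d N ∈ piece ε d p (word ε d N).length (degree ε d N) :=
          z_mem_piece ε d le_rfl (fun _ l hl => hM _ (List.mem_cons_of_mem _ hl)) rfl
        have hN' : z ε d N ∈ piece ε d (fun _ => True) (word ε d N).length (degree ε d N) :=
          z_mem_piece ε d le_rfl (fun _ _ _ => trivial) rfl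
        have hb := basis_mem 𝓛 b d hspan
        have key := piece_mono ε d (p := p) (Nat.lt_succ_self _) _
          (ih.mem_homogeneous hspan (hbr.degree (hb i) (hb j)) hN')
        rw [add_assoc] at key
        rw [step_cons ε br b d _ hj h, degree_cons, word_cons, List.length_cons]
        split_ifs with hij
        · subst hij
          exact Submodule.smul_mem _ _ key
        · refine add_mem (Submodule.smul_mem _ _ ?_) key
          rw [add_left_comm]
          exact ih.mem (hM j (by simp)) (ih.mem hi hN)

theorem precedes_or_le (i j : Fin m) : Precedes ε d i j ∨ j ≤ i := by
  rcases lt_or_ge i j with h | h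
  exacts [Or.inl (Or.inl h), Or.inr h]

include hspan hbr in
/-- The approximation `approx n` is exact on `x_i z_M` as soon as `m |M| + i < n`. -/
theorem approx_succ_eq (n : ℕ) (i : Fin m) (M : PBWIndex ε d)
    (h : m * (word ε d M).length + i < n) :
    approx ε br b d (n + 1) (b i) (z ε d M) = approx ε br b d n (b i) (z ε d M) := by
  induction n generalizing i M with
  | zero => omega
  | succ n ih =>
    rw [approx.eq_2 _ _ _ _ n, approx.eq_2 _ _ _ _ (n + 1), ofBasis_apply, ofBasis_apply]
    by_cases h1 : CanCons ε d i M
    · rw [step_of_canCons ε br b d _ h1, step_of_canCons ε br b d _ h1]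
    · obtain rfl | ⟨j, N, hj, rfl⟩ := eq_nil_or_cons ε d M
      · exact absurd (canCons_nil ε d i) h1
      · rw [canCons_cons] at h1
        rw [word_cons, List.length_cons, mul_add] at h
        have h2 : ∀ x, approx ε br b d (n + 1) x (z ε d N) = approx ε br b d n x (z ε d N) := by
          intro x
          refine LinearMap.congr_fun (f := (approx ε br b d (n + 1)).flip _)
            (g := (approx ε br b d n).flip _) (b.ext fun k => ih k _ ?_) x
          have := k.2
          omega
        have hle : j ≤ i := (precedes_or_le ε d i j).resolve_left h1
        rw [step_cons ε br b d _ hj h1, step_cons ε br b d _ hj h1, h2, h2, h2]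
        split_ifs with hij
        · rfl
        · congr 2
          have hv := bounded_approx ε 𝓛 br b d hspan hbr n (fun _ => True) i N trivial
            fun _ _ => trivial
          generalize approx ε br b d n (b i) (z ε d N) = v at hv
          induction hv using Submodule.span_induction with
          | mem v hv =>
            obtain ⟨Z, ⟨h3, -, -⟩, rfl⟩ := hv
            refine ih j Z ?_
            have := lt_of_le_of_ne hle (Ne.symm hij)
            have := Nat.mul_le_mul_left m h3
            rw [mul_add] at this
            omega
          | zero => simp
          | add v w _ _ hv hw => rw [map_add, map_add, hv, hw]
          | smul r v _ hv => rw [map_smul, map_smul, hv]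

include hspan hbr in
theorem act_eq_approx {n : ℕ} {i : Fin m} {M : PBWIndex ε d} (h : m * (word ε d M).length + i < n) :
    act ε br b d (b i) (z ε d M) = approx ε br b d n (b i) (z ε d M) := by
  rw [act, ofBasis_apply]
  induction n, h using Nat.le_induction with
  | base => rfl
  | succ n hn ih => rw [ih, approx_succ_eq ε 𝓛 br b d hspan hbr n i M (by omega)]

include hspan hbr in
theorem bounded_act : Bounded ε b d (act ε br b d) := by
  intro p i M hi hM
  rw [act_eq_approx ε 𝓛 br b d hspan hbr (Nat.lt_succ_self _)]
  exact bounded_approx ε 𝓛 br b d hspan hbr _ p i M hi hM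

include hspan hbr in
theorem act_eq_approx_of_mem {n k : ℕ} {g : G} {p : Fin m → Prop} {v : PBWIndex ε d →₀ R}
    (hv : v ∈ piece ε d p k g) (h : m * (k + 1) ≤ n) (x : L) :
    act ε br b d x v = approx ε br b d n x v := by
  refine LinearMap.congr_fun (f := (act ε br b d).flip _)
    (g := (approx ε br b d n).flip _) (b.ext fun i => ?_) x
  simp only [LinearMap.flip_apply]
  induction hv using Submodule.span_induction with
  | mem v hv =>
    obtain ⟨M, ⟨h1, -, -⟩, rfl⟩ := hv
    refine act_eq_approx ε 𝓛 br b d hspan hbr ?_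
    have := Nat.mul_le_mul_left m h1
    rw [mul_add] at h
    have := i.2
    omega
  | zero => simp
  | add v w _ _ hv hw => rw [map_add, map_add, hv, hw]
  | smul r v _ hv => rw [map_smul, map_smul, hv]

include hspan hbr in
/-- The action obeys the recursion that the approximations were built from. -/
theorem act_eq_step (i : Fin m) (M : PBWIndex ε d) :
    act ε br b d (b i) (z ε d M) = step ε br b d (act ε br b d) i M := by
  have hlt : m * (word ε d M).length + i < m * ((word ε d M).length + 1) + 1 := by
    have := i.2
    rw [mul_add]
    omega
  rw [act_eq_approx ε 𝓛 br b d hspan hbr hlt, approx, ofBasis_apply]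
  by_cases h1 : CanCons ε d i M
  · rw [step_of_canCons ε br b d _ h1, step_of_canCons ε br b d _ h1]
  · obtain rfl | ⟨j, N, hj, rfl⟩ := eq_nil_or_cons ε d M
    · exact absurd (canCons_nil ε d i) h1
    · rw [canCons_cons] at h1
      have hN : z ε d N ∈ piece ε d (fun _ => True) (word ε d N).length (degree ε d N) :=
        z_mem_piece ε d le_rfl (fun _ _ _ => trivial) rfl
      have hle : m * ((word ε d N).length + 1) ≤ m * ((word ε d (cons j N hj)).length + 1) :=
        Nat.mul_le_mul_left m (by simp)
      have e1 := fun x => act_eq_approx_of_mem ε 𝓛 br b d hspan hbr hN hle x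
      have e2 := fun x => act_eq_approx_of_mem ε 𝓛 br b d hspan hbr
        ((bounded_act ε 𝓛 br b d hspan hbr).mem (i := i) (p := fun _ => True) trivial hN)
        (n := m * ((word ε d (cons j N hj)).length + 1)) le_rfl x
      rw [step_cons ε br b d _ hj h1, step_cons ε br b d _ hj h1, e1, e1, e1]
      rw [e1] at e2
      rw [e2]

end Straightening

end PBW

theorem Bicharacter.val_add_left {G : Type*} [AddCommGroup G] {R : Type*} [CommRing R]
    (ε : Bicharacter G R) (g h k : G) : ε.val (g + h) k = ε.val g k * ε.val h k := by
  rw [val, val, val, ε.add_left, Units.val_mul]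

/-! ### The action of the Lie algebra on ordered monomials -/

section Defect

variable {G : Type*} [AddCommGroup G] {R : Type*} [CommRing R] (ε : Bicharacter G R)
  {L : Type*} [AddCommGroup L] [Module R L] (𝓛 : G → Submodule R L) (br : L →ₗ[R] L →ₗ[R] L)
  {V : Type*} [AddCommGroup V] [Module R V] (X : L →ₗ[R] V →ₗ[R] V)

/-- The failure of `x y v = ε(a,c) y x v + [x, y] v` for elements `x`, `y` of degrees `a`, `c`,
where `L` acts on `V` by `X`. -/
def defect (a c : G) (x y : L) : V →ₗ[R] V :=
  X x ∘ₗ X y - ε.val a c • X y ∘ₗ X x - X (br x y)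

theorem defect_apply (a c : G) (x y : L) (v : V) : defect ε br X a c x y v =
    X x (X y v) - ε.val a c • X y (X x v) - X (br x y) v := rfl

/-- The two ways of reversing a product of three elements lead to a linear relation between the
defects. This is where the Jacobi identity enters. -/
theorem defect_hexagon (hbr : IsColorLieBracket ε 𝓛 br) {v : V}
    (hv : ∀ {a c : G} {x y : L}, x ∈ 𝓛 a → y ∈ 𝓛 c → defect ε br X a c x y v = 0)
    {a c g : G} {x y w : L} (hx : x ∈ 𝓛 a) (hy : y ∈ 𝓛 c) (hw : w ∈ 𝓛 g) :
    defect ε br X a c x y (X w v) - ε.val c g • defect ε br X a g x w (X y v)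
      + (ε.val a c * ε.val a g) • defect ε br X c g y w (X x v) = 0 := by
  have e1 := congrArg (X x) (hv hy hw)
  have e2 := congrArg (X y) (hv hx hw)
  have e3 := congrArg (X w) (hv hx hy)
  have e4 := hv hx (hbr.degree hy hw)
  have e5 := hv (hbr.degree hx hy) hw
  have e6 := hv (hbr.degree hx hw) hy
  have j := congrArg (fun u => ε.val a g • X u v) (hbr.jacobi hx hy hw)
  have s1 : br (br x y) w = -((ε.val a g * ε.val c g) • br w (br x y)) := by
    rw [hbr.skew (hbr.degree hx hy) hw, ε.val_add_left]
  have s2 : br (br x w) y = (ε.val a c * ε.val g c * ε.val a g) • br y (br w x) := by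
    rw [hbr.skew (hbr.degree hx hw) hy, ε.val_add_left, hbr.skew hx hw, map_neg, map_smul]
    module
  have h1 := ε.val_mul_swap a g
  have h2 := ε.val_mul_swap c g
  rw [defect_apply, s1] at e5
  rw [defect_apply, s2] at e6
  simp only [defect_apply, map_sub, map_smul, map_zero, map_add, map_neg, LinearMap.add_apply,
    LinearMap.smul_apply, LinearMap.neg_apply, ε.val_add_left, ε.val_add_right,
    LinearMap.zero_apply, smul_zero] at e1 e2 e3 e4 e5 e6 j ⊢
  linear_combination (norm := skip) e1 - ε.val a c • e2 + (ε.val c g * ε.val a g) • e3 + e4 - e5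
    + ε.val c g • e6 + j
  match_scalars <;> first
    | ring1
    | linear_combination (norm := ring1) -h1
    | linear_combination (norm := ring1) ε.val a c * h2
    | linear_combination (norm := ring1) ε.val a c * ε.val a g * h2

theorem defect_swap (hbr : IsColorLieBracket ε 𝓛 br) {a c : G} {x y : L} (hx : x ∈ 𝓛 a)
    (hy : y ∈ 𝓛 c) (v : V) :
    defect ε br X a c x y v = -(ε.val a c • defect ε br X c a y x v) := by
  have h := ε.val_mul_swap a c
  rw [defect_apply, defect_apply, hbr.skew hx hy, map_neg, map_smul, LinearMap.neg_apply,
    LinearMap.smul_apply]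
  match_scalars
  · linear_combination -h
  · ring
  · ring

/-- The defects vanish on homogeneous elements as soon as they vanish on a homogeneous basis. -/
theorem defect_eq_zero_of_basis {ι : Type*} {b : ι → L} {d : ι → G}
    (hspan : ∀ g, 𝓛 g = Submodule.span R (b '' {i | d i = g})) {v : V}
    (h : ∀ i j, defect ε br X (d i) (d j) (b i) (b j) v = 0) {a c : G} {x y : L}
    (hx : x ∈ 𝓛 a) (hy : y ∈ 𝓛 c) : defect ε br X a c x y v = 0 := by
  rw [hspan] at hx hy
  induction hx using Submodule.span_induction with
  | mem x hx =>
    obtain ⟨i, rfl, rfl⟩ := hx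
    induction hy using Submodule.span_induction with
    | mem y hy =>
      obtain ⟨j, rfl, rfl⟩ := hy
      exact h i j
    | zero => simp [defect_apply]
    | add y y' _ _ hy hy' =>
      rw [← add_zero (0 : V)]
      nth_rewrite 1 [← hy]
      rw [← hy']
      simp only [defect_apply, map_add, LinearMap.add_apply]
      module
    | smul r y _ hy =>
      rw [← smul_zero r, ← hy]
      simp only [defect_apply, map_smul, LinearMap.smul_apply]
      module
  | zero => simp [defect_apply]
  | add x x' _ _ hx hx' =>
    rw [← add_zero (0 : V)]
    nth_rewrite 1 [← hx]
    rw [← hx']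
    simp only [defect_apply, map_add, LinearMap.add_apply]
    module
  | smul r x _ hx =>
    rw [← smul_zero r, ← hx]
    simp only [defect_apply, map_smul, LinearMap.smul_apply]
    module

end Defect

namespace PBW

section Module

variable {G : Type*} [AddCommGroup G] {R : Type*} [CommRing R] (ε : Bicharacter G R)
  {L : Type*} [AddCommGroup L] [Module R L] (𝓛 : G → Submodule R L) (br : L →ₗ[R] L →ₗ[R] L)
  {m : ℕ} (b : Module.Basis (Fin m) R L) (d : Fin m → G)
  (hspan : ∀ g, 𝓛 g = Submodule.span R (b '' {i | d i = g}))
  (hbr : IsColorLieBracket ε 𝓛 br) (hε : ∀ i, ε.val (d i) (d i) = 1 ∨ ε.val (d i) (d i) = -1)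
  (h2 : IsUnit (2 : R)) (h3 : IsUnit (3 : R))

instance : Trans (Precedes ε d) (Precedes ε d) (Precedes ε d) where
  trans := by
    rintro i j k (h | ⟨rfl, h⟩) (h' | ⟨rfl, h'⟩)
    exacts [Or.inl (h.trans h'), Or.inl h, Or.inl h', Or.inr ⟨rfl, h⟩]

variable {ε d} in
theorem CanCons.precedes {i : Fin m} {M : PBWIndex ε d} (h : CanCons ε d i M) :
    ∀ l ∈ word ε d M, Precedes ε d i l :=
  fun _ hl => List.IsChain.rel_cons h hl

theorem canCons_of_precedes {i : Fin m} {M : PBWIndex ε d}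
    (h : ∀ l ∈ word ε d M, Precedes ε d i l) : CanCons ε d i M := by
  obtain rfl | ⟨j, N, hj, rfl⟩ := eq_nil_or_cons ε d M
  · exact canCons_nil ε d i
  · exact (canCons_cons ε d).2 (h j (by simp))

include hε in
theorem not_precedes {i j : Fin m} (h : ¬ Precedes ε d i j) :
    j < i ∨ (i = j ∧ ε.val (d i) (d i) = -1) := by
  rcases lt_trichotomy i j with h' | h' | h'
  · exact absurd (Or.inl h') h
  · exact Or.inr ⟨h', (hε i).resolve_left fun h'' => h (Or.inr ⟨h', h''⟩)⟩
  · exact Or.inl h'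

include hspan hbr in
theorem act_of_canCons {i : Fin m} {M : PBWIndex ε d} (h : CanCons ε d i M) :
    act ε br b d (b i) (z ε d M) = z ε d (cons i M h) := by
  rw [act_eq_step ε 𝓛 br b d hspan hbr, step_of_canCons ε br b d _ h]

include hspan hbr hε h2 in
/-- The relation for `x_i x_j z_N` holds by construction if `jN` is ordered and `ijN` is not. -/
theorem defect_act_of_canCons {i j : Fin m} {N : PBWIndex ε d} (hj : CanCons ε d j N)
    (h : ¬ Precedes ε d i j) :
    defect ε br (act ε br b d) (d i) (d j) (b i) (b j) (z ε d N) = 0 := by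
  have e := act_eq_step ε 𝓛 br b d hspan hbr i (cons j N hj)
  rw [step_cons ε br b d _ hj h] at e
  rw [defect_apply, act_of_canCons ε 𝓛 br b d hspan hbr hj, e]
  split_ifs with hij
  · subst hij
    have h' := (hε i).resolve_left fun h'' => h (Or.inr ⟨rfl, h''⟩)
    rw [act_of_canCons ε 𝓛 br b d hspan hbr hj, e, if_pos rfl, h']
    have := Ring.mul_inverse_cancel _ h2
    match_scalars
    linear_combination this
  · module

include hspan hbr hε h2 h3 in
/-- The free module on the ordered monomials is a module over the color Lie algebra. -/
theorem defect_act_basis (N : PBWIndex ε d) (i j : Fin m) :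
    defect ε br (act ε br b d) (d i) (d j) (b i) (b j) (z ε d N) = 0 := by
  induction hn : (word ε d N).length using Nat.strong_induction_on generalizing N i j with
  | _ n ih =>
  subst hn
  have hb := basis_mem 𝓛 b d hspan
  wlog hij : ¬ Precedes ε d i j generalizing i j
  · rw [not_not] at hij
    by_cases hji : Precedes ε d j i
    · obtain ⟨rfl, hi⟩ : i = j ∧ ε.val (d i) (d i) = 1 := by
        rcases hij with hij | hij
        · rcases hji with hji | ⟨rfl, -⟩
          exacts [absurd hji hij.asymm, absurd hij (lt_irrefl _)]
        · exact hij
      have h0 : (2 : R) • br (b i) (b i) = 0 := by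
        have := hbr.skew (hb i) (hb i)
        rw [hi, one_smul, eq_neg_iff_add_eq_zero] at this
        rw [two_smul, this]
      rw [defect_apply, (h2.smul_eq_zero).1 h0, hi]
      simp
    · rw [defect_swap ε 𝓛 br _ hbr (hb i) (hb j), this j i hji]
      simp
  by_cases hj : CanCons ε d j N
  · exact defect_act_of_canCons ε 𝓛 br b d hspan hbr hε h2 hj hij
  obtain rfl | ⟨k, P, hk, rfl⟩ := eq_nil_or_cons ε d N
  · exact absurd (canCons_nil ε d j) hj
  rw [canCons_cons] at hj
  have hv := fun {a c : G} {x y : L} (hx : x ∈ 𝓛 a) (hy : y ∈ 𝓛 c) =>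
    defect_eq_zero_of_basis ε 𝓛 br (act ε br b d) hspan
      (fun i j => ih (word ε d P).length (by simp) P i j rfl) hx hy
  -- the first term of the hexagon is the defect in question
  have hex := defect_hexagon ε 𝓛 br (act ε br b d) hbr hv (hb i) (hb j) (hb k)
  rw [act_of_canCons ε 𝓛 br b d hspan hbr hk] at hex
  -- the terms of `x_l z_P` of full length only have indices which `k` precedes
  have key : ∀ {a l : Fin m}, ¬ Precedes ε d a k → Precedes ε d k l →
      defect ε br (act ε br b d) (d a) (d k) (b a) (b k) (act ε br b d (b l) (z ε d P)) = 0 := by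
    intro a l ha hl
    have hmem := bounded_act ε 𝓛 br b d hspan hbr (Precedes ε d k) l P hl hk.precedes
    generalize act ε br b d (b l) (z ε d P) = v at hmem
    induction hmem using Submodule.span_induction with
    | mem v hv =>
      obtain ⟨Z, ⟨h4, h5, -⟩, rfl⟩ := hv
      rcases h4.eq_or_lt with h4 | h4
      · exact defect_act_of_canCons ε 𝓛 br b d hspan hbr hε h2
          (canCons_of_precedes ε d (h5 h4)) ha
      · exact ih _ (by simpa using h4) Z a k rfl
    | zero => simp
    | add v w _ _ hv hw => rw [map_add, hv, hw, add_zero]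
    | smul r v _ hv => rw [map_smul, hv, smul_zero]
  rcases not_precedes ε d hε hj with hjk | ⟨rfl, hodd⟩
  · have hik : k < i := by
      rcases not_precedes ε d hε hij with h | ⟨rfl, -⟩
      exacts [hjk.trans h, hjk]
    have hik' : ¬ Precedes ε d i k := by
      rintro (h | ⟨rfl, -⟩)
      exacts [h.asymm hik, lt_irrefl _ hik]
    rwa [key hik' (Or.inl hjk), key hj (Or.inl hik), smul_zero, smul_zero, sub_zero,
      add_zero] at hex
  · -- now `j = k` is odd, and two or three terms of the hexagon contain the same defect
    rw [act_of_canCons ε 𝓛 br b d hspan hbr hk, hodd] at hex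
    rcases not_precedes ε d hε hij with hji | ⟨rfl, -⟩
    · rw [key hj (Or.inl hji), smul_zero, add_zero] at hex
      refine (h2.smul_eq_zero).1 ?_
      rw [← hex]
      module
    · rw [act_of_canCons ε 𝓛 br b d hspan hbr hk, hodd] at hex
      -- here `i = j = k`, so that the hexagon is three times the defect
      refine (h3.smul_eq_zero).1 ?_
      rw [← hex]
      module

include hspan hbr hε h2 h3 in
theorem defect_act {a c : G} {x y : L} (hx : x ∈ 𝓛 a) (hy : y ∈ 𝓛 c) :
    defect ε br (act ε br b d) a c x y = 0 :=
  Finsupp.lhom_ext' fun N => LinearMap.ext_ring <|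
    defect_eq_zero_of_basis ε 𝓛 br (act ε br b d) hspan
      (defect_act_basis ε 𝓛 br b d hspan hbr hε h2 h3 N) hx hy

end Module

end PBW

/-! ### The universal property of the universal enveloping algebra -/

namespace Enveloping

section Lift

variable {G : Type*} [AddCommGroup G] {R : Type*} [CommRing R] (ε : Bicharacter G R)
  {L : Type*} [AddCommGroup L] [Module R L] (𝓛 : G → Submodule R L) (br : L →ₗ[R] L →ₗ[R] L)

theorem incl_mul_incl {a c : G} {x y : L} (hx : x ∈ 𝓛 a) (hy : y ∈ 𝓛 c) :
    incl ε 𝓛 br x * incl ε 𝓛 br y =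
      ε.val a c • (incl ε 𝓛 br y * incl ε 𝓛 br x) + incl ε 𝓛 br (br x y) := by
  have h := RingQuot.mkAlgHom_rel R (EnvelopingRel.bracket (ε := ε) (br := br) hx hy)
  rw [map_add, map_smul, map_mul, map_mul] at h
  exact h

/-- The algebra homomorphism from `U(L)` that extends a linear map from `L` with values in an
associative algebra, which maps brackets to color commutators. -/
def lift {A : Type*} [Ring A] [Algebra R A] (f : L →ₗ[R] A)
    (hf : ∀ {a c : G} {x y : L}, x ∈ 𝓛 a → y ∈ 𝓛 c →
      f x * f y = ε.val a c • (f y * f x) + f (br x y)) : Enveloping ε 𝓛 br →ₐ[R] A :=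
  RingQuot.liftAlgHom R ⟨TensorAlgebra.lift R f, by
    rintro _ _ ⟨hx, hy⟩
    simp [hf hx hy]⟩

@[simp] theorem lift_incl {A : Type*} [Ring A] [Algebra R A] (f : L →ₗ[R] A)
    (hf : ∀ {a c : G} {x y : L}, x ∈ 𝓛 a → y ∈ 𝓛 c →
      f x * f y = ε.val a c • (f y * f x) + f (br x y)) (x : L) :
    lift ε 𝓛 br f hf (incl ε 𝓛 br x) = f x := by
  refine (RingQuot.liftAlgHom_mkAlgHom_apply R _ _ _).trans ?_
  simp

variable {ε 𝓛 br} in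
theorem induction {C : Enveloping ε 𝓛 br → Prop} (algebraMap : ∀ r, C (algebraMap R _ r))
    (incl : ∀ x, C (incl ε 𝓛 br x)) (mul : ∀ u v, C u → C v → C (u * v))
    (add : ∀ u v, C u → C v → C (u + v)) (u : Enveloping ε 𝓛 br) : C u := by
  obtain ⟨w, rfl⟩ := RingQuot.mkAlgHom_surjective R (EnvelopingRel ε 𝓛 br) u
  induction w using TensorAlgebra.induction with
  | algebraMap r => rw [AlgHom.commutes]; exact algebraMap r
  | ι x => exact incl x
  | mul u v hu hv => rw [map_mul]; exact mul _ _ hu hv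
  | add u v hu hv => rw [map_add]; exact add _ _ hu hv

variable {ε 𝓛 br} in
theorem algHom_ext {A : Type*} [Ring A] [Algebra R A] {f g : Enveloping ε 𝓛 br →ₐ[R] A}
    (h : ∀ x, f (incl ε 𝓛 br x) = g (incl ε 𝓛 br x)) : f = g := by
  ext u
  induction u using Enveloping.induction with
  | algebraMap r => simp
  | incl x => exact h x
  | mul u v hu hv => rw [map_mul, map_mul, hu, hv]
  | add u v hu hv => rw [map_add, map_add, hu, hv]

variable {ε 𝓛 br} in
/-- A submodule that contains `1` and is stable under left multiplication by a spanning subset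
of `L` is everything. -/
theorem eq_top_of_mul_mem {ι : Type*} {b : ι → L} (hb : Submodule.span R (Set.range b) = ⊤)
    {S : Submodule R (Enveloping ε 𝓛 br)} (h1 : 1 ∈ S)
    (h : ∀ i, ∀ u ∈ S, incl ε 𝓛 br (b i) * u ∈ S) : S = ⊤ := by
  have key : ∀ v u : Enveloping ε 𝓛 br, u ∈ S → v * u ∈ S := by
    intro v
    induction v using Enveloping.induction with
    | algebraMap r =>
      intro u hu
      rw [← Algebra.smul_def]
      exact S.smul_mem r hu
    | incl x =>
      intro u hu
      have hx : x ∈ Submodule.span R (Set.range b) := hb ▸ Submodule.mem_top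
      induction hx using Submodule.span_induction with
      | mem x hx => obtain ⟨i, rfl⟩ := hx; exact h i u hu
      | zero => simp
      | add x y _ _ hx hy => rw [map_add, add_mul]; exact add_mem hx hy
      | smul r x _ hx => rw [map_smul, smul_mul_assoc]; exact S.smul_mem r hx
    | mul v w hv hw => intro u hu; rw [mul_assoc]; exact hv _ (hw _ hu)
    | add v w hv hw => intro u hu; rw [add_mul]; exact add_mem (hv _ hu) (hw _ hu)
  refine eq_top_iff.2 fun v _ => ?_
  rw [← mul_one v]
  exact key v 1 h1

theorem one_mem_grading : (1 : Enveloping ε 𝓛 br) ∈ grading ε 𝓛 br 0 :=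
  Submodule.subset_span ⟨[], by simp, rfl, rfl⟩

theorem mul_mem_grading {g h : G} {u v : Enveloping ε 𝓛 br} (hu : u ∈ grading ε 𝓛 br g)
    (hv : v ∈ grading ε 𝓛 br h) : u * v ∈ grading ε 𝓛 br (g + h) := by
  have := Submodule.mul_mem_mul hu hv
  rw [grading, grading, Submodule.span_mul_span] at this
  refine Submodule.span_mono ?_ this
  rintro _ ⟨_, ⟨l, hl, rfl, rfl⟩, _, ⟨l', hl', rfl, rfl⟩, rfl⟩
  refine ⟨l ++ l', fun p hp => ?_, by simp, by simp⟩
  rcases List.mem_append.1 hp with hp | hp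
  exacts [hl p hp, hl' p hp]

theorem incl_mem_grading {g : G} {x : L} (hx : x ∈ 𝓛 g) :
    incl ε 𝓛 br x ∈ grading ε 𝓛 br g :=
  Submodule.subset_span ⟨[(g, x)], by simpa using hx, by simp, by simp⟩

end Lift

end Enveloping

/-! ### The Poincaré-Birkhoff-Witt theorem -/

namespace PBW

section Basis

variable {G : Type*} [AddCommGroup G] {R : Type*} [CommRing R] (ε : Bicharacter G R)
  {L : Type*} [AddCommGroup L] [Module R L] (𝓛 : G → Submodule R L) (br : L →ₗ[R] L →ₗ[R] L)
  {m : ℕ} (b : Module.Basis (Fin m) R L) (d : Fin m → G)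
  (hspan : ∀ g, 𝓛 g = Submodule.span R (b '' {i | d i = g}))
  (hbr : IsColorLieBracket ε 𝓛 br) (hε : ∀ i, ε.val (d i) (d i) = 1 ∨ ε.val (d i) (d i) = -1)
  (h2 : IsUnit (2 : R)) (h3 : IsUnit (3 : R))

theorem monomial_nil : monomial ε 𝓛 br b d (nil ε d) = 1 := rfl

theorem monomial_cons (i : Fin m) (M : PBWIndex ε d) (h : CanCons ε d i M) :
    monomial ε 𝓛 br b d (cons i M h) =
      Enveloping.incl ε 𝓛 br (b i) * monomial ε 𝓛 br b d M := rfl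

theorem word_induction {C : PBWIndex ε d → Prop} (nil : C (nil ε d))
    (cons : ∀ i N h, C N → C (cons i N h)) (M : PBWIndex ε d) : C M := by
  induction hn : (word ε d M).length generalizing M with
  | zero =>
    obtain rfl | ⟨j, N, hj, rfl⟩ := eq_nil_or_cons ε d M
    · exact nil
    · simp at hn
  | succ n ih =>
    obtain rfl | ⟨j, N, hj, rfl⟩ := eq_nil_or_cons ε d M
    · exact nil
    · exact cons j N hj (ih N (by simpa using hn))

include hspan hbr hε h2 h3 in
/-- The action on the empty monomial separates the ordered monomials. -/
theorem linearIndependent_monomial : LinearIndependent R (monomial ε 𝓛 br b d) := by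
  let ρ : Enveloping ε 𝓛 br →ₐ[R] Module.End R (PBWIndex ε d →₀ R) :=
    Enveloping.lift ε 𝓛 br (act ε br b d) fun hx hy => by
      have := defect_act ε 𝓛 br b d hspan hbr hε h2 h3 hx hy
      rw [defect, sub_sub, sub_eq_zero] at this
      exact this
  refine LinearIndependent.of_comp (LinearMap.applyₗ (z ε d (nil ε d)) ∘ₗ ρ.toLinearMap) ?_
  have : (LinearMap.applyₗ (z ε d (nil ε d)) ∘ₗ ρ.toLinearMap) ∘ monomial ε 𝓛 br b d
      = z ε d := by
    funext M
    simp only [Function.comp_apply, LinearMap.comp_apply, LinearMap.applyₗ_apply_apply,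
      AlgHom.toLinearMap_apply]
    induction M using word_induction with
    | nil => rw [monomial_nil, map_one, Module.End.one_apply]
    | cons i N h ih =>
      rw [monomial_cons, map_mul, Module.End.mul_apply, ih, Enveloping.lift_incl,
        act_of_canCons ε 𝓛 br b d hspan hbr h]
  rw [this]
  exact Finsupp.linearIndependent_single_one _ _

/-- The linear map from the free module on the ordered monomials to `U(L)`. -/
def toEnveloping : (PBWIndex ε d →₀ R) →ₗ[R] Enveloping ε 𝓛 br :=
  Finsupp.linearCombination R (monomial ε 𝓛 br b d)

theorem toEnveloping_z (M : PBWIndex ε d) :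
    toEnveloping ε 𝓛 br b d (z ε d M) = monomial ε 𝓛 br b d M := by
  simp [toEnveloping, z]

include hspan hbr hε h2 in
/-- Straightening does not change the value in `U(L)`. As for `act`, the induction is on
`m |M| + i`. -/
theorem toEnveloping_act_basis (i : Fin m) (M : PBWIndex ε d) :
    toEnveloping ε 𝓛 br b d (act ε br b d (b i) (z ε d M)) =
      Enveloping.incl ε 𝓛 br (b i) * toEnveloping ε 𝓛 br b d (z ε d M) := by
  induction hn : m * (word ε d M).length + i using Nat.strong_induction_on generalizing i M with
  | _ n ih =>
  subst hn
  have hb := basis_mem 𝓛 b d hspan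
  by_cases hi : CanCons ε d i M
  · rw [act_of_canCons ε 𝓛 br b d hspan hbr hi, toEnveloping_z, toEnveloping_z, monomial_cons]
  obtain rfl | ⟨j, N, hj, rfl⟩ := eq_nil_or_cons ε d M
  · exact absurd (canCons_nil ε d i) hi
  rw [canCons_cons] at hi
  have hN : ∀ x, toEnveloping ε 𝓛 br b d (act ε br b d x (z ε d N)) =
      Enveloping.incl ε 𝓛 br x * toEnveloping ε 𝓛 br b d (z ε d N) := by
    refine LinearMap.congr_fun (f := toEnveloping ε 𝓛 br b d ∘ₗ (act ε br b d).flip (z ε d N))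
      (g := LinearMap.mulRight R (toEnveloping ε 𝓛 br b d (z ε d N)) ∘ₗ Enveloping.incl ε 𝓛 br)
      (b.ext fun k => ih _ ?_ k N rfl)
    rw [word_cons, List.length_cons, mul_add]
    have := k.2
    omega
  rw [act_eq_step ε 𝓛 br b d hspan hbr, step_cons ε br b d _ hj hi, toEnveloping_z _ _ _ _ _
    (cons j N hj), monomial_cons, ← toEnveloping_z, ← mul_assoc,
    Enveloping.incl_mul_incl ε 𝓛 br (hb i) (hb j)]
  split_ifs with hij
  · subst hij
    have hodd := (hε i).resolve_left fun h => hi (Or.inr ⟨rfl, h⟩)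
    have h := Enveloping.incl_mul_incl ε 𝓛 br (hb i) (hb i)
    rw [hodd, neg_one_smul, eq_neg_add_iff_add_eq, ← two_smul R] at h
    rw [hodd, map_smul, hN, ← h, neg_one_smul, two_smul, neg_add_cancel_left, ← two_smul R,
      smul_mul_assoc, smul_smul, Ring.inverse_mul_cancel _ h2, one_smul]
  · rw [map_add, map_smul, hN, add_mul, smul_mul_assoc, mul_assoc, ← hN (b i)]
    congr 2
    have hmem := bounded_act ε 𝓛 br b d hspan hbr (fun _ => True) i N trivial fun _ _ => trivial
    generalize act ε br b d (b i) (z ε d N) = v at hmem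
    induction hmem using Submodule.span_induction with
    | mem v hv =>
      obtain ⟨Z, ⟨h4, -, -⟩, rfl⟩ := hv
      refine ih _ ?_ j Z rfl
      have hji := lt_of_le_of_ne ((precedes_or_le ε d i j).resolve_left hi) (Ne.symm hij)
      have := Nat.mul_le_mul_left m h4
      rw [word_cons, List.length_cons]
      omega
    | zero => simp
    | add v w _ _ hv hw => simp only [map_add, mul_add, hv, hw]
    | smul r v _ hv => simp only [map_smul, mul_smul_comm, hv]

include hspan hbr hε h2 in
theorem toEnveloping_act (x : L) (v : PBWIndex ε d →₀ R) :
    toEnveloping ε 𝓛 br b d (act ε br b d x v) =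
      Enveloping.incl ε 𝓛 br x * toEnveloping ε 𝓛 br b d v := by
  have : (act ε br b d).compr₂ (toEnveloping ε 𝓛 br b d) =
      (LinearMap.mul R _).compl₁₂ (Enveloping.incl ε 𝓛 br) (toEnveloping ε 𝓛 br b d) :=
    b.ext fun i => Finsupp.lhom_ext' fun M => LinearMap.ext_ring <|
      toEnveloping_act_basis ε 𝓛 br b d hspan hbr hε h2 i M
  exact LinearMap.congr_fun₂ this x v

include hspan hbr hε h2 in
theorem span_monomial : Submodule.span R (Set.range (monomial ε 𝓛 br b d)) = ⊤ := by
  rw [← Finsupp.range_linearCombination]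
  refine Enveloping.eq_top_of_mul_mem b.span_eq ⟨z ε d (nil ε d), toEnveloping_z _ _ _ _ _ _⟩ ?_
  rintro i _ ⟨v, rfl⟩
  exact ⟨act ε br b d (b i) v, toEnveloping_act ε 𝓛 br b d hspan hbr hε h2 (b i) v⟩

include hspan hbr hε h2 h3 in
/-- The Poincaré-Birkhoff-Witt theorem. -/
theorem isBasis_monomial : IsBasis R (monomial ε 𝓛 br b d) :=
  ⟨linearIndependent_monomial ε 𝓛 br b d hspan hbr hε h2 h3,
    span_monomial ε 𝓛 br b d hspan hbr hε h2⟩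

include hspan in
theorem monomial_mem_grading (M : PBWIndex ε d) :
    monomial ε 𝓛 br b d M ∈ Enveloping.grading ε 𝓛 br (degree ε d M) := by
  induction M using word_induction with
  | nil => exact Enveloping.one_mem_grading ε 𝓛 br
  | cons i N h ih =>
    rw [degree_cons, monomial_cons]
    exact Enveloping.mul_mem_grading ε 𝓛 br
      (Enveloping.incl_mem_grading ε 𝓛 br (basis_mem 𝓛 b d hspan i)) ih

include hspan hbr hε h2 in
/-- The homogeneous elements of `U(L)` are the combinations of ordered monomials of the same
degree. -/
theorem grading_eq_span (g : G) : Enveloping.grading ε 𝓛 br g =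
    Submodule.span R (monomial ε 𝓛 br b d '' {M | degree ε d M = g}) := by
  refine le_antisymm (Submodule.span_le.2 ?_) (Submodule.span_le.2 ?_)
  · rintro _ ⟨l, hl, rfl, rfl⟩
    have key : ∃ n, (l.map fun p => Enveloping.incl ε 𝓛 br p.2).prod ∈
        (piece ε d (fun _ => True) n (l.map Prod.fst).sum).map (toEnveloping ε 𝓛 br b d) := by
      induction l with
      | nil => exact ⟨0, z ε d (nil ε d), z_mem_piece ε d le_rfl (fun _ _ _ => trivial) rfl,
          toEnveloping_z _ _ _ _ _ _⟩
      | cons p l ih =>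
        obtain ⟨n, v, hv, hv'⟩ := ih fun q hq => hl q (List.mem_cons_of_mem _ hq)
        refine ⟨n + 1, act ε br b d p.2 v, ?_, ?_⟩
        · exact (bounded_act ε 𝓛 br b d hspan hbr).mem_homogeneous hspan (hl p (by simp)) hv
        · rw [toEnveloping_act ε 𝓛 br b d hspan hbr hε h2, hv', List.map_cons, List.prod_cons]
    obtain ⟨n, hn⟩ := key
    rw [piece, Submodule.map_span] at hn
    refine Submodule.span_mono ?_ hn
    rintro _ ⟨_, ⟨M, ⟨-, -, hM⟩, rfl⟩, rfl⟩
    exact ⟨M, hM, (toEnveloping_z _ _ _ _ _ _).symm⟩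
  · rintro _ ⟨M, rfl, rfl⟩
    exact monomial_mem_grading ε 𝓛 br b d hspan M

end Basis

end PBW

/-! ### Linear maps between modules of power series -/

namespace Series

section

variable {K : Type*} [CommRing K] {E : Type*} [AddCommGroup E] [Module K E]
  {F : Type*} [AddCommGroup F] [Module K F] {H : Type*} [AddCommGroup H] [Module K H]

@[simp] theorem coeff_const_zero (e : E) : (const e).coeff 0 = e := rfl

theorem coeff_const_of_ne (e : E) {n : ℕ} (h : n ≠ 0) : (const e).coeff n = 0 := if_neg h

theorem const_add (x y : E) : const (x + y) = const x + const y := by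
  ext n
  rcases eq_or_ne n 0 with rfl | h
  · rfl
  · simp [coeff_const_of_ne _ h]

@[simp] theorem const_zero : const (0 : E) = 0 := by
  ext n
  simp [const]

theorem const_smul (r : K) (x : E) : const (r • x) = (PowerSeries.C r : K⟦X⟧) • const x := by
  ext n
  rw [coeff_C_smul]
  rcases eq_or_ne n 0 with rfl | h
  · rfl
  · simp [coeff_const_of_ne _ h]

theorem coeff_smul_const (a : K⟦X⟧) (x : E) (n : ℕ) :
    (a • const x).coeff n = PowerSeries.coeff n a • x := by
  rw [coeff_smul_apply, Finset.sum_eq_single (n, 0)]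
  · simp
  · rintro ⟨i, j⟩ h hne
    rw [coeff_const_of_ne, smul_zero]
    rintro rfl
    exact hne (by simpa using h)
  · simp

theorem coeff_zero_smul (a : K⟦X⟧) (x : Series E) :
    (a • x).coeff 0 = PowerSeries.constantCoeff a • x.coeff 0 := by
  simp [coeff_smul_apply]

theorem coeff_X_smul_zero (x : Series E) : ((PowerSeries.X : K⟦X⟧) • x).coeff 0 = 0 := by
  simp [coeff_zero_smul]

theorem coeff_X_smul_succ (x : Series E) (n : ℕ) :
    ((PowerSeries.X : K⟦X⟧) • x).coeff (n + 1) = x.coeff n := by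
  rw [coeff_smul_apply, Finset.sum_eq_single (1, n)]
  · simp
  · rintro ⟨i, j⟩ h hne
    rw [PowerSeries.coeff_X, if_neg, zero_smul]
    rintro rfl
    refine hne (Prod.ext rfl ?_)
    have := Finset.HasAntidiagonal.mem_antidiagonal.1 h
    dsimp only at this ⊢
    omega
  · intro h
    exact absurd (Finset.HasAntidiagonal.mem_antidiagonal.2 (add_comm 1 n)) h

variable (K) in
theorem eq_const_add_X_smul (x : Series E) :
    x = const (x.coeff 0) + (PowerSeries.X : K⟦X⟧) • ⟨fun n => x.coeff (n + 1)⟩ := by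
  ext n
  rw [coeff_add, Pi.add_apply]
  cases n with
  | zero => rw [coeff_X_smul_zero, add_zero, coeff_const_zero]
  | succ n => rw [coeff_X_smul_succ, coeff_const_of_ne _ n.succ_ne_zero, zero_add]

/-- A `K[[t]]`-linear map between modules of power series is determined by its values on constant
series, since it is continuous for the `t`-adic topology. -/
theorem linearMap_ext {f g : Series E →ₗ[K⟦X⟧] Series F} (h : ∀ e, f (const e) = g (const e)) :
    f = g := by
  refine LinearMap.ext fun x => Series.ext (funext fun n => ?_)
  induction n generalizing x with
  | zero =>
    rw [eq_const_add_X_smul K x]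
    simp only [map_add, map_smul, coeff_add, Pi.add_apply, h, coeff_X_smul_zero]
  | succ n ih =>
    rw [eq_const_add_X_smul K x]
    simp only [map_add, map_smul, coeff_add, Pi.add_apply, h, coeff_X_smul_succ, ih]

theorem linearMap₂_ext {f g : Series E →ₗ[K⟦X⟧] Series F →ₗ[K⟦X⟧] Series H}
    (h : ∀ x y, f (const x) (const y) = g (const x) (const y)) : f = g := by
  refine LinearMap.ext fun x => linearMap_ext fun y => ?_
  have : f.flip (const y) = g.flip (const y) := linearMap_ext fun x => h x y
  exact LinearMap.congr_fun this x

theorem coeff_map_const (f : ℕ → E →ₗ[K] F) (e : E) (n : ℕ) :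
    (map f (const e)).coeff n = f n e := by
  rw [coeff_map, Finset.sum_eq_single (n, 0)]
  · rfl
  · rintro ⟨i, j⟩ h hne
    rw [coeff_const_of_ne, map_zero]
    rintro rfl
    exact hne (by simpa using h)
  · simp

theorem map₂_const_left (m : ℕ → E →ₗ[K] F →ₗ[K] H) (x : E) :
    map₂ m (const x) = map fun n => m n x := by
  refine linearMap_ext fun y => Series.ext (funext fun n => ?_)
  change (map (map m (const x)).coeff (const y)).coeff n = _
  rw [coeff_map_const, coeff_map_const, coeff_map_const]

theorem coeff_map₂_const (m : ℕ → E →ₗ[K] F →ₗ[K] H) (x : E) (y : F) (n : ℕ) :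
    (map₂ m (const x) (const y)).coeff n = m n x y := by
  rw [map₂_const_left, coeff_map_const]

theorem map₂_const_right (m : ℕ → E →ₗ[K] F →ₗ[K] H) (y : F) :
    (map₂ m).flip (const y) = map fun n => (m n).flip y := by
  refine linearMap_ext fun x => Series.ext (funext fun n => ?_)
  rw [LinearMap.flip_apply, coeff_map₂_const, coeff_map_const, LinearMap.flip_apply]

theorem coeff_zero_map (f : ℕ → E →ₗ[K] F) (x : Series E) :
    (map f x).coeff 0 = f 0 (x.coeff 0) := by
  simp [coeff_map]

theorem coeff_zero_map₂ (m : ℕ → E →ₗ[K] F →ₗ[K] H) (x : Series E) (y : Series F) :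
    (map₂ m x y).coeff 0 = m 0 (x.coeff 0) (y.coeff 0) := by
  simp [coeff_map₂]

theorem map_injective {f g : ℕ → E →ₗ[K] F} (h : ∀ e, map f (const e) = map g (const e)) :
    f = g := by
  funext n
  ext e
  rw [← coeff_map_const, h, coeff_map_const]

theorem map₂_injective {f g : ℕ → E →ₗ[K] F →ₗ[K] H}
    (h : ∀ x y, map₂ f (const x) (const y) = map₂ g (const x) (const y)) : f = g := by
  funext n
  ext x y
  rw [← coeff_map₂_const, h, coeff_map₂_const]

theorem map_map (f g : PowerSeries (Module.End K E)) (x : Series E) :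
    map (fun n => PowerSeries.coeff n f) (map (fun n => PowerSeries.coeff n g) x)
      = map (fun n => PowerSeries.coeff n (f * g)) x := by
  refine LinearMap.congr_fun (f := map (fun n => PowerSeries.coeff n f) ∘ₗ map _)
    (linearMap_ext fun e => Series.ext (funext fun n => ?_)) x
  rw [LinearMap.comp_apply, coeff_map, coeff_map_const, PowerSeries.coeff_mul,
    LinearMap.sum_apply]
  exact Finset.sum_congr rfl fun p _ => by rw [coeff_map_const, Module.End.mul_apply]

theorem map_one_eq (x : Series E) :
    map (fun n => PowerSeries.coeff n (1 : PowerSeries (Module.End K E))) x = x := by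
  refine LinearMap.congr_fun (g := LinearMap.id)
    (linearMap_ext fun e => Series.ext (funext fun n => ?_)) x
  rw [coeff_map_const, PowerSeries.coeff_one, LinearMap.id_apply]
  split_ifs with h
  · subst h; rfl
  · rw [coeff_const_of_ne _ h, LinearMap.zero_apply]

/-- A series `id + f₁ t + f₂ t² + ⋯` is invertible. -/
theorem exists_inverse {f : ℕ → E →ₗ[K] E} (hf : f 0 = LinearMap.id) :
    ∃ g : ℕ → E →ₗ[K] E, g 0 = LinearMap.id ∧ (∀ x, map f (map g x) = x) ∧
      ∀ x, map g (map f x) = x := by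
  let F : PowerSeries (Module.End K E) := PowerSeries.mk f
  have hF : (fun n => PowerSeries.coeff n F) = f := funext fun n => PowerSeries.coeff_mk n f
  have h1 : PowerSeries.constantCoeff F = ((1 : (Module.End K E)ˣ) : Module.End K E) := by
    rw [← PowerSeries.coeff_zero_eq_constantCoeff_apply, PowerSeries.coeff_mk, hf]
    rfl
  refine ⟨fun n => PowerSeries.coeff n (PowerSeries.invOfUnit F 1), ?_, fun x => ?_, fun x => ?_⟩
  · dsimp only
    rw [PowerSeries.coeff_invOfUnit, if_pos rfl]
    rfl
  · rw [← hF, map_map, PowerSeries.mul_invOfUnit _ _ h1, map_one_eq]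
  · rw [← hF, map_map, PowerSeries.invOfUnit_mul _ _ h1, map_one_eq]

theorem const_mem_submodule {S : Submodule K E} {e : E} (he : e ∈ S) :
    const e ∈ submodule S := by
  intro n
  rcases eq_or_ne n 0 with rfl | h
  · exact he
  · rw [coeff_const_of_ne _ h]
    exact S.zero_mem

/-- The inverse of a series `id + f₁ t + f₂ t² + ⋯` preserves the submodules that all `fₙ`
preserve. -/
theorem mem_submodule_of_map_mem {f : ℕ → E →ₗ[K] E} (hf : f 0 = LinearMap.id)
    {S : Submodule K E} (hS : ∀ n, ∀ e ∈ S, f n e ∈ S) {x : Series E}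
    (hx : map f x ∈ submodule S) : x ∈ submodule S := by
  intro n
  induction n using Nat.strong_induction_on with
  | _ n ih =>
  have h := hx n
  rw [coeff_map, ← Finset.add_sum_erase _ _ (a := (0, n)) (by simp), hf] at h
  refine (Submodule.add_mem_iff_left _ (Submodule.sum_mem _ ?_)).1 h
  rintro ⟨i, j⟩ hij
  rw [Finset.mem_erase, Finset.HasAntidiagonal.mem_antidiagonal] at hij
  obtain ⟨hne, hij⟩ := hij
  refine hS _ _ (ih _ (lt_of_le_of_ne (by dsimp only at hij ⊢; omega) ?_))
  rintro rfl
  exact hne (Prod.ext (by dsimp only at hij ⊢; omega) rfl)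

theorem coeff_sum {ι : Type*} (s : Finset ι) (f : ι → Series E) (n : ℕ) :
    (∑ i ∈ s, f i).coeff n = ∑ i ∈ s, (f i).coeff n := by
  classical
  induction s using Finset.induction_on with
  | empty => rfl
  | insert a s ha ih => rw [Finset.sum_insert ha, Finset.sum_insert ha, ← ih]; rfl

/-- The constant series on the elements of a finite basis of `E` form a basis of `E[[t]]`. -/
def constBasis {ι : Type*} [Fintype ι] (b : Module.Basis ι K E) :
    Module.Basis ι K⟦X⟧ (Series E) :=
  Module.Basis.mk (v := fun i => const (b i))
    (Fintype.linearIndependent_iff.2 fun a h i => by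
      ext n
      have := congrArg (fun x : Series E => x.coeff n) h
      simp only [coeff_sum, coeff_smul_const] at this
      simpa using Fintype.linearIndependent_iff.1 b.linearIndependent _ this i)
    (fun x _ => by
      have : x = ∑ i, (PowerSeries.mk fun n => b.repr (x.coeff n) i) • const (b i) := by
        ext n
        simp only [coeff_sum, coeff_smul_const, PowerSeries.coeff_mk]
        exact (b.sum_repr _).symm
      rw [this]
      exact Submodule.sum_mem _ fun i _ => Submodule.smul_mem _ _ (Submodule.subset_span ⟨i, rfl⟩))

@[simp] theorem constBasis_apply {ι : Type*} [Fintype ι] (b : Module.Basis ι K E) (i : ι) :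
    constBasis b i = const (b i) :=
  Module.Basis.mk_apply _ _ i

/-- If `E'` is spanned by a part of a finite basis, then so is `E'[[t]]`. -/
theorem submodule_eq_span {ι : Type*} [Fintype ι] (b : Module.Basis ι K E) {s : Set ι}
    {E' : Submodule K E} (h : E' = Submodule.span K (b '' s)) :
    submodule E' = Submodule.span K⟦X⟧ (constBasis b '' s) := by
  subst h
  refine le_antisymm (fun x hx => ?_) (Submodule.span_le.2 ?_)
  · have : x = ∑ i, (PowerSeries.mk fun n => b.repr (x.coeff n) i) • const (b i) := by
      ext n
      simp only [coeff_sum, coeff_smul_const, PowerSeries.coeff_mk]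
      exact (b.sum_repr _).symm
    rw [this]
    refine Submodule.sum_mem _ fun i _ => ?_
    by_cases hi : i ∈ s
    · exact Submodule.smul_mem _ _ (Submodule.subset_span ⟨i, hi, constBasis_apply b i⟩)
    · have : (PowerSeries.mk fun n => b.repr (x.coeff n) i) = 0 := by
        ext n
        rw [PowerSeries.coeff_mk, map_zero]
        by_contra h
        exact hi ((b.mem_span_image.1 (hx n)) (Finsupp.mem_support_iff.2 h))
      rw [this, zero_smul]
      exact Submodule.zero_mem _
  · rintro _ ⟨i, hi, rfl⟩
    rw [constBasis_apply]
    exact const_mem_submodule (Submodule.subset_span ⟨i, hi, rfl⟩)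

theorem coeff_ofTensor_tmul (a : K⟦X⟧) (e : E) (n : ℕ) :
    (ofTensor K E (a ⊗ₜ e)).coeff n = PowerSeries.coeff n a • e := rfl

theorem ofTensor_tmul (a : K⟦X⟧) (e : E) : ofTensor K E (a ⊗ₜ e) = a • const e := by
  ext n
  rw [coeff_smul_const, coeff_ofTensor_tmul]

/-- The canonical map `K[[t]] ⊗ E → E[[t]]` is `K[[t]]`-linear. -/
def ofTensorLinear (K : Type*) [CommRing K] (E : Type*) [AddCommGroup E] [Module K E] :
    K⟦X⟧ ⊗[K] E →ₗ[K⟦X⟧] Series E where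
  toFun := ofTensor K E
  map_add' := map_add _
  map_smul' a x := by
    induction x using TensorProduct.induction_on with
    | zero => simp
    | tmul c e => rw [TensorProduct.smul_tmul', ofTensor_tmul, ofTensor_tmul, smul_eq_mul,
        mul_smul, RingHom.id_apply]
    | add x y hx hy => rw [smul_add, map_add, map_add, smul_add, hx, hy]

/-- The extension of a linear map to power series, coefficient by coefficient. -/
def mapCoeff (f : E →ₗ[K] F) : Series E →ₗ[K⟦X⟧] Series F :=
  map fun n => if n = 0 then f else 0

theorem coeff_mapCoeff (f : E →ₗ[K] F) (x : Series E) (n : ℕ) :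
    (mapCoeff f x).coeff n = f (x.coeff n) := by
  rw [mapCoeff, coeff_map, Finset.sum_eq_single (0, n)]
  · rfl
  · rintro ⟨i, j⟩ h hne
    rw [if_neg, LinearMap.zero_apply]
    rintro rfl
    exact hne (by simpa using h)
  · simp

theorem mapCoeff_const (f : E →ₗ[K] F) (x : E) : mapCoeff f (const x) = const (f x) := by
  ext n
  rw [coeff_mapCoeff]
  rcases eq_or_ne n 0 with rfl | h
  · rfl
  · rw [coeff_const_of_ne _ h, coeff_const_of_ne _ h, map_zero]

theorem map₂_mem {m : ℕ → E →ₗ[K] F →ₗ[K] H} {S : Submodule K E} {T : Submodule K F}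
    {U : Submodule K H} (h : ∀ n, ∀ x ∈ S, ∀ y ∈ T, m n x y ∈ U) {x : Series E} {y : Series F}
    (hx : x ∈ submodule S) (hy : y ∈ submodule T) : map₂ m x y ∈ submodule U := by
  intro n
  rw [coeff_map₂]
  exact U.sum_mem fun p _ => U.sum_mem fun q _ => h _ _ (hx _) _ (hy _)

theorem map_mem {f : ℕ → E →ₗ[K] F} {S : Submodule K E} {T : Submodule K F}
    (h : ∀ n, ∀ x ∈ S, f n x ∈ T) {x : Series E} (hx : x ∈ submodule S) :
    map f x ∈ submodule T := by
  intro n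
  rw [coeff_map]
  exact T.sum_mem fun p _ => h _ _ (hx _)

/-- Every `K[[t]]`-linear map between modules of power series is of the form `∑ fₙ tⁿ`. -/
theorem exists_map_eq (T : Series E →ₗ[K⟦X⟧] Series F) : ∃ f : ℕ → E →ₗ[K] F, map f = T := by
  refine ⟨fun n =>
    { toFun := fun e => (T (const e)).coeff n
      map_add' := fun x y => by rw [const_add, map_add]; rfl
      map_smul' := fun r x => by rw [const_smul (K := K), map_smul, coeff_C_smul]; rfl }, ?_⟩
  refine linearMap_ext fun e => Series.ext (funext fun n => ?_)
  rw [coeff_map_const]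
  rfl

/-- Associativity on power series follows from associativity on constants. -/
theorem map₂_assoc {m : ℕ → E →ₗ[K] E →ₗ[K] E}
    (h : ∀ u v w : E, map₂ m (map₂ m (const u) (const v)) (const w) =
      map₂ m (const u) (map₂ m (const v) (const w))) (u v w : Series E) :
    map₂ m (map₂ m u v) w = map₂ m u (map₂ m v w) := by
  have h1 : ∀ (u : Series E) (v w : E), map₂ m (map₂ m u (const v)) (const w) =
      map₂ m u (map₂ m (const v) (const w)) := fun u v w =>
    LinearMap.congr_fun (f := (map₂ m).flip (const w) ∘ₗ (map₂ m).flip (const v))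
      (g := (map₂ m).flip (map₂ m (const v) (const w))) (linearMap_ext fun u => h u v w) u
  have h2 : ∀ (u v : Series E) (w : E), map₂ m (map₂ m u v) (const w) =
      map₂ m u (map₂ m v (const w)) := fun u v w =>
    LinearMap.congr_fun (f := (map₂ m).flip (const w) ∘ₗ map₂ m u)
      (g := map₂ m u ∘ₗ (map₂ m).flip (const w)) (linearMap_ext fun v => h1 u v w) v
  exact LinearMap.congr_fun (g := map₂ m u ∘ₗ map₂ m v) (linearMap_ext fun w => h2 u v w) w

end

end Series

/-! ### Homogeneous bases -/

section HomogeneousBasis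

variable {G : Type*} [DecidableEq G] {K : Type*} [Field K]
  {L : Type*} [AddCommGroup L] [Module K L] {𝓛 : G → Submodule K L}

/-- A homogeneous basis is a union of bases of the homogeneous components. -/
theorem eq_span_of_isInternal (hL : DirectSum.IsInternal 𝓛) {m : ℕ}
    (b : Module.Basis (Fin m) K L) (d : Fin m → G) (hb : ∀ i, b i ∈ 𝓛 (d i)) (g : G) :
    𝓛 g = Submodule.span K (b '' {i | d i = g}) := by
  have hle : Submodule.span K (b '' {i | d i = g}) ≤ 𝓛 g := by
    rw [Submodule.span_le]
    rintro _ ⟨i, rfl, rfl⟩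
    exact hb i
  refine le_antisymm (fun x hx => ?_) hle
  have hsum := Finset.sum_filter_add_sum_filter_not Finset.univ (fun i => d i = g)
    fun i => b.repr x i • b i
  rw [b.sum_repr] at hsum
  have h1 : ∑ i with d i = g, b.repr x i • b i ∈ Submodule.span K (b '' {i | d i = g}) :=
    Submodule.sum_mem _ fun i hi => Submodule.smul_mem _ _
      (Submodule.subset_span ⟨i, (Finset.mem_filter.1 hi).2, rfl⟩)
  have h2 : ∑ i with ¬ d i = g, b.repr x i • b i ∈ ⨆ h, ⨆ _ : h ≠ g, 𝓛 h :=
    Submodule.sum_mem _ fun i hi => Submodule.smul_mem _ _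
      (Submodule.mem_iSup_of_mem (d i)
        (Submodule.mem_iSup_of_mem (Finset.mem_filter.1 hi).2 (hb i)))
  have h3 : ∑ i with ¬ d i = g, b.repr x i • b i ∈ 𝓛 g := by
    rw [eq_sub_of_add_eq' hsum]
    exact sub_mem hx (hle h1)
  rw [Submodule.disjoint_def.1 (hL.submodule_iSupIndep g) _ h3 h2, add_zero] at hsum
  rwa [← hsum]

theorem exists_homogeneous_basis [FiniteDimensional K L] (hL : DirectSum.IsInternal 𝓛) :
    ∃ (m : ℕ) (b : Module.Basis (Fin m) K L) (d : Fin m → G), ∀ i, b i ∈ 𝓛 (d i) := by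
  let c := hL.collectedBasis fun g => Module.finBasis K (𝓛 g)
  have : Fintype (Σ g, Fin (Module.finrank K (𝓛 g))) := FiniteDimensional.fintypeBasisIndex c
  let e := Fintype.equivFin (Σ g, Fin (Module.finrank K (𝓛 g)))
  refine ⟨_, c.reindex e, fun i => (e.symm i).1, fun i => ?_⟩
  rw [Module.Basis.reindex_apply]
  exact hL.collectedBasis_mem _ _

end HomogeneousBasis

/-! ### The enveloping algebra of the deformed color Lie algebra -/

section Deformed

variable {G : Type*} [AddCommGroup G] {K : Type*} [Field K] [CharZero K] (ε : Bicharacter G K)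
  {L : Type*} [AddCommGroup L] [Module K L] (𝓛 : G → Submodule K L) (br : L →ₗ[K] L →ₗ[K] L)
  {m : ℕ} (b : Module.Basis (Fin m) K L) (d : Fin m → G)
  (hspan : ∀ g, 𝓛 g = Submodule.span K (b '' {i | d i = g}))
  (μ : ℕ → L →ₗ[K] L →ₗ[K] L)

omit [CharZero K] in
theorem Bicharacter.val_self (g : G) : ε.val g g = 1 ∨ ε.val g g = -1 :=
  mul_self_eq_one_iff.1 (ε.val_mul_swap g g)

omit [CharZero K] in
theorem Bicharacter.val_map (g h : G) :
    (ε.map (PowerSeries.C (R := K))).val g h = PowerSeries.C (ε.val g h) := rfl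

theorem isUnit_ofNat (n : ℕ) [n.AtLeastTwo] : IsUnit (OfNat.ofNat n : K) :=
  IsUnit.mk0 _ (OfNat.ofNat_ne_zero n)

theorem PowerSeries.isUnit_ofNat (n : ℕ) [n.AtLeastTwo] : IsUnit (OfNat.ofNat n : K⟦X⟧) := by
  have := (ColorLie.isUnit_ofNat (K := K) n).map (PowerSeries.C (R := K))
  rwa [map_ofNat] at this

/-- The ordered monomials over `K` and over `K[[t]]` have the same indices. -/
def indexEquiv : PBWIndex (ε.map (PowerSeries.C (R := K))) d ≃ PBWIndex ε d :=
  Equiv.subtypeEquivRight fun I => by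
    simp only [Bicharacter.val_map, map_eq_one_iff _ (PowerSeries.C_injective (R := K))]

omit [CharZero K] in
theorem deformedMonomial_indexEquiv (I : PBWIndex (ε.map (PowerSeries.C (R := K))) d) :
    deformedMonomial ε 𝓛 μ b d (indexEquiv ε d I) =
      monomial (ε.map PowerSeries.C) (fun g => Series.submodule (𝓛 g)) (Series.map₂ μ)
        (Series.constBasis b) d I := by
  simp only [deformedMonomial, monomial, Series.constBasis_apply]
  rfl

variable (hbr : IsColorLieBracket (ε.map PowerSeries.C) (fun g => Series.submodule (𝓛 g))
  (Series.map₂ μ))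

omit [CharZero K] in
theorem range_deformedMonomial : Set.range (deformedMonomial ε 𝓛 μ b d) =
    Set.range (monomial (ε.map PowerSeries.C) (fun g => Series.submodule (𝓛 g)) (Series.map₂ μ)
        (Series.constBasis b) d) := by
  rw [← (indexEquiv ε d).surjective.range_comp]
  exact congrArg Set.range (funext fun I => deformedMonomial_indexEquiv ε 𝓛 b d μ I)

omit [AddCommGroup G] [CharZero K] in
include hspan in
theorem submodule_span (g : G) : Series.submodule (𝓛 g) =
    Submodule.span K⟦X⟧ (Series.constBasis b '' {i | d i = g}) :=
  Series.submodule_eq_span b (hspan g)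

omit [CharZero K] in
theorem val_map_self (i : Fin m) : (ε.map (PowerSeries.C (R := K))).val (d i) (d i) = 1 ∨
    (ε.map (PowerSeries.C (R := K))).val (d i) (d i) = -1 := by
  simp only [Bicharacter.val_map]
  rcases ε.val_self (d i) with h | h <;> simp [h]

include hspan hbr in
theorem isBasis_deformedMonomial : IsBasis K⟦X⟧ (deformedMonomial ε 𝓛 μ b d) := by
  obtain ⟨h1, h2⟩ := PBW.isBasis_monomial (ε.map PowerSeries.C)
    (fun g => Series.submodule (𝓛 g)) (Series.map₂ μ) (Series.constBasis b) d
    (submodule_span 𝓛 b d hspan) hbr (val_map_self ε d) (PowerSeries.isUnit_ofNat 2)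
    (PowerSeries.isUnit_ofNat 3)
  refine ⟨(linearIndependent_equiv (indexEquiv ε d)).1 ?_, ?_⟩
  · exact (funext (deformedMonomial_indexEquiv ε 𝓛 b d μ) :
      deformedMonomial ε 𝓛 μ b d ∘ indexEquiv ε d = _) ▸ h1
  · rw [range_deformedMonomial, h2]

include hspan hbr in
theorem grading_deformed_eq_span (g : G) :
    Enveloping.grading (ε.map PowerSeries.C) (fun g => Series.submodule (𝓛 g)) (Series.map₂ μ) g =
      Submodule.span K⟦X⟧ (deformedMonomial ε 𝓛 μ b d '' {M | PBW.degree ε d M = g}) := by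
  rw [PBW.grading_eq_span (ε.map PowerSeries.C) (fun g => Series.submodule (𝓛 g)) (Series.map₂ μ)
    (Series.constBasis b) d (submodule_span 𝓛 b d hspan) hbr (val_map_self ε d)
    (PowerSeries.isUnit_ofNat 2)]
  congr 1
  ext u
  constructor
  · rintro ⟨I, hI, rfl⟩
    exact ⟨indexEquiv ε d I, hI, deformedMonomial_indexEquiv ε 𝓛 b d μ I⟩
  · rintro ⟨I, hI, rfl⟩
    obtain ⟨I, rfl⟩ := (indexEquiv ε d).surjective I
    exact ⟨I, hI, (deformedMonomial_indexEquiv ε 𝓛 b d μ I).symm⟩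

omit [CharZero K] in
theorem deformedMonomial_nil : deformedMonomial ε 𝓛 μ b d (PBW.nil ε d) = 1 := rfl

omit [CharZero K] in
theorem deformedMonomial_cons (i : Fin m) (M : PBWIndex ε d) (h : PBW.CanCons ε d i M) :
    deformedMonomial ε 𝓛 μ b d (PBW.cons i M h) =
      Enveloping.incl (ε.map PowerSeries.C) (fun g => Series.submodule (𝓛 g)) (Series.map₂ μ)
        (Series.const (b i)) * deformedMonomial ε 𝓛 μ b d M := rfl

omit [CharZero K] in
/-- Setting `t = 0` gives a ring homomorphism from the enveloping algebra of the deformed color Lie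
algebra to `U(L)`. -/
theorem exists_specialization (hμ : μ 0 = br) :
    ∃ s : DeformedEnveloping ε 𝓛 μ →+* Enveloping ε 𝓛 br,
      (∀ x, s (Enveloping.incl _ _ _ x) = Enveloping.incl ε 𝓛 br (x.coeff 0)) ∧
      ∀ (a : K⟦X⟧) u, s (a • u) = PowerSeries.constantCoeff a • s u := by
  let _ : Algebra K⟦X⟧ (Enveloping ε 𝓛 br) :=
    ((algebraMap K (Enveloping ε 𝓛 br)).comp PowerSeries.constantCoeff).toAlgebra'
      fun c x => Algebra.commutes (PowerSeries.constantCoeff c) x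
  have hsmul : ∀ (a : K⟦X⟧) (u : Enveloping ε 𝓛 br), a • u = PowerSeries.constantCoeff a • u :=
    fun a u => (Algebra.smul_def a u).trans (Algebra.smul_def (PowerSeries.constantCoeff a) u).symm
  let f : Series L →ₗ[K⟦X⟧] Enveloping ε 𝓛 br :=
    { toFun := fun x => Enveloping.incl ε 𝓛 br (x.coeff 0)
      map_add' := fun x y => map_add _ _ _
      map_smul' := fun a x => by
        rw [Series.coeff_zero_smul, map_smul, hsmul, RingHom.id_apply] }
  let s := Enveloping.lift (ε.map PowerSeries.C) (fun g => Series.submodule (𝓛 g))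
    (Series.map₂ μ) f fun {a c x y} hx hy => by
      change Enveloping.incl ε 𝓛 br (x.coeff 0) * Enveloping.incl ε 𝓛 br (y.coeff 0) =
        _ • (Enveloping.incl ε 𝓛 br (y.coeff 0) * Enveloping.incl ε 𝓛 br (x.coeff 0)) +
        Enveloping.incl ε 𝓛 br ((Series.map₂ μ x y).coeff 0)
      rw [Series.coeff_zero_map₂, hμ, hsmul, Enveloping.incl_mul_incl ε 𝓛 br (hx 0) (hy 0)]
      simp [Bicharacter.val_map]
  exact ⟨s.toRingHom, fun x => Enveloping.lift_incl _ _ _ _ _ x, fun a u =>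
    (map_smul s a u).trans (hsmul a _)⟩

end Deformed

/-! ### Homomorphisms from the deformed enveloping algebra to extensions -/

section Comparison

variable {G : Type*} [AddCommGroup G] {K : Type*} [Field K] [CharZero K] (ε : Bicharacter G K)
  {L : Type*} [AddCommGroup L] [Module K L] (𝓛 : G → Submodule K L) (br : L →ₗ[K] L →ₗ[K] L)
  (μ : ℕ → L →ₗ[K] L →ₗ[K] L)

/-- The canonical map from `L[[t]]` to the universal enveloping algebra of `(L[[t]], μ_t)`. -/
abbrev deformedIncl : Series L →ₗ[K⟦X⟧] DeformedEnveloping ε 𝓛 μ :=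
  Enveloping.incl (ε.map PowerSeries.C) (fun g => Series.submodule (𝓛 g)) (Series.map₂ μ)

/-- `Ψ` is a homomorphism of unital algebras from the universal enveloping algebra of
`(L[[t]], μ_t)` to `(U(L)[[t]], π_t)`, which extends the inclusion of `L[[t]]`. -/
structure IsComparison
    (π : ℕ → Enveloping ε 𝓛 br →ₗ[K] Enveloping ε 𝓛 br →ₗ[K] Enveloping ε 𝓛 br)
    (Ψ : DeformedEnveloping ε 𝓛 μ →ₗ[K⟦X⟧] Series (Enveloping ε 𝓛 br)) : Prop where
  map_mul : ∀ u v, Ψ (u * v) = Series.map₂ π (Ψ u) (Ψ v)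
  map_incl : ∀ x, Ψ (deformedIncl ε 𝓛 μ x) = Series.mapCoeff (Enveloping.incl ε 𝓛 br) x
  one_mul : ∀ u, Series.map₂ π (Ψ 1) u = u
  mul_one : ∀ u, Series.map₂ π u (Ψ 1) = u

omit [AddCommGroup G] [CharZero K] in
/-- A deformation of a unital associative algebra has a unit element. -/
theorem exists_unit_of_assoc {A : Type*} [Ring A] [Algebra K A] {π : ℕ → A →ₗ[K] A →ₗ[K] A}
    (h0 : ∀ u v, π 0 u v = u * v) (hassoc : ∀ u v w : Series A,
      Series.map₂ π (Series.map₂ π u v) w = Series.map₂ π u (Series.map₂ π v w)) :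
    ∃ e, (∀ u, Series.map₂ π e u = u) ∧ ∀ u, Series.map₂ π u e = u := by
  -- left and right multiplication by the constant series `1` are invertible
  obtain ⟨g, -, hg, hg'⟩ := Series.exists_inverse (f := fun n => π n 1)
    (LinearMap.ext fun u => (h0 1 u).trans (one_mul u))
  obtain ⟨k, -, hk, hk'⟩ := Series.exists_inverse (f := fun n => (π n).flip 1)
    (LinearMap.ext fun u => (h0 u 1).trans (mul_one u))
  simp only [← Series.map₂_const_left] at hg hg'
  simp only [← Series.map₂_const_right, LinearMap.flip_apply] at hk hk'
  have hl : ∀ u, Series.map₂ π (Series.map g (Series.const 1)) u = u := fun u => by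
    rw [← hg' (Series.map₂ π (Series.map g (Series.const 1)) u), ← hassoc, hg, hg']
  have hr : ∀ u, Series.map₂ π u (Series.map k (Series.const 1)) = u := fun u => by
    rw [← hk' (Series.map₂ π u (Series.map k (Series.const 1))), hassoc, hk, hk']
  have he : Series.map g (Series.const 1) = Series.map k (Series.const 1) := by
    rw [← hr (Series.map g (Series.const 1)), hl]
  exact ⟨_, hl, fun u => by rw [he, hr]⟩

variable {m : ℕ} (b : Module.Basis (Fin m) K L) (d : Fin m → G)
  (hspan : ∀ g, 𝓛 g = Submodule.span K (b '' {i | d i = g}))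

variable {ε 𝓛 br μ} in
omit [CharZero K] in
include hspan in
/-- The inclusion of `L[[t]]` in `U(L)[[t]]` turns the bracket `μ_t` into the color commutator of
`π_t`, and hence extends to the enveloping algebra. -/
theorem IsExtension.exists_isComparison
    {π : ℕ → Enveloping ε 𝓛 br →ₗ[K] Enveloping ε 𝓛 br →ₗ[K] Enveloping ε 𝓛 br}
    (hπ : IsExtension ε 𝓛 br μ π) : ∃ Ψ, IsComparison ε 𝓛 br μ π Ψ := by
  have hassoc := hπ.isDeformation.assoc
  obtain ⟨e, hl, hr⟩ := exists_unit_of_assoc hπ.isDeformation.zero hassoc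
  -- `U(L[[t]], μ_t)` acts on `U(L)[[t]]` by left multiplication
  let X : Series L →ₗ[K⟦X⟧] Module.End K⟦X⟧ (Series (Enveloping ε 𝓛 br)) :=
    Series.map₂ π ∘ₗ Series.mapCoeff (Enveloping.incl ε 𝓛 br)
  have hX : ∀ x u, X x u = Series.map₂ π (Series.mapCoeff (Enveloping.incl ε 𝓛 br) x) u :=
    fun _ _ => rfl
  have hdef : ∀ {a c : G} {x y : Series L}, x ∈ Series.submodule (𝓛 a) →
      y ∈ Series.submodule (𝓛 c) → X x * X y =
        (ε.map PowerSeries.C).val a c • (X y * X x) + X (Series.map₂ μ x y) := by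
    intro a c x y hx hy
    refine LinearMap.ext fun u => ?_
    have := defect_eq_zero_of_basis (ε.map PowerSeries.C) (fun g => Series.submodule (𝓛 g))
      (Series.map₂ μ) X (submodule_span 𝓛 b d hspan) (v := u) (fun i j => ?_) hx hy
    · rw [defect_apply, sub_sub, sub_eq_zero] at this
      exact this
    · rw [Series.constBasis_apply, Series.constBasis_apply, defect_apply, hX, hX, hX, hX, hX,
        ← hassoc, ← hassoc, ← LinearMap.smul_apply, ← LinearMap.sub_apply, ← map_smul, ← map_sub,
        ← LinearMap.sub_apply, ← map_sub, sub_eq_zero.2, map_zero, LinearMap.zero_apply]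
      ext n
      rw [Series.coeff_mapCoeff, Series.mapCoeff_const, Series.mapCoeff_const,
        Series.coeff_map₂_const, ← hπ.commutator n (PBW.basis_mem 𝓛 b d hspan i)
          (PBW.basis_mem 𝓛 b d hspan j), colorCommutator, Bicharacter.val_map,
        ← Series.coeff_map₂_const, ← Series.coeff_map₂_const, ← Series.coeff_C_smul]
      rfl
  let ρ := Enveloping.lift (ε.map PowerSeries.C) (fun g => Series.submodule (𝓛 g))
    (Series.map₂ μ) X hdef
  have hρ : ∀ x, ρ (deformedIncl ε 𝓛 μ x) = X x := Enveloping.lift_incl _ _ _ _ _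
  have hmul : ∀ w u v, ρ w (Series.map₂ π u v) = Series.map₂ π (ρ w u) v := by
    intro w
    induction w using Enveloping.induction with
    | algebraMap r =>
      intro u v
      rw [AlgHom.commutes, Module.algebraMap_end_apply, Module.algebraMap_end_apply, map_smul,
        LinearMap.smul_apply]
    | incl x => intro u v; rw [hρ, hX, hX, hassoc]
    | mul w w' h h' => intro u v; rw [map_mul, Module.End.mul_apply, h', h]; rfl
    | add w w' h h' =>
      intro u v
      rw [map_add, LinearMap.add_apply, h, h', LinearMap.add_apply, map_add, LinearMap.add_apply]
  have hρ' : ∀ w u, ρ w u = Series.map₂ π (ρ w e) u := fun w u => by rw [← hmul, hl]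
  refine ⟨LinearMap.applyₗ e ∘ₗ ρ.toLinearMap, fun u v => ?_, fun x => ?_, fun u => ?_,
    fun u => ?_⟩
  · change ρ (u * v) e = Series.map₂ π (ρ u e) (ρ v e)
    rw [map_mul, Module.End.mul_apply, hρ']
  · change ρ (deformedIncl ε 𝓛 μ x) e = _
    rw [hρ, hX, hr]
  · change Series.map₂ π (ρ 1 e) u = u
    rw [map_one, Module.End.one_apply, hl]
  · change Series.map₂ π u (ρ 1 e) = u
    rw [map_one, Module.End.one_apply, hr]

namespace IsComparison

variable {ε 𝓛 br μ}
  {π : ℕ → Enveloping ε 𝓛 br →ₗ[K] Enveloping ε 𝓛 br →ₗ[K] Enveloping ε 𝓛 br}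
  {Ψ : DeformedEnveloping ε 𝓛 μ →ₗ[K⟦X⟧] Series (Enveloping ε 𝓛 br)}
  (hΨ : IsComparison ε 𝓛 br μ π Ψ)

include hΨ

omit [CharZero K] in
theorem map_incl_const (x : L) : Ψ (deformedIncl ε 𝓛 μ (Series.const x)) =
    Series.const (Enveloping.incl ε 𝓛 br x) := by
  rw [hΨ.map_incl, Series.mapCoeff_const]

omit [CharZero K] in
theorem coeff_zero_one (h0 : ∀ u v, π 0 u v = u * v) : (Ψ 1).coeff 0 = 1 := by
  have := congrArg (fun u => Series.coeff u 0) (hΨ.one_mul (Series.const 1))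
  simpa only [Series.coeff_zero_map₂, h0, Series.coeff_const_zero, _root_.mul_one] using this

omit [CharZero K] in
theorem one_mem (hπ : IsAssocDeformation (Enveloping.grading ε 𝓛 br) π) :
    Ψ 1 ∈ Series.submodule (Enveloping.grading ε 𝓛 br 0) := by
  refine Series.mem_submodule_of_map_mem (f := fun n => π n 1)
    (LinearMap.ext fun u => (hπ.zero 1 u).trans (_root_.one_mul u)) (fun n u hu => ?_) ?_
  · have := hπ.degree n (Enveloping.one_mem_grading ε 𝓛 br) hu
    rwa [add_zero] at this
  · rw [← Series.map₂_const_left, hΨ.mul_one]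
    exact Series.const_mem_submodule (Enveloping.one_mem_grading ε 𝓛 br)

omit [CharZero K] in
theorem coeff_zero_monomial (h0 : ∀ u v, π 0 u v = u * v) (I : PBWIndex ε d) :
    (Ψ (deformedMonomial ε 𝓛 μ b d I)).coeff 0 = monomial ε 𝓛 br b d I := by
  induction I using PBW.word_induction with
  | nil => rw [deformedMonomial_nil, hΨ.coeff_zero_one h0, PBW.monomial_nil]
  | cons i N h ih =>
    rw [deformedMonomial_cons, PBW.monomial_cons, hΨ.map_mul, hΨ.map_incl_const,
      Series.coeff_zero_map₂, ih, h0, Series.coeff_const_zero]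

omit [CharZero K] in
include hspan in
theorem monomial_mem (hπ : IsAssocDeformation (Enveloping.grading ε 𝓛 br) π)
    (I : PBWIndex ε d) : Ψ (deformedMonomial ε 𝓛 μ b d I) ∈
      Series.submodule (Enveloping.grading ε 𝓛 br (PBW.degree ε d I)) := by
  induction I using PBW.word_induction with
  | nil => exact hΨ.one_mem hπ
  | cons i N h ih =>
    rw [deformedMonomial_cons, PBW.degree_cons, hΨ.map_mul, hΨ.map_incl_const]
    exact Series.map₂_mem (fun n u hu v hv => hπ.degree n hu hv) (Series.const_mem_submodule
      (Enveloping.incl_mem_grading ε 𝓛 br (PBW.basis_mem 𝓛 b d hspan i))) ih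

omit [CharZero K] in
theorem starMonomial_eq (h1 : Ψ 1 = Series.const 1) (I : List (Fin m)) :
    starMonomial ε 𝓛 br π b I =
      Ψ (I.map fun i => deformedIncl ε 𝓛 μ (Series.const (b i))).prod := by
  induction I with
  | nil => exact h1.symm
  | cons i I ih =>
    rw [List.map_cons, List.prod_cons, hΨ.map_mul, hΨ.map_incl_const, ← ih]
    rfl

omit [CharZero K] in
/-- An equivalence that is the identity on `L` carries one comparison map to the other. -/
theorem map_eq_of_isEquivalence
    {π' : ℕ → Enveloping ε 𝓛 br →ₗ[K] Enveloping ε 𝓛 br →ₗ[K] Enveloping ε 𝓛 br}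
    {Ψ' : DeformedEnveloping ε 𝓛 μ →ₗ[K⟦X⟧] Series (Enveloping ε 𝓛 br)}
    (hΨ' : IsComparison ε 𝓛 br μ π' Ψ') {φ : ℕ → Enveloping ε 𝓛 br →ₗ[K] Enveloping ε 𝓛 br}
    (hφ : IsEquivalence (Enveloping.grading ε 𝓛 br) π π' φ)
    (hφ' : ∀ n, n ≠ 0 → ∀ x : L, φ n (Enveloping.incl ε 𝓛 br x) = 0)
    (u : DeformedEnveloping ε 𝓛 μ) : Series.map φ (Ψ u) = Ψ' u := by
  have h1 : Series.map φ (Ψ 1) = Ψ' 1 := by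
    obtain ⟨g, -, hg, -⟩ := Series.exists_inverse hφ.zero
    rw [← hΨ'.mul_one (Series.map φ (Ψ 1)), ← hg (Ψ' 1), ← hφ.map_mul, hΨ.one_mul]
  have hincl : Series.map φ ∘ₗ Series.mapCoeff (Enveloping.incl ε 𝓛 br) =
      Series.mapCoeff (Enveloping.incl ε 𝓛 br) := by
    refine Series.linearMap_ext fun x => Series.ext (funext fun n => ?_)
    rw [LinearMap.comp_apply, Series.mapCoeff_const, Series.coeff_map_const]
    rcases eq_or_ne n 0 with rfl | hn
    · rw [hφ.zero]; rfl
    · rw [hφ' n hn, Series.coeff_const_of_ne _ hn]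
  induction u using Enveloping.induction with
  | algebraMap r => rw [Algebra.algebraMap_eq_smul_one, map_smul, map_smul, map_smul, h1]
  | incl x =>
    exact (congrArg (Series.map φ) (hΨ.map_incl x)).trans
      ((LinearMap.congr_fun hincl x).trans (hΨ'.map_incl x).symm)
  | mul u v hu hv => rw [hΨ.map_mul, hφ.map_mul, hu, hv, hΨ'.map_mul]
  | add u v hu hv => rw [map_add, map_add, map_add, hu, hv]

end IsComparison

end Comparison

/-! ### Equivalences -/

section Equivalence

variable {G : Type*} {K : Type*} [CommRing K] {A : Type*} [Ring A] [Algebra K A]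
  {𝓐 : G → Submodule K A} {π π' π'' : ℕ → A →ₗ[K] A →ₗ[K] A}

theorem IsEquivalence.trans {φ ψ : ℕ → A →ₗ[K] A} (hφ : IsEquivalence 𝓐 π π' φ)
    (hψ : IsEquivalence 𝓐 π' π'' ψ) :
    ∃ χ, IsEquivalence 𝓐 π π'' χ ∧ ∀ u, Series.map χ u = Series.map ψ (Series.map φ u) := by
  obtain ⟨χ, hχ⟩ := Series.exists_map_eq (Series.map ψ ∘ₗ Series.map φ)
  have hχ' : ∀ u, Series.map χ u = Series.map ψ (Series.map φ u) := LinearMap.congr_fun hχ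
  refine ⟨χ, ⟨?_, fun n a x hx => ?_, fun u v => ?_⟩, hχ'⟩
  · ext u
    rw [← Series.coeff_map_const, hχ', Series.coeff_zero_map, Series.coeff_zero_map, hφ.zero,
      hψ.zero]
    rfl
  · rw [← Series.coeff_map_const, hχ']
    exact Series.map_mem (fun n u hu => hψ.degree n hu)
      (Series.map_mem (fun n u hu => hφ.degree n hu) (Series.const_mem_submodule hx)) n
  · rw [hχ', hχ', hχ', hφ.map_mul, hψ.map_mul]

theorem IsEquivalence.symm {φ : ℕ → A →ₗ[K] A} (hφ : IsEquivalence 𝓐 π π' φ) :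
    ∃ ψ, IsEquivalence 𝓐 π' π ψ ∧ (∀ u, Series.map ψ (Series.map φ u) = u) ∧
      ∀ u, Series.map φ (Series.map ψ u) = u := by
  obtain ⟨ψ, h0, h1, h2⟩ := Series.exists_inverse hφ.zero
  refine ⟨ψ, ⟨h0, fun n a x hx => ?_, fun u v => ?_⟩, h2, h1⟩
  · rw [← Series.coeff_map_const]
    refine Series.mem_submodule_of_map_mem hφ.zero (fun n u hu => hφ.degree n hu) ?_ n
    rw [h1]
    exact Series.const_mem_submodule hx
  · rw [← h2 (Series.map₂ π (Series.map ψ u) (Series.map ψ v)), hφ.map_mul, h1, h1]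

end Equivalence

/-! ### Transport of the product of the deformed enveloping algebra -/

/-- The basis formed by a linearly independent spanning family. -/
def IsBasis.toBasis {R : Type*} [CommRing R] {M : Type*} [AddCommGroup M] [Module R M] {ι : Type*}
    {v : ι → M} (h : IsBasis R v) : Module.Basis ι R M :=
  Module.Basis.mk h.1 h.2.ge

@[simp] theorem IsBasis.toBasis_apply {R : Type*} [CommRing R] {M : Type*} [AddCommGroup M]
    [Module R M] {ι : Type*} {v : ι → M} (h : IsBasis R v) (i : ι) : h.toBasis i = v i :=
  Module.Basis.mk_apply _ _ i

section Transport

variable {G : Type*} [AddCommGroup G] {K : Type*} [Field K] [CharZero K] {ε : Bicharacter G K}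
  {L : Type*} [AddCommGroup L] [Module K L] {𝓛 : G → Submodule K L} {br : L →ₗ[K] L →ₗ[K] L}
  {μ : ℕ → L →ₗ[K] L →ₗ[K] L} {m : ℕ} {b : Module.Basis (Fin m) K L} {d : Fin m → G}
  (hspan : ∀ g, 𝓛 g = Submodule.span K (b '' {i | d i = g}))
  (hbr : IsColorLieBracket ε 𝓛 br) (hμ : IsLieDeformation ε 𝓛 br μ)

include hspan hbr hμ

omit hμ in
/-- The isomorphism that matches the Poincaré-Birkhoff-Witt bases. -/
theorem exists_pbwEquiv (hB' : IsBasis K⟦X⟧ (deformedMonomial ε 𝓛 μ b d)) :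
    ∃ Φ : (K⟦X⟧ ⊗[K] Enveloping ε 𝓛 br) ≃ₗ[K⟦X⟧] DeformedEnveloping ε 𝓛 μ,
      ∀ I, Φ (1 ⊗ₜ[K] monomial ε 𝓛 br b d I) = deformedMonomial ε 𝓛 μ b d I := by
  have hB := PBW.isBasis_monomial ε 𝓛 br b d hspan hbr (fun i => ε.val_self (d i)) (isUnit_ofNat 2)
    (isUnit_ofNat 3)
  refine ⟨(Algebra.TensorProduct.basis K⟦X⟧ hB.toBasis).equiv hB'.toBasis (Equiv.refl _),
    fun I => ?_⟩
  have := (Algebra.TensorProduct.basis K⟦X⟧ hB.toBasis).equiv_apply I hB'.toBasis (Equiv.refl _)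
  rwa [Algebra.TensorProduct.basis_apply, IsBasis.toBasis_apply, IsBasis.toBasis_apply] at this

/-- The product of the enveloping algebra of the deformed color Lie algebra yields an extension,
when it is transported along maps `c` and `j` that match the ordered monomials. -/
theorem exists_isExtension_of_section
    {j : DeformedEnveloping ε 𝓛 μ →ₗ[K⟦X⟧] Series (Enveloping ε 𝓛 br)}
    {c : Enveloping ε 𝓛 br → DeformedEnveloping ε 𝓛 μ}
    (hc_add : ∀ u v, c (u + v) = c u + c v)
    (hc_smul : ∀ (r : K) u, c (r • u) = (PowerSeries.C r : K⟦X⟧) • c u)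
    (hjc : ∀ u, j (c u) = Series.const u)
    (hΦ : ∀ I, c (monomial ε 𝓛 br b d I) = deformedMonomial ε 𝓛 μ b d I) :
    ∃ π, (∀ u v, Series.map₂ π (Series.const u) (Series.const v) = j (c u * c v)) ∧
      IsExtension ε 𝓛 br μ π ∧ IsUnital ε 𝓛 br π ∧ IsComparison ε 𝓛 br μ π j := by
  have hB' := isBasis_deformedMonomial ε 𝓛 b d hspan μ hμ.isBracket
  have hj : ∀ I, j (deformedMonomial ε 𝓛 μ b d I) = Series.const (monomial ε 𝓛 br b d I) :=
    fun I => by rw [← hΦ I, hjc]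
  have hc_zero : c 0 = 0 := by simpa using hc_add 0 0
  let π : ℕ → Enveloping ε 𝓛 br →ₗ[K] Enveloping ε 𝓛 br →ₗ[K] Enveloping ε 𝓛 br := fun n =>
    LinearMap.mk₂ K (fun u v => (j (c u * c v)).coeff n)
      (fun u v w => by rw [hc_add, add_mul, map_add]; rfl)
      (fun r u v => by rw [hc_smul, smul_mul_assoc, map_smul, Series.coeff_C_smul])
      (fun u v w => by rw [hc_add, mul_add, map_add]; rfl)
      (fun r u v => by rw [hc_smul, mul_smul_comm, map_smul, Series.coeff_C_smul])
  have hπ : ∀ u v, Series.map₂ π (Series.const u) (Series.const v) = j (c u * c v) := fun u v =>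
    Series.ext (funext fun n => Series.coeff_map₂_const _ _ _ _)
  have hmul : ∀ u v, j (u * v) = Series.map₂ π (j u) (j v) := fun u v => by
    refine (LinearMap.congr_fun₂ (f := (Series.map₂ π).compl₁₂ j j)
      (g := (LinearMap.mul K⟦X⟧ _).compr₂ j)
      (hB'.toBasis.ext fun I => hB'.toBasis.ext fun J => ?_) u v).symm
    rw [IsBasis.toBasis_apply, IsBasis.toBasis_apply, LinearMap.compl₁₂_apply, hj, hj, hπ,
      LinearMap.compr₂_apply, LinearMap.mul_apply', ← hΦ, ← hΦ]
  have hcincl : ∀ x, c (Enveloping.incl ε 𝓛 br x) = deformedIncl ε 𝓛 μ (Series.const x) := by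
    intro x
    induction b.mem_span x using Submodule.span_induction with
    | mem x hx =>
      obtain ⟨i, rfl⟩ := hx
      have := hΦ (PBW.cons i (PBW.nil ε d) (PBW.canCons_nil ε d i))
      rwa [PBW.monomial_cons, deformedMonomial_cons, PBW.monomial_nil, deformedMonomial_nil,
        mul_one, mul_one] at this
    | zero => rw [map_zero, Series.const_zero, map_zero, hc_zero]
    | add x y _ _ hx hy => rw [map_add, hc_add, hx, hy, Series.const_add, map_add]
    | smul r x _ hx =>
      rw [map_smul, hc_smul, hx, Series.const_smul (K := K), map_smul]
  have hjincl : ∀ x, j (deformedIncl ε 𝓛 μ x) = Series.mapCoeff (Enveloping.incl ε 𝓛 br) x :=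
    LinearMap.congr_fun (f := j ∘ₗ deformedIncl ε 𝓛 μ) (Series.linearMap_ext fun x => by
      rw [LinearMap.comp_apply, ← hcincl, hjc, Series.mapCoeff_const])
  have hone : c 1 = 1 := hΦ (PBW.nil ε d)
  have hj1 : j 1 = Series.const 1 := hj (PBW.nil ε d)
  have hunital : IsUnital ε 𝓛 br π := fun u => by
    constructor
    · refine LinearMap.congr_fun (g := LinearMap.id) (Series.linearMap_ext fun u => ?_) u
      rw [hπ, hone, one_mul, hjc, LinearMap.id_apply]
    · refine LinearMap.congr_fun (f := (Series.map₂ π).flip (Series.const 1)) (g := LinearMap.id)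
        (Series.linearMap_ext fun u => ?_) u
      rw [LinearMap.flip_apply, hπ, hone, mul_one, hjc, LinearMap.id_apply]
  have hcdeg : ∀ {g : G} {u : Enveloping ε 𝓛 br}, u ∈ Enveloping.grading ε 𝓛 br g →
      c u ∈ Enveloping.grading (ε.map PowerSeries.C) (fun g => Series.submodule (𝓛 g))
        (Series.map₂ μ) g := by
    intro g u hu
    rw [PBW.grading_eq_span ε 𝓛 br b d hspan hbr (fun i => ε.val_self (d i)) (isUnit_ofNat 2)] at hu
    rw [grading_deformed_eq_span ε 𝓛 b d hspan μ hμ.isBracket]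
    induction hu using Submodule.span_induction with
    | mem u hu =>
      obtain ⟨I, hI, rfl⟩ := hu
      exact Submodule.subset_span ⟨I, hI, (hΦ I).symm⟩
    | zero => rw [hc_zero]; exact Submodule.zero_mem _
    | add u v _ _ hu hv => rw [hc_add]; exact add_mem hu hv
    | smul r u _ hu => rw [hc_smul]; exact Submodule.smul_mem _ _ hu
  have hjdeg : ∀ {g : G} {u : DeformedEnveloping ε 𝓛 μ},
      u ∈ Enveloping.grading (ε.map PowerSeries.C) (fun g => Series.submodule (𝓛 g))
        (Series.map₂ μ) g → j u ∈ Series.submodule (Enveloping.grading ε 𝓛 br g) := by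
    intro g u hu
    rw [grading_deformed_eq_span ε 𝓛 b d hspan μ hμ.isBracket] at hu
    induction hu using Submodule.span_induction with
    | mem u hu =>
      obtain ⟨I, rfl, rfl⟩ := hu
      rw [hj]
      exact Series.const_mem_submodule (PBW.monomial_mem_grading ε 𝓛 br b d hspan I)
    | zero => simp
    | add u v _ _ hu hv => rw [map_add]; exact add_mem hu hv
    | smul r u _ hu => rw [map_smul]; exact Submodule.smul_mem _ _ hu
  obtain ⟨s, hs, hs'⟩ := exists_specialization ε 𝓛 br μ hμ.zero
  -- setting `t = 0` in the transported series agrees with the specialization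
  have hjs : ∀ u, (j u).coeff 0 = s u := by
    intro u
    have hu : u ∈ Submodule.span K⟦X⟧ (Set.range (deformedMonomial ε 𝓛 μ b d)) :=
      hB'.2 ▸ Submodule.mem_top
    induction hu using Submodule.span_induction with
    | mem u hu =>
      obtain ⟨I, rfl⟩ := hu
      rw [hj, Series.coeff_const_zero]
      induction I using PBW.word_induction with
      | nil => exact (map_one s).symm
      | cons i N h ih =>
        rw [deformedMonomial_cons, PBW.monomial_cons, map_mul, ih, hs, Series.coeff_const_zero]
    | zero => rw [map_zero, map_zero]; rfl
    | add u v _ _ hu hv => rw [map_add, map_add, ← hu, ← hv]; rfl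
    | smul r u _ hu => rw [map_smul, hs', Series.coeff_zero_smul, hu]
  refine ⟨π, hπ, ⟨⟨fun u v => ?_, fun n g h u v hu hv => ?_, ?_⟩,
    fun n g h x y hx hy => ?_⟩, hunital, ⟨hmul, hjincl, ?_, ?_⟩⟩
  · change (j (c u * c v)).coeff 0 = u * v
    rw [hjs, map_mul, ← hjs, ← hjs, hjc, hjc, Series.coeff_const_zero, Series.coeff_const_zero]
  · exact hjdeg (Enveloping.mul_mem_grading (ε.map PowerSeries.C) (fun g => Series.submodule (𝓛 g))
      (Series.map₂ μ) (hcdeg hu) (hcdeg hv)) n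
  · refine Series.map₂_assoc fun u v w => ?_
    rw [← hjc u, ← hjc v, ← hjc w, ← hmul, ← hmul, ← hmul, ← hmul, mul_assoc]
  · change (j (c _ * c _)).coeff n - ε.val g h • (j (c _ * c _)).coeff n = _
    rw [hcincl, hcincl, Enveloping.incl_mul_incl (ε.map PowerSeries.C)
      (fun g => Series.submodule (𝓛 g)) (Series.map₂ μ) (Series.const_mem_submodule hx)
      (Series.const_mem_submodule hy), map_add, map_smul, Bicharacter.val_map, Series.coeff_add,
      Pi.add_apply, Series.coeff_C_smul, add_sub_cancel_left, hjincl, Series.coeff_mapCoeff,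
      Series.coeff_map₂_const]
  · intro u; rw [hj1]; exact (hunital u).1
  · intro u; rw [hj1]; exact (hunital u).2

/-- The product of the enveloping algebra of the deformed color Lie algebra, transported along the
Poincaré-Birkhoff-Witt bases, is an extension, and the transport is a comparison map. -/
theorem exists_transport : ∃ π, IsTransport ε 𝓛 br μ π b d ∧ IsExtension ε 𝓛 br μ π ∧
    IsUnital ε 𝓛 br π ∧ ∃ j, IsComparison ε 𝓛 br μ π j ∧
      ∀ I, j (deformedMonomial ε 𝓛 μ b d I) = Series.const (monomial ε 𝓛 br b d I) := by
  obtain ⟨Φ, hΦ⟩ := exists_pbwEquiv (μ := μ) hspan hbr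
    (isBasis_deformedMonomial ε 𝓛 b d hspan μ hμ.isBracket)
  have hj : ∀ u : Enveloping ε 𝓛 br,
      (Series.ofTensorLinear K _ ∘ₗ Φ.symm.toLinearMap) (Φ (1 ⊗ₜ[K] u)) = Series.const u :=
    fun u => by
      change Series.ofTensor K _ (Φ.symm (Φ (1 ⊗ₜ[K] u))) = _
      rw [LinearEquiv.symm_apply_apply, Series.ofTensor_tmul, one_smul]
  obtain ⟨π, hπ, h1, h2, h3⟩ := exists_isExtension_of_section hspan hbr hμ
    (j := Series.ofTensorLinear K _ ∘ₗ Φ.symm.toLinearMap) (c := fun u => Φ (1 ⊗ₜ[K] u))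
    (fun u v => by rw [TensorProduct.tmul_add, map_add])
    (fun r u => by
      rw [← map_smul, TensorProduct.smul_tmul', ← TensorProduct.smul_tmul, smul_eq_mul, mul_one,
        PowerSeries.smul_eq_C_mul, mul_one])
    hj hΦ
  exact ⟨π, ⟨Φ, hΦ, hπ⟩, h1, h2, _, h3, fun I => by rw [← hΦ I, hj]⟩

omit hμ in
/-- Two comparison maps, one of which preserves the ordered monomials, differ by an equivalence. -/
theorem IsComparison.exists_isEquivalence
    {π₀ π : ℕ → Enveloping ε 𝓛 br →ₗ[K] Enveloping ε 𝓛 br →ₗ[K] Enveloping ε 𝓛 br}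
    {j Ψ : DeformedEnveloping ε 𝓛 μ →ₗ[K⟦X⟧] Series (Enveloping ε 𝓛 br)}
    (hj : IsComparison ε 𝓛 br μ π₀ j)
    (hj' : ∀ I, j (deformedMonomial ε 𝓛 μ b d I) = Series.const (monomial ε 𝓛 br b d I))
    (hB' : IsBasis K⟦X⟧ (deformedMonomial ε 𝓛 μ b d))
    (hΨ : IsComparison ε 𝓛 br μ π Ψ) (hπ : IsAssocDeformation (Enveloping.grading ε 𝓛 br) π) :
    ∃ φ, IsEquivalence (Enveloping.grading ε 𝓛 br) π₀ π φ ∧ (∀ u, Series.map φ (j u) = Ψ u) ∧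
      ∀ n, n ≠ 0 → ∀ x : L, φ n (Enveloping.incl ε 𝓛 br x) = 0 := by
  have hB := PBW.isBasis_monomial ε 𝓛 br b d hspan hbr (fun i => ε.val_self (d i)) (isUnit_ofNat 2)
    (isUnit_ofNat 3)
  let φ : ℕ → Enveloping ε 𝓛 br →ₗ[K] Enveloping ε 𝓛 br := fun n =>
    hB.toBasis.constr K fun I => (Ψ (deformedMonomial ε 𝓛 μ b d I)).coeff n
  have hφ : ∀ n I, φ n (monomial ε 𝓛 br b d I) =
      (Ψ (deformedMonomial ε 𝓛 μ b d I)).coeff n := fun n I => by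
    rw [← hB.toBasis_apply, Module.Basis.constr_basis]
  have hφj : ∀ u, Series.map φ (j u) = Ψ u :=
    LinearMap.congr_fun (f := Series.map φ ∘ₗ j) (hB'.toBasis.ext fun I => by
      rw [IsBasis.toBasis_apply, LinearMap.comp_apply, hj']
      exact Series.ext (funext fun n => (Series.coeff_map_const _ _ _).trans (hφ n I)))
  have hconst : ∀ u : Enveloping ε 𝓛 br, ∃ v, j v = Series.const u := by
    intro u
    have hu : u ∈ Submodule.span K (Set.range (monomial ε 𝓛 br b d)) := hB.2 ▸ Submodule.mem_top
    induction hu using Submodule.span_induction with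
    | mem u hu => obtain ⟨I, rfl⟩ := hu; exact ⟨_, hj' I⟩
    | zero => exact ⟨0, by rw [map_zero, Series.const_zero]⟩
    | add u v _ _ hu hv =>
      obtain ⟨u', hu⟩ := hu
      obtain ⟨v', hv⟩ := hv
      exact ⟨u' + v', by rw [map_add, hu, hv, Series.const_add]⟩
    | smul r u _ hu =>
      obtain ⟨u', hu⟩ := hu
      exact ⟨(PowerSeries.C r : K⟦X⟧) • u', by rw [map_smul, hu, Series.const_smul (K := K)]⟩
  refine ⟨φ, ⟨?_, fun n g u hu => ?_, fun u v => ?_⟩, hφj, fun n hn x => ?_⟩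
  · refine hB.toBasis.ext fun I => ?_
    rw [IsBasis.toBasis_apply, hφ, hΨ.coeff_zero_monomial b d hπ.zero, LinearMap.id_apply]
  · rw [PBW.grading_eq_span ε 𝓛 br b d hspan hbr (fun i => ε.val_self (d i)) (isUnit_ofNat 2)] at hu
    induction hu using Submodule.span_induction with
    | mem u hu =>
      obtain ⟨I, rfl, rfl⟩ := hu
      rw [hφ]
      exact hΨ.monomial_mem b d hspan hπ I n
    | zero => simp
    | add u v _ _ hu hv => rw [map_add]; exact add_mem hu hv
    | smul r u _ hu => rw [map_smul]; exact Submodule.smul_mem _ _ hu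
  · refine LinearMap.congr_fun₂ (f := (Series.map₂ π₀).compr₂ (Series.map φ))
      (g := (Series.map₂ π).compl₁₂ (Series.map φ) (Series.map φ))
      (Series.linearMap₂_ext fun u v => ?_) u v
    obtain ⟨u', hu⟩ := hconst u
    obtain ⟨v', hv⟩ := hconst v
    rw [LinearMap.compr₂_apply, LinearMap.compl₁₂_apply, ← hu, ← hv, ← hj.map_mul, hφj, hφj, hφj,
      hΨ.map_mul]
  · rw [← Series.coeff_map_const, ← hj.map_incl_const, hφj, hΨ.map_incl_const,
      Series.coeff_const_of_ne _ hn]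

/-- Extensions are unique up to a unique equivalence that is the identity on `L`. -/
theorem existsUnique_isEquivalence
    {π π' : ℕ → Enveloping ε 𝓛 br →ₗ[K] Enveloping ε 𝓛 br →ₗ[K] Enveloping ε 𝓛 br}
    (hπ : IsExtension ε 𝓛 br μ π) (hπ' : IsExtension ε 𝓛 br μ π') :
    ∃! φ, IsEquivalence (Enveloping.grading ε 𝓛 br) π π' φ ∧
      ∀ n, n ≠ 0 → ∀ x : L, φ n (Enveloping.incl ε 𝓛 br x) = 0 := by
  obtain ⟨π₀, -, -, -, j, hj, hj'⟩ := exists_transport hspan hbr hμ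
  have hB' := isBasis_deformedMonomial ε 𝓛 b d hspan μ hμ.isBracket
  obtain ⟨Ψ, hΨ⟩ := hπ.exists_isComparison b d hspan
  obtain ⟨Ψ', hΨ'⟩ := hπ'.exists_isComparison b d hspan
  obtain ⟨φ, hφ, hφj, hφL⟩ :=
    hj.exists_isEquivalence hspan hbr hj' hB' hΨ hπ.isDeformation
  obtain ⟨φ', hφ', hφj', hφL'⟩ :=
    hj.exists_isEquivalence hspan hbr hj' hB' hΨ' hπ'.isDeformation
  obtain ⟨ψ, hψ, hψφ, hφψ⟩ := hφ.symm
  obtain ⟨χ, hχ, hχ'⟩ := hψ.trans hφ'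
  have hconst : ∀ x : L, Series.map φ (Series.const (Enveloping.incl ε 𝓛 br x)) =
      Series.const (Enveloping.incl ε 𝓛 br x) := fun x => by
    rw [← hj.map_incl_const, hφj, hΨ.map_incl_const, hj.map_incl_const]
  refine ⟨χ, ⟨hχ, fun n hn x => ?_⟩, fun χ₁ ⟨hχ₁, hχ₁'⟩ => ?_⟩
  · rw [← Series.coeff_map_const, hχ', ← hconst, hψφ, Series.coeff_map_const, hφL' n hn]
  · refine Series.map_injective fun e => ?_
    -- both equivalences carry `Ψ` to `Ψ'`
    have key : Series.map χ₁ ∘ₗ Series.map φ = Series.map φ' := by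
      refine Series.linearMap_ext fun u => ?_
      have hB := PBW.isBasis_monomial ε 𝓛 br b d hspan hbr (fun i => ε.val_self (d i))
        (isUnit_ofNat 2) (isUnit_ofNat 3)
      have hu : u ∈ Submodule.span K (Set.range (monomial ε 𝓛 br b d)) := hB.2 ▸ Submodule.mem_top
      induction hu using Submodule.span_induction with
      | mem u hu =>
        obtain ⟨I, rfl⟩ := hu
        rw [← hj', LinearMap.comp_apply, hφj, hφj',
          hΨ.map_eq_of_isEquivalence hΨ' hχ₁ hχ₁']
      | zero => rw [Series.const_zero, map_zero, map_zero]
      | add u v _ _ hu hv => rw [Series.const_add, map_add, map_add, hu, hv]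
      | smul r u _ hu => rw [Series.const_smul (K := K), map_smul, map_smul, hu]
    rw [hχ', ← key, LinearMap.comp_apply, hφψ]

/-- An extension in which the ordered monomials are undeformed is the transported product. -/
theorem eq_of_starMonomial_eq
    {π₀ π : ℕ → Enveloping ε 𝓛 br →ₗ[K] Enveloping ε 𝓛 br →ₗ[K] Enveloping ε 𝓛 br}
    {j : DeformedEnveloping ε 𝓛 μ →ₗ[K⟦X⟧] Series (Enveloping ε 𝓛 br)}
    (hj : IsComparison ε 𝓛 br μ π₀ j)
    (hj' : ∀ I, j (deformedMonomial ε 𝓛 μ b d I) = Series.const (monomial ε 𝓛 br b d I))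
    (hπ : IsExtension ε 𝓛 br μ π) (hπ' : IsUnital ε 𝓛 br π)
    (hstar : ∀ I : PBWIndex ε d, starMonomial ε 𝓛 br π b I.1 =
      Series.const (monomial ε 𝓛 br b d I)) : π = π₀ := by
  have hB := PBW.isBasis_monomial ε 𝓛 br b d hspan hbr (fun i => ε.val_self (d i))
    (isUnit_ofNat 2) (isUnit_ofNat 3)
  have hB' := isBasis_deformedMonomial ε 𝓛 b d hspan μ hμ.isBracket
  obtain ⟨Ψ, hΨ⟩ := hπ.exists_isComparison b d hspan
  obtain ⟨φ, hφ, hφj, -⟩ := hj.exists_isEquivalence hspan hbr hj' hB' hΨ hπ.isDeformation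
  have h1 : Ψ 1 = Series.const 1 := by rw [← hΨ.mul_one (Series.const 1), (hπ' _).1]
  have hφI : ∀ n, n ≠ 0 → φ n = 0 := fun n hn => hB.toBasis.ext fun I => by
    rw [IsBasis.toBasis_apply, ← Series.coeff_map_const, ← hj', hφj, LinearMap.zero_apply]
    have := hΨ.starMonomial_eq b h1 I.1
    rw [hstar] at this
    exact (congrArg (fun s => Series.coeff s n) this).symm.trans (Series.coeff_const_of_ne _ hn)
  have hid : ∀ u, Series.map φ u = u := LinearMap.congr_fun (g := LinearMap.id) <|
    Series.linearMap_ext fun u => Series.ext (funext fun n => by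
      rw [Series.coeff_map_const]
      rcases eq_or_ne n 0 with rfl | hn
      · rw [hφ.zero]; rfl
      · rw [hφI n hn]; exact (Series.coeff_const_of_ne _ hn).symm)
  refine Series.map₂_injective fun u v => ?_
  have := hφ.map_mul (Series.const u) (Series.const v)
  rw [hid, hid, hid] at this
  exact this.symm

end Transport

/-! ### The Adams operation of the enveloping algebra -/

namespace Adams

section

variable {G : Type*} [AddCommGroup G] {K : Type*} [Field K] (ε : Bicharacter G K)
  {L : Type*} [AddCommGroup L] [Module K L] (𝓛 : G → Submodule K L) (br : L →ₗ[K] L →ₗ[K] L)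
  {m : ℕ} (b : Module.Basis (Fin m) K L) (d : Fin m → G)
  (hspan : ∀ g, 𝓛 g = Submodule.span K (b '' {i | d i = g}))
  (hbr : IsColorLieBracket ε 𝓛 br)

variable {𝓛 b d} in
omit [AddCommGroup G] in
include hspan in
/-- Two linear maps agree on the elements of degree `g` if they agree on the basis elements of
degree `g`. It is applied to maps that depend on `g`. -/
theorem apply_eq_of_basis {V : Type*} [AddCommGroup V] [Module K V] {f f' : L →ₗ[K] V} {g : G}
    (h : ∀ i, d i = g → f (b i) = f' (b i)) {x : L} (hx : x ∈ 𝓛 g) : f x = f' x := by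
  rw [hspan] at hx
  induction hx using Submodule.span_induction with
  | mem x hx => obtain ⟨i, hi, rfl⟩ := hx; exact h i hi
  | zero => rw [map_zero, map_zero]
  | add x y _ _ hx hy => rw [map_add, map_add, hx, hy]
  | smul r x _ hx => rw [map_smul, map_smul, hx]

/-- The linear map on `L` that multiplies elements of degree `g` by `ε(a, g)`, followed by the
canonical map to `U(L)`. -/
def twistAux (a : G) : L →ₗ[K] Enveloping ε 𝓛 br :=
  b.constr K fun i => ε.val a (d i) • Enveloping.incl ε 𝓛 br (b i)

include hspan in
theorem twistAux_apply (a : G) {g : G} {x : L} (hx : x ∈ 𝓛 g) :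
    twistAux ε 𝓛 br b d a x = ε.val a g • Enveloping.incl ε 𝓛 br x :=
  apply_eq_of_basis hspan (f' := ε.val a g • Enveloping.incl ε 𝓛 br)
    (fun i hi => by rw [twistAux, Module.Basis.constr_basis, hi, LinearMap.smul_apply]) hx

include hspan hbr in
theorem exists_twist (a : G) : ∃ τ : Enveloping ε 𝓛 br →ₐ[K] Enveloping ε 𝓛 br,
    ∀ {g : G} {x : L}, x ∈ 𝓛 g →
      τ (Enveloping.incl ε 𝓛 br x) = ε.val a g • Enveloping.incl ε 𝓛 br x := by
  refine ⟨Enveloping.lift ε 𝓛 br (twistAux ε 𝓛 br b d a) fun {g h x y} hx hy => ?_,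
    fun hx => by rw [Enveloping.lift_incl, twistAux_apply ε 𝓛 br b d hspan a hx]⟩
  rw [twistAux_apply ε 𝓛 br b d hspan a hx, twistAux_apply ε 𝓛 br b d hspan a hy,
    twistAux_apply ε 𝓛 br b d hspan a (hbr.degree hx hy), smul_mul_smul_comm, smul_mul_smul_comm,
    Enveloping.incl_mul_incl ε 𝓛 br hx hy, ε.val_add_right]
  module

end

section

variable {G : Type*} [AddCommGroup G] {K : Type*} [Field K] {ε : Bicharacter G K}
  {L : Type*} [AddCommGroup L] [Module K L] {𝓛 : G → Submodule K L} {br : L →ₗ[K] L →ₗ[K] L}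
  {m : ℕ} {b : Module.Basis (Fin m) K L} {d : Fin m → G}
  (hspan : ∀ g, 𝓛 g = Submodule.span K (b '' {i | d i = g}))
  (hbr : IsColorLieBracket ε 𝓛 br)

/-- The automorphism of `U(L)` that multiplies elements of degree `g` by `ε(a, g)`. -/
def twist (a : G) : Enveloping ε 𝓛 br →ₐ[K] Enveloping ε 𝓛 br :=
  (exists_twist ε 𝓛 br b d hspan hbr a).choose

theorem twist_incl (a : G) {g : G} {x : L} (hx : x ∈ 𝓛 g) :
    twist hspan hbr a (Enveloping.incl ε 𝓛 br x) = ε.val a g • Enveloping.incl ε 𝓛 br x :=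
  (exists_twist ε 𝓛 br b d hspan hbr a).choose_spec hx

theorem twist_incl_basis (a : G) (i : Fin m) :
    twist hspan hbr a (Enveloping.incl ε 𝓛 br (b i)) =
      ε.val a (d i) • Enveloping.incl ε 𝓛 br (b i) :=
  twist_incl hspan hbr a (PBW.basis_mem 𝓛 b d hspan i)

theorem twist_twist (a c : G) (u : Enveloping ε 𝓛 br) :
    twist hspan hbr a (twist hspan hbr c u) = twist hspan hbr (a + c) u := by
  refine AlgHom.congr_fun (φ₁ := (twist hspan hbr a).comp (twist hspan hbr c))
    (Enveloping.algHom_ext fun x => ?_) u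
  refine LinearMap.congr_fun
    (f := ((twist hspan hbr a).comp (twist hspan hbr c)).toLinearMap ∘ₗ Enveloping.incl ε 𝓛 br)
    (g := (twist hspan hbr (a + c)).toLinearMap ∘ₗ Enveloping.incl ε 𝓛 br)
    (b.ext fun i => ?_) x
  change twist hspan hbr a (twist hspan hbr c (Enveloping.incl ε 𝓛 br (b i))) =
    twist hspan hbr (a + c) (Enveloping.incl ε 𝓛 br (b i))
  rw [twist_incl_basis, map_smul, twist_incl_basis, twist_incl_basis, smul_smul,
    ε.val_add_left, mul_comm]

/-- The action of an element `x` of degree `a` on `U(L) ⊗ U(L)`, as left multiplication by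
`x ⊗ 1 + 1 ⊗ x` in the color tensor product. -/
def leftMul (a : G) (x : L) :
    Module.End K (Enveloping ε 𝓛 br ⊗[K] Enveloping ε 𝓛 br) :=
  TensorProduct.map (LinearMap.mulLeft K (Enveloping.incl ε 𝓛 br x)) LinearMap.id +
    TensorProduct.map (twist hspan hbr a).toLinearMap
      (LinearMap.mulLeft K (Enveloping.incl ε 𝓛 br x))

theorem leftMul_tmul (a : G) (x : L) (u v : Enveloping ε 𝓛 br) :
    leftMul hspan hbr a x (u ⊗ₜ v) = (Enveloping.incl ε 𝓛 br x * u) ⊗ₜ v +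
      twist hspan hbr a u ⊗ₜ (Enveloping.incl ε 𝓛 br x * v) := rfl

theorem leftMul_add (a : G) (x y : L) :
    leftMul hspan hbr a (x + y) = leftMul hspan hbr a x + leftMul hspan hbr a y := by
  refine TensorProduct.ext' fun u v => ?_
  simp only [LinearMap.add_apply, leftMul_tmul, map_add, add_mul, TensorProduct.add_tmul,
    TensorProduct.tmul_add]
  abel

theorem leftMul_smul (a : G) (r : K) (x : L) :
    leftMul hspan hbr a (r • x) = r • leftMul hspan hbr a x := by
  refine TensorProduct.ext' fun u v => ?_
  simp only [LinearMap.smul_apply, leftMul_tmul, map_smul, smul_mul_assoc,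
    TensorProduct.tmul_smul, smul_add, ← TensorProduct.smul_tmul']

theorem leftMul_comm {a c : G} {x y : L} (hx : x ∈ 𝓛 a) (hy : y ∈ 𝓛 c) :
    leftMul hspan hbr a x * leftMul hspan hbr c y =
      ε.val a c • (leftMul hspan hbr c y * leftMul hspan hbr a x) +
        leftMul hspan hbr (a + c) (br x y) := by
  refine TensorProduct.ext' fun u v => ?_
  have h := ε.val_mul_swap a c
  simp only [Module.End.mul_apply, LinearMap.add_apply, LinearMap.smul_apply, leftMul_tmul,
    map_add, map_mul, twist_incl hspan hbr _ hx, twist_incl hspan hbr _ hy, twist_twist,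
    add_comm c a, ← mul_assoc, Enveloping.incl_mul_incl ε 𝓛 br hx hy, add_mul, smul_mul_assoc,
    TensorProduct.add_tmul, TensorProduct.tmul_add, TensorProduct.tmul_smul,
    ← TensorProduct.smul_tmul']
  match_scalars <;> first
    | ring1
    | linear_combination (norm := ring1) -h

/-- The linear extension of `leftMul` from the homogeneous basis. -/
def diagAux : L →ₗ[K] Module.End K (Enveloping ε 𝓛 br ⊗[K] Enveloping ε 𝓛 br) :=
  b.constr K fun i => leftMul hspan hbr (d i) (b i)

theorem diagAux_apply {a : G} {x : L} (hx : x ∈ 𝓛 a) :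
    diagAux hspan hbr x = leftMul hspan hbr a x :=
  apply_eq_of_basis hspan (f' :=
    { toFun := leftMul hspan hbr a
      map_add' := leftMul_add hspan hbr a
      map_smul' := leftMul_smul hspan hbr a })
    (fun i hi => by rw [diagAux, Module.Basis.constr_basis, hi]; rfl) hx

theorem diagAux_comm {a c : G} {x y : L} (hx : x ∈ 𝓛 a) (hy : y ∈ 𝓛 c) :
    diagAux hspan hbr x * diagAux hspan hbr y =
      ε.val a c • (diagAux hspan hbr y * diagAux hspan hbr x) + diagAux hspan hbr (br x y) := by
  rw [diagAux_apply hspan hbr hx, diagAux_apply hspan hbr hy,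
    diagAux_apply hspan hbr (hbr.degree hx hy), leftMul_comm hspan hbr hx hy]

/-- The action of `U(L)` on `U(L) ⊗ U(L)` through the coproduct. -/
def diag : Enveloping ε 𝓛 br →ₐ[K] Module.End K (Enveloping ε 𝓛 br ⊗[K] Enveloping ε 𝓛 br) :=
  Enveloping.lift ε 𝓛 br (diagAux hspan hbr) (diagAux_comm hspan hbr)

theorem diag_incl {a : G} {x : L} (hx : x ∈ 𝓛 a) :
    diag hspan hbr (Enveloping.incl ε 𝓛 br x) = leftMul hspan hbr a x := by
  rw [diag, Enveloping.lift_incl ε 𝓛 br _ (diagAux_comm hspan hbr), diagAux_apply hspan hbr hx]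

/-- The second Adams operation of `U(L)`: the coproduct followed by the product. -/
def adams : Enveloping ε 𝓛 br →ₗ[K] Enveloping ε 𝓛 br :=
  LinearMap.mul' K _ ∘ₗ LinearMap.applyₗ (1 ⊗ₜ[K] 1) ∘ₗ (diag hspan hbr).toLinearMap

theorem adams_apply (u : Enveloping ε 𝓛 br) :
    adams hspan hbr u = LinearMap.mul' K _ (diag hspan hbr u (1 ⊗ₜ[K] 1)) := rfl

theorem adams_one : adams hspan hbr 1 = 1 := by
  rw [adams_apply, map_one, Module.End.one_apply, LinearMap.mul'_apply, one_mul]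

/-- The adjoint action of an element `x` of degree `a`. -/
def ad (a : G) (x : L) : Enveloping ε 𝓛 br →ₗ[K] Enveloping ε 𝓛 br :=
  LinearMap.mulLeft K (Enveloping.incl ε 𝓛 br x) -
    LinearMap.mulRight K (Enveloping.incl ε 𝓛 br x) ∘ₗ (twist hspan hbr a).toLinearMap

theorem ad_apply (a : G) (x : L) (u : Enveloping ε 𝓛 br) : ad hspan hbr a x u =
    Enveloping.incl ε 𝓛 br x * u - twist hspan hbr a u * Enveloping.incl ε 𝓛 br x := rfl

theorem ad_mul (a : G) (x : L) (u v : Enveloping ε 𝓛 br) :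
    ad hspan hbr a x (u * v) =
      ad hspan hbr a x u * v + twist hspan hbr a u * ad hspan hbr a x v := by
  simp only [ad_apply, map_mul, sub_mul, mul_sub, mul_assoc]
  abel

theorem ad_algebraMap (a : G) (x : L) (r : K) :
    ad hspan hbr a x (algebraMap K _ r) = 0 := by
  rw [ad_apply, AlgHom.commutes, Algebra.commutes, sub_self]

theorem ad_incl {a c : G} {x y : L} (hx : x ∈ 𝓛 a) (hy : y ∈ 𝓛 c) :
    ad hspan hbr a x (Enveloping.incl ε 𝓛 br y) = Enveloping.incl ε 𝓛 br (br x y) := by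
  rw [ad_apply, twist_incl hspan hbr a hy, Enveloping.incl_mul_incl ε 𝓛 br hx hy, smul_mul_assoc,
    add_sub_cancel_left]

theorem twist_ad {a c : G} {x : L} (hx : x ∈ 𝓛 a) (u : Enveloping ε 𝓛 br) :
    ad hspan hbr a x (twist hspan hbr c u) =
      ε.val a c • twist hspan hbr c (ad hspan hbr a x u) := by
  simp only [ad_apply, map_sub, map_mul, twist_incl hspan hbr c hx, twist_twist, add_comm c a,
    smul_mul_assoc, mul_smul_comm, ← smul_sub, smul_smul, ε.val_mul_swap, one_smul]

/-- The adjoint action of an element `x` of degree `a` on `U(L) ⊗ U(L)`. -/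
def ad₂ (a : G) (x : L) : Module.End K (Enveloping ε 𝓛 br ⊗[K] Enveloping ε 𝓛 br) :=
  TensorProduct.map (ad hspan hbr a x) LinearMap.id +
    TensorProduct.map (twist hspan hbr a).toLinearMap (ad hspan hbr a x)

theorem ad₂_tmul (a : G) (x : L) (u v : Enveloping ε 𝓛 br) :
    ad₂ hspan hbr a x (u ⊗ₜ v) =
      ad hspan hbr a x u ⊗ₜ v + twist hspan hbr a u ⊗ₜ ad hspan hbr a x v := rfl

theorem mul'_ad₂ (a : G) (x : L) (w : Enveloping ε 𝓛 br ⊗[K] Enveloping ε 𝓛 br) :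
    LinearMap.mul' K _ (ad₂ hspan hbr a x w) = ad hspan hbr a x (LinearMap.mul' K _ w) := by
  induction w using TensorProduct.induction_on with
  | zero => simp only [map_zero]
  | tmul u v => rw [ad₂_tmul, map_add, LinearMap.mul'_apply, LinearMap.mul'_apply,
      LinearMap.mul'_apply, ad_mul]
  | add v w hv hw => simp only [map_add, hv, hw]

theorem ad₂_leftMul {a c : G} {x y : L} (hx : x ∈ 𝓛 a) (hy : y ∈ 𝓛 c)
    (w : Enveloping ε 𝓛 br ⊗[K] Enveloping ε 𝓛 br) :
    ad₂ hspan hbr a x (leftMul hspan hbr c y w) = leftMul hspan hbr (a + c) (br x y) w +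
      ε.val a c • leftMul hspan hbr c y (ad₂ hspan hbr a x w) := by
  induction w using TensorProduct.induction_on with
  | zero => simp only [map_zero, smul_zero, add_zero]
  | tmul u v =>
    simp only [leftMul_tmul, ad₂_tmul, map_add, ad_mul, ad_incl hspan hbr hx hy, map_mul,
      twist_incl hspan hbr _ hy, twist_ad hspan hbr hx, twist_twist, add_comm c a, smul_mul_assoc,
      TensorProduct.add_tmul, TensorProduct.tmul_add, TensorProduct.tmul_smul,
      ← TensorProduct.smul_tmul']
    module
  | add v w hv hw =>
    simp only [map_add, hv, hw]
    module

theorem ad₂_diag {a : G} {x : L} (hx : x ∈ 𝓛 a) (u : Enveloping ε 𝓛 br)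
    (w : Enveloping ε 𝓛 br ⊗[K] Enveloping ε 𝓛 br) :
    ad₂ hspan hbr a x (diag hspan hbr u w) = diag hspan hbr (ad hspan hbr a x u) w +
      diag hspan hbr (twist hspan hbr a u) (ad₂ hspan hbr a x w) := by
  induction u using Enveloping.induction generalizing w with
  | algebraMap r =>
    rw [ad_algebraMap, AlgHom.commutes, AlgHom.commutes, AlgHom.commutes, map_zero,
      LinearMap.zero_apply, zero_add, Module.algebraMap_end_apply, Module.algebraMap_end_apply,
      map_smul]
  | incl y =>
    induction b.mem_span y using Submodule.span_induction with
    | mem y hy =>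
      obtain ⟨i, rfl⟩ := hy
      have hi := PBW.basis_mem 𝓛 b d hspan i
      rw [ad_incl hspan hbr hx hi, diag_incl hspan hbr hi,
        diag_incl hspan hbr (hbr.degree hx hi), twist_incl hspan hbr a hi, map_smul,
        diag_incl hspan hbr hi, ad₂_leftMul hspan hbr hx hi, LinearMap.smul_apply]
    | zero => simp only [map_zero, LinearMap.zero_apply, add_zero]
    | add y z _ _ hy hz =>
      simp only [map_add, LinearMap.add_apply] at hy hz ⊢
      rw [hy, hz]
      abel
    | smul r y _ hy =>
      simp only [map_smul, LinearMap.smul_apply] at hy ⊢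
      rw [hy, smul_add]
  | mul u v hu hv =>
    simp only [map_mul, Module.End.mul_apply, hu, hv, ad_mul, map_add, LinearMap.add_apply,
      add_assoc]
  | add u v hu hv =>
    simp only [map_add, LinearMap.add_apply, hu, hv]
    abel

/-- The Adams operation is equivariant for the adjoint action. -/
theorem adams_ad {a : G} {x : L} (hx : x ∈ 𝓛 a) (u : Enveloping ε 𝓛 br) :
    adams hspan hbr (ad hspan hbr a x u) = ad hspan hbr a x (adams hspan hbr u) := by
  have h := ad₂_diag hspan hbr hx u (1 ⊗ₜ[K] 1)
  have h1 : ad hspan hbr a x 1 = 0 := by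
    simpa using ad_algebraMap hspan hbr a x (1 : K)
  rw [ad₂_tmul, h1, TensorProduct.zero_tmul, TensorProduct.tmul_zero, add_zero, map_zero,
    add_zero] at h
  rw [adams_apply, adams_apply, ← h, mul'_ad₂]

end

/-! ### The Adams operation and the standard filtration -/

section

variable {G : Type*} [AddCommGroup G] {K : Type*} [Field K] {ε : Bicharacter G K}
  {L : Type*} [AddCommGroup L] [Module K L] {𝓛 : G → Submodule K L} {br : L →ₗ[K] L →ₗ[K] L}
  {m : ℕ} {b : Module.Basis (Fin m) K L} {d : Fin m → G}
  (hspan : ∀ g, 𝓛 g = Submodule.span K (b '' {i | d i = g}))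
  (hbr : IsColorLieBracket ε 𝓛 br)

variable (ε 𝓛 br) in
/-- The span of the products of fewer than `n` homogeneous elements of `L` whose degrees add up
to `g`. -/
def filt (n : ℕ) (g : G) : Submodule K (Enveloping ε 𝓛 br) :=
  Submodule.span K {u | ∃ l : List (G × L), (∀ p ∈ l, p.2 ∈ 𝓛 p.1) ∧ l.length < n ∧
    (l.map Prod.fst).sum = g ∧ u = (l.map fun p => Enveloping.incl ε 𝓛 br p.2).prod}

theorem prod_mem_filt {l : List (G × L)} (hl : ∀ p ∈ l, p.2 ∈ 𝓛 p.1) {n : ℕ} (hn : l.length < n) :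
    (l.map fun p => Enveloping.incl ε 𝓛 br p.2).prod ∈ filt ε 𝓛 br n (l.map Prod.fst).sum :=
  Submodule.subset_span ⟨l, hl, hn, rfl, rfl⟩

theorem filt_mono {n k : ℕ} (h : n ≤ k) (g : G) : filt ε 𝓛 br n g ≤ filt ε 𝓛 br k g :=
  Submodule.span_mono fun _ ⟨l, h1, h2, h3⟩ => ⟨l, h1, h2.trans_le h, h3⟩

theorem filt_le_grading (n : ℕ) (g : G) : filt ε 𝓛 br n g ≤ Enveloping.grading ε 𝓛 br g :=
  Submodule.span_mono fun _ ⟨l, h1, _, h3⟩ => ⟨l, h1, h3⟩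

theorem exists_mem_filt {g : G} {u : Enveloping ε 𝓛 br} (hu : u ∈ Enveloping.grading ε 𝓛 br g) :
    ∃ n, u ∈ filt ε 𝓛 br n g := by
  induction hu using Submodule.span_induction with
  | mem u hu =>
    obtain ⟨l, hl, rfl, rfl⟩ := hu
    exact ⟨_, prod_mem_filt hl (Nat.lt_succ_self _)⟩
  | zero => exact ⟨0, Submodule.zero_mem _⟩
  | add u v _ _ hu hv =>
    obtain ⟨n, hn⟩ := hu
    obtain ⟨k, hk⟩ := hv
    exact ⟨max n k, add_mem (filt_mono (le_max_left _ _) g hn) (filt_mono (le_max_right _ _) g hk)⟩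
  | smul r u _ hu =>
    obtain ⟨n, hn⟩ := hu
    exact ⟨n, Submodule.smul_mem _ r hn⟩

theorem mul_mem_filt {p q : ℕ} {g h : G} {u v : Enveloping ε 𝓛 br}
    (hu : u ∈ filt ε 𝓛 br (p + 1) g) (hv : v ∈ filt ε 𝓛 br (q + 1) h) :
    u * v ∈ filt ε 𝓛 br (p + q + 1) (g + h) := by
  have := Submodule.mul_mem_mul hu hv
  rw [filt, filt, Submodule.span_mul_span] at this
  refine Submodule.span_mono ?_ this
  rintro _ ⟨_, ⟨l, hl, hn, rfl, rfl⟩, _, ⟨l', hl', hn', rfl, rfl⟩, rfl⟩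
  refine ⟨l ++ l', fun p hp => ?_, by rw [List.length_append]; omega, by simp, by simp⟩
  rcases List.mem_append.1 hp with hp | hp
  exacts [hl p hp, hl' p hp]

theorem incl_mul_mem_filt {n : ℕ} {g h : G} {x : L} {u : Enveloping ε 𝓛 br} (hx : x ∈ 𝓛 g)
    (hu : u ∈ filt ε 𝓛 br n h) : Enveloping.incl ε 𝓛 br x * u ∈ filt ε 𝓛 br (n + 1) (g + h) := by
  induction hu using Submodule.span_induction with
  | mem u hu =>
    obtain ⟨l, hl, hn, rfl, rfl⟩ := hu
    refine Submodule.subset_span ⟨(g, x) :: l, fun p hp => ?_, by simpa using hn, by simp, by simp⟩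
    rcases List.mem_cons.1 hp with rfl | hp
    exacts [hx, hl p hp]
  | zero => rw [mul_zero]; exact Submodule.zero_mem _
  | add u v _ _ hu hv => rw [mul_add]; exact add_mem hu hv
  | smul r u _ hu => rw [mul_smul_comm]; exact Submodule.smul_mem _ r hu

theorem twist_apply (a : G) {g : G} {u : Enveloping ε 𝓛 br}
    (hu : u ∈ Enveloping.grading ε 𝓛 br g) : twist hspan hbr a u = ε.val a g • u := by
  induction hu using Submodule.span_induction with
  | mem u hu =>
    obtain ⟨l, hl, rfl, rfl⟩ := hu
    induction l with
    | nil =>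
      have : ε.val a 0 = 1 := by
        have h := ε.val_add_right a 0 0
        rw [add_zero] at h
        have h' : ε.val a 0 ≠ 0 := Units.ne_zero _
        exact (mul_eq_left₀ h').1 h.symm
      simp [this]
    | cons p l ih =>
      rw [List.map_cons, List.prod_cons, map_mul, ih fun q hq => hl q (List.mem_cons_of_mem _ hq),
        twist_incl hspan hbr a (hl p (by simp)), smul_mul_smul_comm, ← ε.val_add_right,
        List.map_cons, List.sum_cons]
  | zero => simp
  | add u v _ _ hu hv => rw [map_add, hu, hv, smul_add]
  | smul r u _ hu => rw [map_smul, hu, smul_comm]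

theorem ad_eq_adjointAction {a c : G} (x : L) {u : Enveloping ε 𝓛 br}
    (hu : u ∈ Enveloping.grading ε 𝓛 br c) :
    adjointAction ε 𝓛 br a c x u = ad hspan hbr a x u := by
  rw [ad_apply, twist_apply hspan hbr a hu, smul_mul_assoc]
  rfl

theorem ad_mem_filt {n : ℕ} {a g : G} {x : L} (hx : x ∈ 𝓛 a) {u : Enveloping ε 𝓛 br}
    (hu : u ∈ filt ε 𝓛 br n g) : ad hspan hbr a x u ∈ filt ε 𝓛 br n (a + g) := by
  induction hu using Submodule.span_induction with
  | mem u hu =>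
    obtain ⟨l, hl, hn, rfl, rfl⟩ := hu
    refine filt_mono (Nat.succ_le_of_lt hn) _ ?_
    clear hn
    induction l with
    | nil =>
      have := ad_algebraMap hspan hbr a x (1 : K)
      rw [map_one] at this
      simp only [List.map_nil, List.prod_nil, this]
      exact Submodule.zero_mem _
    | cons p l ih =>
      have hl' := fun q hq => hl q (List.mem_cons_of_mem p hq)
      have hp := hl p (by simp)
      simp only [List.map_cons, List.prod_cons, List.sum_cons, List.length_cons]
      rw [ad_mul, ad_incl hspan hbr hx hp, twist_incl hspan hbr a hp, smul_mul_assoc]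
      refine add_mem ?_ (Submodule.smul_mem _ _ ?_)
      · rw [← add_assoc]
        exact incl_mul_mem_filt (hbr.degree hx hp) (prod_mem_filt hl' (Nat.lt_succ_self _))
      · rw [add_left_comm]
        exact incl_mul_mem_filt hp (ih hl')
  | zero => simp
  | add u v _ _ hu hv => rw [map_add]; exact add_mem hu hv
  | smul r u _ hu => rw [map_smul]; exact Submodule.smul_mem _ r hu

variable (ε 𝓛 br) in
/-- The elements of degree `g` and of filtration degree at most `n` in `U(L) ⊗ U(L)`. -/
def filt₂ (n : ℕ) (g : G) : Submodule K (Enveloping ε 𝓛 br ⊗[K] Enveloping ε 𝓛 br) :=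
  Submodule.span K {w | ∃ p q a c, ∃ u ∈ filt ε 𝓛 br (p + 1) a, ∃ v ∈ filt ε 𝓛 br (q + 1) c,
    p + q = n ∧ a + c = g ∧ w = u ⊗ₜ v}

theorem leftMul_mem_filt₂ {n : ℕ} {a g : G} {x : L} (hx : x ∈ 𝓛 a)
    {w : Enveloping ε 𝓛 br ⊗[K] Enveloping ε 𝓛 br} (hw : w ∈ filt₂ ε 𝓛 br n g) :
    leftMul hspan hbr a x w ∈ filt₂ ε 𝓛 br (n + 1) (a + g) := by
  induction hw using Submodule.span_induction with
  | mem w hw =>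
    obtain ⟨p, q, c, h, u, hu, v, hv, rfl, rfl, rfl⟩ := hw
    rw [leftMul_tmul, twist_apply hspan hbr a (filt_le_grading _ _ hu), ← TensorProduct.smul_tmul']
    refine add_mem (Submodule.subset_span ?_)
      (Submodule.smul_mem _ _ (Submodule.subset_span ?_))
    · exact ⟨p + 1, q, a + c, h, _, incl_mul_mem_filt hx hu, v, hv, by omega, add_assoc _ _ _, rfl⟩
    · exact ⟨p, q + 1, c, a + h, u, hu, _, incl_mul_mem_filt hx hv, by omega,
        add_left_comm _ _ _, rfl⟩
  | zero => simp
  | add u v _ _ hu hv => rw [map_add]; exact add_mem hu hv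
  | smul r u _ hu => rw [map_smul]; exact Submodule.smul_mem _ r hu

/-- Up to terms of lower filtration degree, the two summands of `x ⊗ 1 + 1 ⊗ x` have the same
effect after multiplication. -/
theorem mul'_leftMul_sub_mem {n : ℕ} {a g : G} {x : L} (hx : x ∈ 𝓛 a)
    {w : Enveloping ε 𝓛 br ⊗[K] Enveloping ε 𝓛 br} (hw : w ∈ filt₂ ε 𝓛 br n g) :
    LinearMap.mul' K _ (leftMul hspan hbr a x w) -
      (2 : K) • (Enveloping.incl ε 𝓛 br x * LinearMap.mul' K _ w) ∈
        filt ε 𝓛 br (n + 1) (a + g) := by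
  induction hw using Submodule.span_induction with
  | mem w hw =>
    obtain ⟨p, q, c, h, u, hu, v, hv, rfl, rfl, rfl⟩ := hw
    have : LinearMap.mul' K _ (leftMul hspan hbr a x (u ⊗ₜ v)) -
        (2 : K) • (Enveloping.incl ε 𝓛 br x * LinearMap.mul' K _ (u ⊗ₜ v)) =
        -(ad hspan hbr a x u * v) := by
      rw [leftMul_tmul, map_add, LinearMap.mul'_apply, LinearMap.mul'_apply, LinearMap.mul'_apply,
        ad_apply, two_smul, sub_mul, mul_assoc, mul_assoc]
      abel
    rw [this, ← add_assoc]
    exact neg_mem (mul_mem_filt (ad_mem_filt hspan hbr hx hu) hv)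
  | zero => simp
  | add u v _ _ hu hv =>
    simp only [map_add, mul_add, smul_add]
    rw [add_sub_add_comm]
    exact add_mem hu hv
  | smul r u _ hu =>
    simp only [map_smul, mul_smul_comm]
    rw [smul_comm (2 : K) r, ← smul_sub]
    exact Submodule.smul_mem _ r hu

/-- The Adams operation on a product of `n` homogeneous elements of `L` is multiplication by `2ⁿ`,
up to terms of lower filtration degree. The first part makes the induction possible. -/
theorem adams_prod {l : List (G × L)} (hl : ∀ p ∈ l, p.2 ∈ 𝓛 p.1) :
    diag hspan hbr (l.map fun p => Enveloping.incl ε 𝓛 br p.2).prod (1 ⊗ₜ[K] 1) ∈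
        filt₂ ε 𝓛 br l.length (l.map Prod.fst).sum ∧
      adams hspan hbr (l.map fun p => Enveloping.incl ε 𝓛 br p.2).prod -
        (2 : K) ^ l.length • (l.map fun p => Enveloping.incl ε 𝓛 br p.2).prod ∈
          filt ε 𝓛 br l.length (l.map Prod.fst).sum := by
  induction l with
  | nil =>
    have h1 : (1 : Enveloping ε 𝓛 br) ∈ filt ε 𝓛 br (0 + 1) 0 :=
      prod_mem_filt (l := []) (by simp) Nat.one_pos
    refine ⟨?_, ?_⟩
    · simp only [List.map_nil, List.prod_nil, map_one, Module.End.one_apply]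
      exact Submodule.subset_span ⟨0, 0, 0, 0, 1, h1, 1, h1, rfl, add_zero _, rfl⟩
    · simp only [List.map_nil, List.prod_nil, adams_one, List.length_nil, pow_zero, one_smul,
        sub_self]
      exact Submodule.zero_mem _
  | cons p l ih =>
    have hp := hl p (by simp)
    obtain ⟨h1, h2⟩ := ih fun q hq => hl q (List.mem_cons_of_mem p hq)
    simp only [List.map_cons, List.prod_cons, List.sum_cons, List.length_cons]
    rw [adams_apply, map_mul, Module.End.mul_apply, diag_incl hspan hbr hp]
    refine ⟨leftMul_mem_filt₂ hspan hbr hp h1, ?_⟩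
    have h3 := add_mem (mul'_leftMul_sub_mem hspan hbr hp h1)
      (Submodule.smul_mem _ (2 : K) (incl_mul_mem_filt hp h2))
    rw [← adams_apply, mul_sub, smul_sub, sub_add_sub_cancel, mul_smul_comm, smul_smul,
      ← pow_succ'] at h3
    exact h3

/-- On the quotient of filtration degree `n`, the Adams operation is multiplication by `2ⁿ`. -/
theorem adams_sub_mem {n : ℕ} {g : G} {u : Enveloping ε 𝓛 br}
    (hu : u ∈ filt ε 𝓛 br (n + 1) g) :
    adams hspan hbr u - (2 : K) ^ n • u ∈ filt ε 𝓛 br n g := by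
  induction hu using Submodule.span_induction with
  | mem u hu =>
    obtain ⟨l, hl, hn, rfl, rfl⟩ := hu
    have h := (adams_prod hspan hbr hl).2
    rcases (Nat.le_of_lt_succ hn).eq_or_lt with rfl | hn
    · exact h
    · have h1 := prod_mem_filt (ε := ε) (br := br) hl hn
      have h2 := add_mem (filt_mono hn.le _ h) (Submodule.smul_mem _ ((2 : K) ^ l.length) h1)
      rw [sub_add_cancel] at h2
      exact sub_mem h2 (Submodule.smul_mem _ _ h1)
  | zero => simp
  | add u v _ _ hu hv =>
    rw [map_add, smul_add, add_sub_add_comm]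
    exact add_mem hu hv
  | smul r u _ hu =>
    rw [map_smul, smul_comm _ r, ← smul_sub]
    exact Submodule.smul_mem _ r hu

theorem adams_incl (x : L) :
    adams hspan hbr (Enveloping.incl ε 𝓛 br x) = (2 : K) • Enveloping.incl ε 𝓛 br x := by
  refine LinearMap.congr_fun (f := adams hspan hbr ∘ₗ Enveloping.incl ε 𝓛 br)
    (g := (2 : K) • Enveloping.incl ε 𝓛 br) (b.ext fun i => ?_) x
  rw [LinearMap.comp_apply, adams_apply, diag_incl hspan hbr (PBW.basis_mem 𝓛 b d hspan i),
    leftMul_tmul, map_one, map_add, LinearMap.mul'_apply, LinearMap.mul'_apply, mul_one, mul_one,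
    one_mul, LinearMap.smul_apply, two_smul]

/-- The product of the operators `(ψ - 2ᵏ) / (2 - 2ᵏ)`, for `k = 0` and `2 ≤ k ≤ n + 1`, where `ψ`
is the Adams operation. It projects the part of filtration degree at most `n + 1` onto `L`. -/
def proj : ℕ → Enveloping ε 𝓛 br →ₗ[K] Enveloping ε 𝓛 br
  | 0 => adams hspan hbr - LinearMap.id
  | n + 1 => ((2 : K) - 2 ^ (n + 2))⁻¹ •
      (proj n ∘ₗ (adams hspan hbr - (2 : K) ^ (n + 2) • LinearMap.id))

theorem proj_succ_apply (n : ℕ) (u : Enveloping ε 𝓛 br) : proj hspan hbr (n + 1) u =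
    ((2 : K) - 2 ^ (n + 2))⁻¹ • proj hspan hbr n (adams hspan hbr u - (2 : K) ^ (n + 2) • u) := rfl

theorem proj_ad (n : ℕ) {a : G} {x : L} (hx : x ∈ 𝓛 a) (u : Enveloping ε 𝓛 br) :
    proj hspan hbr n (ad hspan hbr a x u) = ad hspan hbr a x (proj hspan hbr n u) := by
  induction n generalizing u with
  | zero =>
    rw [proj, LinearMap.sub_apply, LinearMap.sub_apply, adams_ad hspan hbr hx, map_sub]
    rfl
  | succ n ih =>
    have h : adams hspan hbr (ad hspan hbr a x u) - (2 : K) ^ (n + 2) • ad hspan hbr a x u =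
        ad hspan hbr a x (adams hspan hbr u - (2 : K) ^ (n + 2) • u) := by
      rw [adams_ad hspan hbr hx, map_sub, map_smul]
    rw [proj_succ_apply, proj_succ_apply, h, ih, map_smul]

theorem proj_incl [CharZero K] (n : ℕ) (x : L) :
    proj hspan hbr n (Enveloping.incl ε 𝓛 br x) = Enveloping.incl ε 𝓛 br x := by
  induction n with
  | zero =>
    rw [proj, LinearMap.sub_apply, adams_incl, LinearMap.id_apply, two_smul, add_sub_cancel_right]
  | succ n ih =>
    have h : (2 : K) - 2 ^ (n + 2) ≠ 0 := by
      rw [sub_ne_zero]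
      have : 2 ^ 1 < 2 ^ (n + 2) := Nat.pow_lt_pow_right (by norm_num) (by omega)
      exact_mod_cast this.ne
    rw [proj_succ_apply, adams_incl, ← sub_smul, map_smul, ih, smul_smul, inv_mul_cancel₀ h,
      one_smul]

theorem proj_mem (n : ℕ) {g : G} {u : Enveloping ε 𝓛 br} (hu : u ∈ filt ε 𝓛 br (n + 2) g) :
    proj hspan hbr n u ∈ (𝓛 g).map (Enveloping.incl ε 𝓛 br) := by
  induction n generalizing u with
  | zero =>
    induction hu using Submodule.span_induction with
    | mem u hu =>
      obtain ⟨l, hl, hn, rfl, rfl⟩ := hu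
      match l, hl, hn with
      | [], _, _ =>
        simp only [List.map_nil, List.prod_nil, proj, LinearMap.sub_apply, adams_one,
          LinearMap.id_apply, sub_self]
        exact Submodule.zero_mem _
      | [p], hl, _ =>
        simp only [List.map_singleton, List.prod_singleton, List.sum_singleton]
        rw [proj, LinearMap.sub_apply, adams_incl, LinearMap.id_apply, two_smul,
          add_sub_cancel_right]
        exact ⟨p.2, hl p (by simp), rfl⟩
      | _ :: _ :: _, _, hn => simp at hn
    | zero => simp
    | add u v _ _ hu hv => rw [map_add]; exact add_mem hu hv
    | smul r u _ hu => rw [map_smul]; exact Submodule.smul_mem _ r hu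
  | succ n ih =>
    rw [proj_succ_apply]
    exact Submodule.smul_mem _ _ (ih (adams_sub_mem hspan hbr hu))

include hspan hbr in
/-- A bilinear map on `L` that becomes a Chevalley-Eilenberg coboundary in the adjoint module
`U(L)` is a coboundary in `L`, since `L` is a direct summand of `U(L)`. -/
theorem exists_ceDelta₁_eq [CharZero K]
    (hinj : Function.Injective (Enveloping.incl ε 𝓛 br)) {f : L →ₗ[K] Enveloping ε 𝓛 br}
    (hf : IsDegreeZero 𝓛 (Enveloping.grading ε 𝓛 br) f) {ν : L →ₗ[K] L →ₗ[K] L}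
    (h : ∀ ⦃a c : G⦄ ⦃x y : L⦄, x ∈ 𝓛 a → y ∈ 𝓛 c → Enveloping.incl ε 𝓛 br (ν x y) =
      ceDelta₁ ε br (adjointAction ε 𝓛 br) f a c x y) :
    ∃ φ : L →ₗ[K] L, IsDegreeZero 𝓛 𝓛 φ ∧ ∀ ⦃a c : G⦄ ⦃x y : L⦄, x ∈ 𝓛 a → y ∈ 𝓛 c →
      ν x y = ceDelta₁ ε br (fun _ _ z => br z) φ a c x y := by
  have hb := PBW.basis_mem 𝓛 b d hspan
  -- `f` takes values in a single step of the filtration, since `L` is finite-dimensional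
  obtain ⟨n, hn⟩ : ∃ n, ∀ i, f (b i) ∈ filt ε 𝓛 br (n + 2) (d i) := by
    choose N hN using fun i => exists_mem_filt (hf (hb i))
    exact ⟨Finset.univ.sup N, fun i => filt_mono
      ((Finset.le_sup (Finset.mem_univ i)).trans (Nat.le_add_right _ 2)) _ (hN i)⟩
  have hn' : ∀ ⦃a : G⦄ ⦃x : L⦄, x ∈ 𝓛 a → f x ∈ filt ε 𝓛 br (n + 2) a := by
    intro a x hx
    rw [hspan] at hx
    induction hx using Submodule.span_induction with
    | mem x hx => obtain ⟨i, rfl, rfl⟩ := hx; exact hn i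
    | zero => simp
    | add x y _ _ hx hy => rw [map_add]; exact add_mem hx hy
    | smul r x _ hx => rw [map_smul]; exact Submodule.smul_mem _ r hx
  obtain ⟨q, hq⟩ := LinearMap.exists_leftInverse_of_injective _ (LinearMap.ker_eq_bot.2 hinj)
  have hφ : ∀ ⦃a : G⦄ ⦃x : L⦄, x ∈ 𝓛 a → q (proj hspan hbr n (f x)) ∈ 𝓛 a ∧
      Enveloping.incl ε 𝓛 br (q (proj hspan hbr n (f x))) = proj hspan hbr n (f x) := by
    intro a x hx
    obtain ⟨y, hy, hy'⟩ := proj_mem hspan hbr n (hn' hx)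
    have : q (Enveloping.incl ε 𝓛 br y) = y := LinearMap.congr_fun hq y
    rw [← hy', this]
    exact ⟨hy, rfl⟩
  refine ⟨q ∘ₗ proj hspan hbr n ∘ₗ f, fun a x hx => (hφ hx).1, fun a c x y hx hy => hinj ?_⟩
  have e := congrArg (proj hspan hbr n) (h hx hy)
  rw [proj_incl, ceDelta₁, ad_eq_adjointAction hspan hbr x (hf hy),
    ad_eq_adjointAction hspan hbr y (hf hx), map_sub, map_sub, map_smul, proj_ad hspan hbr n hx,
    proj_ad hspan hbr n hy, ← (hφ hx).2, ← (hφ hy).2, ← (hφ (hbr.degree hx hy)).2,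
    ad_incl hspan hbr hx (hφ hy).1, ad_incl hspan hbr hy (hφ hx).1] at e
  rw [e, ceDelta₁, map_sub, map_sub, map_smul]
  rfl

end

end Adams

/-! ### First order terms of deformations -/

section FirstOrder

variable {G : Type*} [AddCommGroup G] {K : Type*} [Field K] {A : Type*} [Ring A] [Algebra K A]
    {𝓐 : G → Submodule K A}

theorem IsAssocDeformation.isHochschildCocycle₂ {π : ℕ → A →ₗ[K] A →ₗ[K] A}
    (hπ : IsAssocDeformation 𝓐 π) : IsHochschildCocycle₂ 𝓐 (π 1) := by
  refine ⟨hπ.degree 1, fun u v w => ?_⟩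
  have h := congrArg (fun s : Series A => s.coeff 1)
    (hπ.assoc (Series.const u) (Series.const v) (Series.const w))
  have h1 : Finset.HasAntidiagonal.antidiagonal 1 = {((0 : ℕ), (1 : ℕ)), (1, 0)} := rfl
  simp [Series.coeff_map₂, h1, Series.const, hπ.zero] at h
  rw [hochschildDelta₂, ← sub_eq_zero_of_eq h.symm]
  abel

omit [AddCommGroup G] in
/-- The first order term of a trivial deformation is a coboundary. -/
theorem IsTrivialDeformation.isHochschildCoboundary₂ {π : ℕ → A →ₗ[K] A →ₗ[K] A}
    (h0 : ∀ u v, π 0 u v = u * v) (hπ : IsTrivialDeformation 𝓐 π) :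
    IsHochschildCoboundary₂ 𝓐 (π 1) := by
  obtain ⟨φ, hφ⟩ := hπ
  refine ⟨φ 1, hφ.degree 1, fun u v => ?_⟩
  have h := congrArg (fun s : Series A => s.coeff 1)
    (hφ.map_mul (Series.const u) (Series.const v))
  have h1 : Finset.HasAntidiagonal.antidiagonal 1 = {((0 : ℕ), (1 : ℕ)), (1, 0)} := rfl
  simp [Series.coeff_map₂, Series.coeff_map, h1, Series.const, hφ.zero, h0] at h
  rw [hochschildDelta₁, ← sub_eq_iff_eq_add.2 h.symm]
  abel

end FirstOrder

section

variable {G : Type*} [AddCommGroup G] {K : Type*} [Field K] {ε : Bicharacter G K} {L : Type*}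
    [AddCommGroup L] [Module K L] {𝓛 : G → Submodule K L} {br : L →ₗ[K] L →ₗ[K] L}

/-- The color antisymmetrization of a Hochschild coboundary is a Chevalley-Eilenberg coboundary,
with values in the adjoint module `U(L)`. -/
theorem hochschildDelta₁_sub_eq_ceDelta₁ (f : Enveloping ε 𝓛 br →ₗ[K] Enveloping ε 𝓛 br)
    {a c : G} {x y : L} (hx : x ∈ 𝓛 a) (hy : y ∈ 𝓛 c) :
    hochschildDelta₁ f (Enveloping.incl ε 𝓛 br x) (Enveloping.incl ε 𝓛 br y) -
        ε.val a c • hochschildDelta₁ f (Enveloping.incl ε 𝓛 br y) (Enveloping.incl ε 𝓛 br x) =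
      ceDelta₁ ε br (adjointAction ε 𝓛 br) (f ∘ₗ Enveloping.incl ε 𝓛 br) a c x y := by
  simp only [hochschildDelta₁, ceDelta₁, adjointAction, colorCommutator, LinearMap.mul_apply',
    LinearMap.comp_apply]
  rw [Enveloping.incl_mul_incl ε 𝓛 br hx hy, map_add, map_smul]
  simp only [smul_add, smul_sub, smul_smul, ε.val_mul_swap, one_smul]
  abel

theorem Enveloping.incl_injective {m : ℕ} (b : Module.Basis (Fin m) K L) {d : Fin m → G}
    (hB : IsBasis K (monomial ε 𝓛 br b d)) : Function.Injective (Enveloping.incl ε 𝓛 br) := by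
  have h := hB.1.comp
    (fun i => (⟨[i], List.isChain_singleton i⟩ : PBWIndex ε d)) fun i k h => by
      simpa using congrArg Subtype.val h
  have h' : (monomial ε 𝓛 br b d ∘ fun i => (⟨[i], List.isChain_singleton i⟩ : PBWIndex ε d)) =
      Enveloping.incl ε 𝓛 br ∘ b := by
    funext i
    exact mul_one _
  rw [h'] at h
  exact LinearMap.injective_of_linearIndependent b.span_eq h

end

end ColorLie

end

theorem mainTheorem1 {G : Type*} [AddCommGroup G] [DecidableEq G] {K : Type*} [Field K] [CharZero K]
    (ε : ColorLie.Bicharacter G K) {L : Type*} [AddCommGroup L] [Module K L]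
    [FiniteDimensional K L] (𝓛 : G → Submodule K L) (br : L →ₗ[K] L →ₗ[K] L)
    (hL : ColorLie.IsColorLieAlgebra ε 𝓛 br) (μ : ℕ → L →ₗ[K] L →ₗ[K] L)
    (hμ : ColorLie.IsLieDeformation ε 𝓛 br μ) :
    -- `μ_t` extends to a graded associative deformation of `U(L)`
    (∃ π, ColorLie.IsExtension ε 𝓛 br μ π ∧ ColorLie.IsUnital ε 𝓛 br π) ∧
    -- uniqueness, up to a unique equivalence that is the identity on `L`
    (∀ π π', ColorLie.IsExtension ε 𝓛 br μ π → ColorLie.IsExtension ε 𝓛 br μ π' →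
      ∃! φ, ColorLie.IsEquivalence (ColorLie.Enveloping.grading ε 𝓛 br) π π' φ ∧
        ∀ n, n ≠ 0 → ∀ x : L, φ n (ColorLie.Enveloping.incl ε 𝓛 br x) = 0) ∧
    -- for every ordered homogeneous basis, the transport of the product of `U(L[[t]])` along the
    -- Poincaré-Birkhoff-Witt bases is the unique extension that keeps the ordered monomials
    (∀ (m : ℕ) (b : Module.Basis (Fin m) K L) (d : Fin m → G), (∀ i, b i ∈ 𝓛 (d i)) →
      ColorLie.IsBasis K (ColorLie.monomial ε 𝓛 br b d) ∧
      ColorLie.IsBasis (PowerSeries K) (ColorLie.deformedMonomial ε 𝓛 μ b d) ∧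
      ∃ π, ColorLie.IsTransport ε 𝓛 br μ π b d ∧
        (ColorLie.IsExtension ε 𝓛 br μ π ∧ ColorLie.IsUnital ε 𝓛 br π ∧
          ∀ I : ColorLie.PBWIndex ε d, ColorLie.starMonomial ε 𝓛 br π b I.1
            = ColorLie.Series.const (ColorLie.monomial ε 𝓛 br b d I)) ∧
        ∀ π', (ColorLie.IsExtension ε 𝓛 br μ π' ∧ ColorLie.IsUnital ε 𝓛 br π' ∧
          ∀ I : ColorLie.PBWIndex ε d, ColorLie.starMonomial ε 𝓛 br π' b I.1
            = ColorLie.Series.const (ColorLie.monomial ε 𝓛 br b d I)) → π' = π) ∧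
    -- `π₁` is a Hochschild cocycle, and it antisymmetrizes to `μ₁`
    (∀ π, ColorLie.IsExtension ε 𝓛 br μ π →
      ColorLie.IsHochschildCocycle₂ (ColorLie.Enveloping.grading ε 𝓛 br) (π 1) ∧
      ∀ ⦃a b : G⦄ ⦃x y : L⦄, x ∈ 𝓛 a → y ∈ 𝓛 b →
        ColorLie.colorCommutator ε (π 1) a b (ColorLie.Enveloping.incl ε 𝓛 br x)
            (ColorLie.Enveloping.incl ε 𝓛 br y)
          = ColorLie.Enveloping.incl ε 𝓛 br (μ 1 x y)) ∧
    -- a Hochschild coboundary antisymmetrizes to a Chevalley-Eilenberg coboundary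
    (∀ f : ColorLie.Enveloping ε 𝓛 br →ₗ[K] ColorLie.Enveloping ε 𝓛 br,
      ColorLie.IsDegreeZero (ColorLie.Enveloping.grading ε 𝓛 br)
        (ColorLie.Enveloping.grading ε 𝓛 br) f →
      ∀ ⦃a b : G⦄ ⦃x y : L⦄, x ∈ 𝓛 a → y ∈ 𝓛 b →
        ColorLie.hochschildDelta₁ f (ColorLie.Enveloping.incl ε 𝓛 br x)
            (ColorLie.Enveloping.incl ε 𝓛 br y)
          - ε.val a b • ColorLie.hochschildDelta₁ f (ColorLie.Enveloping.incl ε 𝓛 br y)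
            (ColorLie.Enveloping.incl ε 𝓛 br x)
          = ColorLie.ceDelta₁ ε br (ColorLie.adjointAction ε 𝓛 br)
            (f ∘ₗ ColorLie.Enveloping.incl ε 𝓛 br) a b x y) ∧
    -- if the class of `μ₁` in `H²(L, L)_e` is nonzero, every extension is nontrivial
    (hμ.infinitesimalClass ≠ 0 → ∀ π, ColorLie.IsExtension ε 𝓛 br μ π →
      ¬ ColorLie.IsTrivialDeformation (ColorLie.Enveloping.grading ε 𝓛 br) π ∧
      ¬ ColorLie.IsHochschildCoboundary₂ (ColorLie.Enveloping.grading ε 𝓛 br) (π 1)) := by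
  obtain ⟨m, b, d, hb⟩ := ColorLie.exists_homogeneous_basis hL.isInternal
  have hbr := hL.isBracket
  have hspan := ColorLie.eq_span_of_isInternal hL.isInternal b d hb
  -- a coboundary `π₁` antisymmetrizes to a coboundary in `U(L)`, hence `μ₁` is one in `L`
  have hcob : ∀ π, ColorLie.IsExtension ε 𝓛 br μ π →
      ColorLie.IsHochschildCoboundary₂ (ColorLie.Enveloping.grading ε 𝓛 br) (π 1) →
      hμ.infinitesimalClass = 0 := by
    rintro π hπ ⟨f, hf, hπf⟩
    have hinj := ColorLie.Enveloping.incl_injective b (ColorLie.PBW.isBasis_monomial ε 𝓛 br b d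
      hspan hbr (fun i => ε.val_self (d i)) (ColorLie.isUnit_ofNat 2) (ColorLie.isUnit_ofNat 3))
    obtain ⟨φ, hφ, hφ'⟩ := ColorLie.Adams.exists_ceDelta₁_eq hspan hbr hinj (ν := μ 1)
      (f := f ∘ₗ ColorLie.Enveloping.incl ε 𝓛 br)
      (fun a x hx => hf (ColorLie.Enveloping.incl_mem_grading ε 𝓛 br hx)) fun a c x y hx hy => by
        rw [← ColorLie.hochschildDelta₁_sub_eq_ceDelta₁ f hx hy, ← hπf, ← hπf]
        exact (hπ.commutator 1 hx hy).symm
    exact (Submodule.Quotient.mk_eq_zero _).2 ⟨hμ.mem_cochains 1, φ, hφ, hφ'⟩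
  refine ⟨?_, fun π π' hπ hπ' => ColorLie.existsUnique_isEquivalence hspan hbr hμ hπ hπ',
    fun m b d hb => ?_, fun π hπ => ⟨hπ.isDeformation.isHochschildCocycle₂, hπ.commutator 1⟩,
    fun f _ a c x y hx hy => ColorLie.hochschildDelta₁_sub_eq_ceDelta₁ f hx hy,
    fun hne π hπ => ⟨fun h => hne (hcob π hπ (h.isHochschildCoboundary₂ hπ.isDeformation.zero)),
      fun h => hne (hcob π hπ h)⟩⟩
  · obtain ⟨π, -, hπ, hπ', -⟩ := ColorLie.exists_transport hspan hbr hμ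
    exact ⟨π, hπ, hπ'⟩
  · have hspan := ColorLie.eq_span_of_isInternal hL.isInternal b d hb
    obtain ⟨π, hπ, hπ', hπ₁, j, hj, hj'⟩ := ColorLie.exists_transport hspan hbr hμ
    have h1 : j 1 = ColorLie.Series.const 1 := hj' (ColorLie.PBW.nil ε d)
    exact ⟨ColorLie.PBW.isBasis_monomial ε 𝓛 br b d hspan hbr (fun i => ε.val_self (d i))
        (ColorLie.isUnit_ofNat 2) (ColorLie.isUnit_ofNat 3),
      ColorLie.isBasis_deformedMonomial ε 𝓛 b d hspan μ hμ.isBracket, π, hπ,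
      ⟨hπ', hπ₁, fun I => (hj.starMonomial_eq b h1 I.1).trans (hj' I)⟩,
      fun π' h => ColorLie.eq_of_starMonomial_eq hspan hbr hμ hj hj' h.1 h.2.1 h.2.2⟩
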